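/- **Sublinear-time kernelization.** All graphs are finite, simple and undirected. For a graph $G=(V,E)$ with $n$ vertices and $m$ edges, $N(v)$ is the neighbourhood of $v$ and $N[v]=N(v)\cup\{v\}$; $\log$ and $\ln$ both denote the natural logarithm. A *vertex cut* of a graph is a partition $(L,S,R)$ of its vertex set with $L,R\neq\emptyset$ and no edge between $L$ and $R$. For vertex sets $A,B$ it is an $(A,B)$-vertex cut if $A\subseteq L$ and $B\subseteq R$; its set $S$ is then an *$(A,B)$-separator*, and an *$(A,B)$-min-separator* if $|S|$ is minimum among all $(A,B)$-separators (singletons are written without braces). A vertex cut $(L,S,R)$ of $G$ is a *$k$-scratch* if $|S|<k$, $|L|\le k/(100\log n)$ and $|\{v\in S:\deg(v)\le 8k\}|\ge 300|L|\ln n$. There are a randomized algorithm on a word RAM with words of $O(\log n)$ bits and constants $C,d$ such that the following holds. Let $G$ be a graph with $n$ vertices and $m$ edges, given by adjacency lists, let $k$ be an integer such that every vertex of $G$ has degree at least $k$, let $\tilde\ell\ge 1$ be an integer with $\tilde\ell\le k/(100\log n)$, and let $X\subseteq V$. Let $T\subseteq V$ be obtained by including each vertex independently with probability $1/(8\tilde\ell)$,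 and let $T_x=T\setminus N[x]$ for $x\in X$. On input $(G,k,\tilde\ell,X,T)$ the algorithm always halts within $C\,(m+|X|k\tilde\ell)(\log n)^d=\tilde O(m+|X|k\tilde\ell)$ steps, and with high probability, namely with probability at least $1-n^{-3}$ over $T$ and the independent random choices of the algorithm, for every $x\in X$ it does one of the following. * It outputs a *kernel* graph $G_{x,T}$ with at most $C\,k\tilde\ell\log n$ edges, whose vertices are some vertices of $G$ including $x$ and one new vertex $t_x$, together with a set $Z_{x,T}\subseteq V$ containing no vertex of $G_{x,T}$, such that the $(x,T_x)$-min-separators of $G$ are exactly the sets $Y\cup Z_{x,T}$ with $Y$ an $(x,t_x)$-min-separator of $G_{x,T}$. That is, every $(x,T_x)$-min-separator of $G$ contains $Z_{x,T}$, and a set $Y\subseteq V\setminus Z_{x,T}$ is an $(x,t_x)$-min-separator of $G_{x,T}$ if and only if $Y\cup Z_{x,T}$ is an $(x,T_x)$-min-separator of $G$. * It outputs $\bot$, and then $T_x=\emptyset$ or there is no $k$-scratch $(L,S,R)$ of $G$ with $\emptyset\ne T_x\subseteq R$, $\tilde\ell\in[|L|/2,|L|]$ and $x\in L$. -/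

import Mathlib

open MeasureTheory ProbabilityTheory

namespace WordRam

/-! ### A randomized word RAM

Programs are built from assignments, array writes, random draws and output instructions by
sequencing, branching and looping.  There are finitely many word variables and finitely many arrays
(those that occur in the program); all values are reduced modulo `W`, the number of machine words.
Evaluating a node of an expression and executing an instruction or a test cost one step each. -/

/-- Binary word operations. Subtraction is truncated at zero; comparisons return `0` or `1`. -/
inductive BinOp where
  | add | sub | mul | div | mod | lt | eq

def BinOp.eval (W : ℕ) : BinOp → ℕ → ℕ → ℕ
  | .add, a, b => (a + b) % W
  | .sub, a, b => (a - b) % W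
  | .mul, a, b => (a * b) % W
  | .div, a, b => (a / b) % W
  | .mod, a, b => (a % b) % W
  | .lt, a, b => (if a < b then 1 else 0) % W
  | .eq, a, b => (if a = b then 1 else 0) % W

inductive Expr where
  /-- a constant -/
  | lit (c : ℕ)
  /-- the content of a variable -/
  | var (x : ℕ)
  /-- the content of the array `a` at the index given by the expression -/
  | get (a : ℕ) (i : Expr)
  | bin (o : BinOp) (e₁ e₂ : Expr)

inductive Prog where
  | skip
  /-- `x := e` -/
  | set (x : ℕ) (e : Expr)
  /-- `a[i] := e` -/
  | put (a : ℕ) (i e : Expr)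
  /-- put a fresh uniformly random word into the variable `x` -/
  | rand (x : ℕ)
  /-- append a word to the output -/
  | out (e : Expr)
  | seq (p q : Prog)
  /-- `p` if the value of `e` is nonzero, `q` otherwise -/
  | ite (e : Expr) (p q : Prog)
  /-- repeat `p` while the value of `e` is nonzero -/
  | loop (e : Expr) (p : Prog)

/-- A machine state: variables, arrays, the number of random words drawn so far, and the output. -/
structure State where
  var : ℕ → ℕ
  arr : ℕ → ℕ → ℕ
  drawn : ℕ
  out : List ℕ

def Expr.eval (W : ℕ) (s : State) : Expr → ℕ
  | .lit c => c % W
  | .var x => s.var x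
  | .get a i => s.arr a (i.eval W s)
  | .bin o e₁ e₂ => o.eval W (e₁.eval W s) (e₂.eval W s)

def Expr.cost : Expr → ℕ
  | .lit _ => 1
  | .var _ => 1
  | .get _ i => i.cost + 1
  | .bin _ e₁ e₂ => e₁.cost + e₂.cost + 1

/-- `Exec ω p s s' t`: started in the state `s` with the sequence `ω` of random words, the program
`p` halts in the state `s'` after exactly `t` steps. -/
inductive Exec {W : ℕ} (ω : ℕ → Fin W) : Prog → State → State → ℕ → Prop
  | skip (s : State) : Exec ω .skip s s 1
  | set (x : ℕ) (e : Expr) (s : State) :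
      Exec ω (.set x e) s { s with var := Function.update s.var x (e.eval W s) } (e.cost + 1)
  | put (a : ℕ) (i e : Expr) (s : State) :
      Exec ω (.put a i e) s
        { s with arr := Function.update s.arr a <|
                    Function.update (s.arr a) (i.eval W s) (e.eval W s) }
        (i.cost + e.cost + 1)
  | rand (x : ℕ) (s : State) :
      Exec ω (.rand x) s
        { s with var := Function.update s.var x (ω s.drawn : ℕ), drawn := s.drawn + 1 } 1
  | out (e : Expr) (s : State) :
      Exec ω (.out e) s { s with out := s.out ++ [e.eval W s] } (e.cost + 1)
  | seq {p q : Prog} {s₁ s₂ s₃ : State} {t₁ t₂ : ℕ} :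
      Exec ω p s₁ s₂ t₁ → Exec ω q s₂ s₃ t₂ → Exec ω (.seq p q) s₁ s₃ (t₁ + t₂)
  | ite_true {e : Expr} {p q : Prog} {s s' : State} {t : ℕ} :
      e.eval W s ≠ 0 → Exec ω p s s' t → Exec ω (.ite e p q) s s' (e.cost + 1 + t)
  | ite_false {e : Expr} {p q : Prog} {s s' : State} {t : ℕ} :
      e.eval W s = 0 → Exec ω q s s' t → Exec ω (.ite e p q) s s' (e.cost + 1 + t)
  | loop_done {e : Expr} {p : Prog} {s : State} :
      e.eval W s = 0 → Exec ω (.loop e p) s s (e.cost + 1)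
  | loop_step {e : Expr} {p : Prog} {s₁ s₂ s₃ : State} {t₁ t₂ : ℕ} :
      e.eval W s₁ ≠ 0 → Exec ω p s₁ s₂ t₁ → Exec ω (.loop e p) s₂ s₃ t₂ →
      Exec ω (.loop e p) s₁ s₃ (e.cost + 1 + t₁ + t₂)

/-- The number of machine words on inputs with `n` vertices: a word has `b` times as many bits as
the binary expansion of `n`, so `O(log n)` bits when `b` is a constant. -/
def numWords (b n : ℕ) : ℕ := 2 ^ (b * n.size)

instance (b n : ℕ) : NeZero (numWords b n) := ⟨pow_ne_zero _ two_ne_zero⟩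

/-- The law of a sequence of independent uniformly random words. -/
noncomputable def randomWords (b n : ℕ) : Measure (ℕ → Fin (numWords b n)) :=
  Measure.infinitePi fun _ : ℕ => (PMF.uniformOfFintype (Fin (numWords b n))).toMeasure

end WordRam

namespace VertexConn

/-! ### Vertex cuts and separators -/

section Cuts

variable {V : Type*}

/-- `(L, S, R)` is a vertex cut of the graph `H`: a partition of the vertex set of `H` with `L` and
`R` nonempty and no edge between `L` and `R`. -/
structure IsVertexCut {G : SimpleGraph V} (H : G.Subgraph) (L S R : Set V) : Prop where
  union_eq : L ∪ S ∪ R = H.verts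
  disjoint_LS : Disjoint L S
  disjoint_LR : Disjoint L R
  disjoint_SR : Disjoint S R
  nonempty_L : L.Nonempty
  nonempty_R : R.Nonempty
  not_adj : ∀ u ∈ L, ∀ v ∈ R, ¬ H.Adj u v

/-- `S` is an `(A, B)`-separator of `H`. -/
def IsSeparator {G : SimpleGraph V} (H : G.Subgraph) (A B S : Set V) : Prop :=
  ∃ L R : Set V, IsVertexCut H L S R ∧ A ⊆ L ∧ B ⊆ R

/-- `S` is an `(A, B)`-separator of `H` of minimum size. -/
def IsMinSeparator {G : SimpleGraph V} (H : G.Subgraph) (A B S : Set V) : Prop :=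
  IsSeparator H A B S ∧ ∀ S' : Set V, IsSeparator H A B S' → S.ncard ≤ S'.ncard

/-- The vertex cut `(L, S, R)` of `G` is a `k`-scratch. -/
structure IsScratch [Fintype V] (G : SimpleGraph V) (k : ℕ) (L S R : Set V) : Prop where
  isVertexCut : IsVertexCut (⊤ : G.Subgraph) L S R
  card_S : S.ncard < k
  card_L : (L.ncard : ℝ) ≤ k / (100 * Real.log (Fintype.card V))
  card_low : 300 * (L.ncard : ℝ) * Real.log (Fintype.card V)
    ≤ ({v ∈ S | (G.neighborSet v).ncard ≤ 8 * k}.ncard : ℝ)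

/-- `T_x = T \ N[x]`. -/
def farTerminals (G : SimpleGraph V) (T : Set V) (x : V) : Set V :=
  T \ insert x (G.neighborSet x)

end Cuts

/-! ### The input and the output of the kernelization algorithm -/

section InputOutput

variable {n : ℕ}

/-- `A v` lists the neighbours of `v`, without repetition and in some order. -/
def IsAdjList (G : SimpleGraph (Fin n)) (A : Fin n → List (Fin n)) : Prop :=
  ∀ v, (A v).Nodup ∧ ∀ u, u ∈ A v ↔ G.Adj v u

open Classical in
/-- The initial state. The variables `0, 1, 2, 3` hold `n`, `k`, `ℓ` and `|X|`; array `1` holds the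
concatenated adjacency lists, array `0` holds at `v` the index in array `1` at which the list of
`v` starts (and at `n` the total length of the lists), array `2` holds the indicator of `T`, and
array `3` lists `X`. Everything else is zero. -/
noncomputable def input (A : Fin n → List (Fin n)) (k ℓ : ℕ) (X : List (Fin n))
    (T : Set (Fin n)) : WordRam.State where
  var := fun i => [n, k, ℓ, X.length].getD i 0
  arr := fun a i =>
    match a with
    | 0 => if i ≤ n then (((List.finRange n).take i).map fun v => (A v).length).sum else 0
    | 1 => (((List.finRange n).flatMap A).map fun v => (v : ℕ)).getD i 0
    | 2 => if h : i < n then (if (⟨i, h⟩ : Fin n) ∈ T then 1 else 0) else 0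
    | 3 => (X.map fun v => (v : ℕ)).getD i 0
    | _ => 0
  drawn := 0
  out := []

/-- A graph whose vertices are vertices of the input graph, written `some v`, and possibly the
additional vertex `t_x`, written `none`. -/
abbrev KernelGraph (n : ℕ) : Type := (⊤ : SimpleGraph (Option (Fin n))).Subgraph

/-- The word that names a vertex of a kernel graph: `v` for a vertex `v` of the input graph, and `n`
for the vertex `t_x`. -/
def vertexCode : Option (Fin n) → ℕ
  | some v => v
  | none => n

/-- The words `ws` describe the graph `H` and the vertex set `Z`: the word `1`, then the number and
the list of the vertices of `H`, the number and the list of the edges of `H` (each by its two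
endpoints), and the number and the list of the elements of `Z`, all without repetition. -/
def EncodesKernel (ws : List ℕ) (H : KernelGraph n) (Z : Set (Fin n)) : Prop :=
  ∃ (vs : List (Option (Fin n))) (es : List (Option (Fin n) × Option (Fin n)))
    (zs : List (Fin n)),
    (vs.Nodup ∧ ∀ v, v ∈ vs ↔ v ∈ H.verts) ∧
    ((es.map fun e => s(e.1, e.2)).Nodup ∧
      ∀ e, e ∈ (es.map fun e => s(e.1, e.2)) ↔ e ∈ H.edgeSet) ∧
    (zs.Nodup ∧ ∀ z, z ∈ zs ↔ z ∈ Z) ∧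
    ws = 1 :: vs.length :: vs.map vertexCode
      ++ es.length :: (es.flatMap fun e => [vertexCode e.1, vertexCode e.2])
      ++ zs.length :: zs.map fun z => (z : ℕ)

/-- `H` together with `Z` is a kernel for `x`: `H` contains `x` and `t_x` and avoids `Z`, every
`(x, T_x)`-min-separator of `G` contains `Z`, and a set `Y` disjoint from `Z` is an
`(x, t_x)`-min-separator of `H` if and only if `Y ∪ Z` is an `(x, T_x)`-min-separator of `G`. -/
structure IsKernel (G : SimpleGraph (Fin n)) (T : Set (Fin n)) (x : Fin n)
    (H : KernelGraph n) (Z : Set (Fin n)) : Prop where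
  source_mem : some x ∈ H.verts
  sink_mem : none ∈ H.verts
  avoids : ∀ z ∈ Z, some z ∉ H.verts
  subset : ∀ S : Set (Fin n),
    IsMinSeparator (⊤ : G.Subgraph) {x} (farTerminals G T x) S → Z ⊆ S
  separator_iff : ∀ Y : Set (Fin n), Disjoint Y Z →
    (IsMinSeparator H {some x} {none} (some '' Y) ↔
      IsMinSeparator (⊤ : G.Subgraph) {x} (farTerminals G T x) (Y ∪ Z))

/-- There is a `k`-scratch `(L, S, R)` with `∅ ≠ T_x ⊆ R`, `|L| / 2 ≤ ℓ ≤ |L|` and `x ∈ L`. -/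
def HasSuitableScratch (G : SimpleGraph (Fin n)) (k ℓ : ℕ) (T : Set (Fin n)) (x : Fin n) : Prop :=
  ∃ L S R : Set (Fin n), IsScratch G k L S R ∧
    (farTerminals G T x).Nonempty ∧ farTerminals G T x ⊆ R ∧
    (L.ncard : ℝ) / 2 ≤ ℓ ∧ ℓ ≤ L.ncard ∧ x ∈ L

/-- The words `ws` are a correct answer for `x`, where kernels may have up to `C k ℓ log n` edges.
The single word `0` certifies that `T_x` is empty or that there is no suitable `k`-scratch. -/
def IsCorrectAnswer (C : ℝ) (G : SimpleGraph (Fin n)) (k ℓ : ℕ) (T : Set (Fin n)) (x : Fin n)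
    (ws : List ℕ) : Prop :=
  (∃ (H : KernelGraph n) (Z : Set (Fin n)), EncodesKernel ws H Z ∧ IsKernel G T x H Z ∧
    (H.edgeSet.ncard : ℝ) ≤ C * (k * ℓ * Real.log n)) ∨
  (ws = [0] ∧ (farTerminals G T x = ∅ ∨ ¬ HasSuitableScratch G k ℓ T x))

/-- The output consists of correct answers for the elements of `X`, in the order of the list. -/
def IsCorrectOutput (C : ℝ) (G : SimpleGraph (Fin n)) (k ℓ : ℕ) (X : List (Fin n))
    (T : Set (Fin n)) (output : List ℕ) : Prop :=
  ∃ answer : Fin n → List ℕ, output = X.flatMap answer ∧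
    ∀ x ∈ X, IsCorrectAnswer C G k ℓ T x (answer x)

end InputOutput

/-- The sampling probability `1 / (8 ℓ)`. -/
noncomputable def sampleRate (ℓ : ℕ) (hℓ : 1 ≤ ℓ) : unitInterval :=
  ⟨1 / (8 * (ℓ : ℝ)), by positivity, by
    have h : (1 : ℝ) ≤ ℓ := by exact_mod_cast hℓ
    rw [div_le_one (by positivity)]
    linarith⟩

end VertexConn

/-! Fix `x`, put B = T_x and F(x,v) = N(v) \ N[x], and call `v` bad if it lies in B or has a
neighbour there. Let h be the bit length of n. With high probability T meets every F(x,v) that has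
at least 40ℓh elements (`setBernoulli_miss_le`): one miss has probability at most (1 -
1/(8ℓ))^(40ℓh) ≤ e^(-5h) < n^(-5), and there are n² pairs. This is the event `Good`. The program
draws no random words, and its time bound holds for every T.

On this event every vertex that is not bad has |F(x,v)| < 40ℓh. If moreover deg(x) ≤ k + 2ℓ, the
minimum degree k makes N(x) \ N(v) small as well, so that N(v) and N(x) nearly coincide
(`card_N_sdiff_le`). Such a vertex is adjacent to at least half of any 84ℓh chosen neighbours of `x`
(`Good.le_count`). When these have degree at most 8k, double counting leaves at most 16k candidates
outside N[x]. A suitable scratch around `x` guarantees both the degree bound and enough neighbours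
of low degree (`low_of_scratch`), so ⊥ is a correct answer whenever one of the two is missing.

For the kernel, the common neighbours of `x` and B belong to every separator and form Z. The source
side of a separator contains no bad vertex, so only the edges at `x` and at vertices that are not
bad matter; and an edge inside N(x) is redundant because `x` reaches both of its ends directly. Each
of the O(k) vertices found not to be bad therefore contributes its edges to F(x,v) and possibly one
edge to `x`, which gives O(kℓh) edges. Vertices of the kernel that are adjacent to B are joined to
the sink. `isKernel_of_closed` isolates the graph theory, and `Collected.isCorrectAnswer` applies
it.

F(x,v) has to be found without reading a whole adjacency list. Neighbourhoods are stored as binary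
tries whose nodes are interned: at a given position, two nodes have the same name exactly if they
carry the same set. The tries are built in O(mh) steps. A breadth-first traversal of the positions
where the tries of `x` and `v` differ visits O(h) nodes per element of the symmetric difference
(`Walk.length_le`). It is cut off after 400ℓh² steps, and exceeding this bound already proves that
F(x,v) is large (`Walk.large`), hence on the event `Good` that `v` is bad. -/

namespace WordRam

/-! ### Reasoning about programs -/

namespace State

/-- Assign the value `a` to the variable `x`. -/
def setv (s : State) (x a : ℕ) : State := { s with var := Function.update s.var x a }

/-- Assign the value `e` to the cell `i` of the array `a`. -/
def seta (s : State) (a i e : ℕ) : State :=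
  { s with arr := Function.update s.arr a (Function.update (s.arr a) i e) }

/-- Append a word to the output. -/
def emit (s : State) (e : ℕ) : State := { s with out := s.out ++ [e] }

@[simp] lemma setv_var (s : State) (x a y : ℕ) :
    (s.setv x a).var y = if y = x then a else s.var y := by
  simp [setv, Function.update_apply]
@[simp] lemma setv_arr (s : State) (x a : ℕ) : (s.setv x a).arr = s.arr := rfl
@[simp] lemma setv_out (s : State) (x a : ℕ) : (s.setv x a).out = s.out := rfl
@[simp] lemma seta_var (s : State) (a i e : ℕ) : (s.seta a i e).var = s.var := rfl
@[simp] lemma seta_arr (s : State) (a i e c : ℕ) :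
    (s.seta a i e).arr c = if c = a then Function.update (s.arr a) i e else s.arr c := by
  by_cases h : c = a
  · subst h; simp [seta]
  · simp [seta, h]
@[simp] lemma seta_out (s : State) (a i e : ℕ) : (s.seta a i e).out = s.out := rfl
@[simp] lemma emit_var (s : State) (e : ℕ) : (s.emit e).var = s.var := rfl
@[simp] lemma emit_arr (s : State) (e : ℕ) : (s.emit e).arr = s.arr := rfl
@[simp] lemma emit_out (s : State) (e : ℕ) : (s.emit e).out = s.out ++ [e] := rfl

end State

/-- `p` started in `s` halts, and the final state and the number of steps satisfy `Q`. -/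
def wp {W : ℕ} (ω : ℕ → Fin W) (p : Prog) (s : State) (Q : State → ℕ → Prop) : Prop :=
  ∃ r t, Exec ω p s r t ∧ Q r t

/-- The variables that occur on a left-hand side. -/
def Prog.wv : Prog → List ℕ
  | .skip => []
  | .set x _ => [x]
  | .put _ _ _ => []
  | .rand x => [x]
  | .out _ => []
  | .seq p q => p.wv ++ q.wv
  | .ite _ p q => p.wv ++ q.wv
  | .loop _ p => p.wv

/-- The arrays that occur on a left-hand side. -/
def Prog.wa : Prog → List ℕ
  | .skip => []
  | .set _ _ => []
  | .put a _ _ => [a]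
  | .rand _ => []
  | .out _ => []
  | .seq p q => p.wa ++ q.wa
  | .ite _ p q => p.wa ++ q.wa
  | .loop _ p => p.wa

/-- The program has no output instruction. -/
def Prog.silent : Prog → Bool
  | .out _ => false
  | .seq p q => p.silent && q.silent
  | .ite _ p q => p.silent && q.silent
  | .loop _ p => p.silent
  | _ => true

/-- The two states agree except on the variables `vs` and the arrays `as`; if `o`, then
they have the same output. -/
structure Same (vs as : List ℕ) (o : Bool) (s s' : State) : Prop where
  var : ∀ x, x ∉ vs → s'.var x = s.var x
  arr : ∀ a, a ∉ as → s'.arr a = s.arr a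
  out : o = true → s'.out = s.out

lemma Same.refl (vs as : List ℕ) (o : Bool) (s : State) : Same vs as o s s :=
  ⟨fun _ _ => rfl, fun _ _ => rfl, fun _ => rfl⟩

lemma Same.trans {vs as : List ℕ} {o : Bool} {s s' s'' : State} (h : Same vs as o s s')
    (h' : Same vs as o s' s'') : Same vs as o s s'' :=
  ⟨fun x hx => (h'.var x hx).trans (h.var x hx), fun a ha => (h'.arr a ha).trans (h.arr a ha),
    fun ho => (h'.out ho).trans (h.out ho)⟩

lemma Same.mono {vs as vs' as' : List ℕ} {o o' : Bool} {s s' : State} (h : Same vs as o s s')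
    (hv : vs ⊆ vs') (ha : as ⊆ as') (ho : o' = true → o = true) : Same vs' as' o' s s' :=
  ⟨fun x hx => h.var x (fun hx' => hx (hv hx')), fun a h' => h.arr a (fun h'' => h' (ha h'')),
    fun h' => h.out (ho h')⟩

/-- The frame property. The sets of written variables and arrays are computed from the program text,
so preservation of everything else is mostly settled by `decide`. -/
lemma Exec.same {W : ℕ} {ω : ℕ → Fin W} {p : Prog} {s s' : State} {t : ℕ}
    (h : Exec ω p s s' t) : Same p.wv p.wa p.silent s s' := by
  induction h with
  | skip s => exact Same.refl _ _ _ _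
  | set x e s =>
    refine ⟨fun y hy => ?_, fun _ _ => rfl, fun _ => rfl⟩
    simp only [Prog.wv, List.mem_singleton] at hy
    simp [hy]
  | put a i e s =>
    refine ⟨fun _ _ => rfl, fun b hb => ?_, fun _ => rfl⟩
    simp only [Prog.wa, List.mem_singleton] at hb
    simp [hb]
  | rand x s =>
    refine ⟨fun y hy => ?_, fun _ _ => rfl, fun _ => rfl⟩
    simp only [Prog.wv, List.mem_singleton] at hy
    simp [hy]
  | out e s => exact ⟨fun _ _ => rfl, fun _ _ => rfl, fun h => by simp [Prog.silent] at h⟩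
  | seq _ _ ih₁ ih₂ =>
    refine (ih₁.mono ?_ ?_ ?_).trans (ih₂.mono ?_ ?_ ?_) <;>
      simp +contextual [Prog.wv, Prog.wa, Prog.silent]
  | ite_true _ _ ih =>
    refine ih.mono ?_ ?_ ?_ <;> simp +contextual [Prog.wv, Prog.wa, Prog.silent]
  | ite_false _ _ ih =>
    refine ih.mono ?_ ?_ ?_ <;> simp +contextual [Prog.wv, Prog.wa, Prog.silent]
  | loop_done _ => exact Same.refl _ _ _ _
  | loop_step _ _ _ ih₁ ih₂ => exact Same.trans ih₁ ih₂

/-- Repeat `p` for the values `0, 1, …` of the variable `i` that are below the variable `m`. -/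
def forVar (i m : ℕ) (p : Prog) : Prog :=
  .seq (.set i (.lit 0)) (.loop (.bin .lt (.var i) (.var m))
    (.seq p (.set i (.bin .add (.var i) (.lit 1)))))

section

variable {W : ℕ} {ω : ℕ → Fin W} {s : State} {Q : State → ℕ → Prop}

/-- The continuation also receives the frame, so specifications of subprograms need only mention
what the subprogram changes. -/
lemma wp_mono {p : Prog} {Q' : State → ℕ → Prop} (h : wp ω p s Q)
    (hQ : ∀ s' t, Q s' t → Same p.wv p.wa p.silent s s' → Q' s' t) : wp ω p s Q' := by
  obtain ⟨s', t, h, hq⟩ := h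
  exact ⟨s', t, h, hQ s' t hq h.same⟩

lemma wp_skip (h : Q s 1) : wp ω .skip s Q := ⟨_, _, .skip s, h⟩

lemma wp_set {x : ℕ} {e : Expr} {a : ℕ} (he : e.eval W s = a)
    (h : Q (s.setv x a) (e.cost + 1)) : wp ω (.set x e) s Q := by
  subst he; exact ⟨_, _, .set x e s, h⟩

lemma wp_put {a : ℕ} {i e : Expr} {j c : ℕ} (hi : i.eval W s = j) (he : e.eval W s = c)
    (h : Q (s.seta a j c) (i.cost + e.cost + 1)) : wp ω (.put a i e) s Q := by
  subst hi he; exact ⟨_, _, .put a i e s, h⟩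

lemma wp_out {e : Expr} {a : ℕ} (he : e.eval W s = a)
    (h : Q (s.emit a) (e.cost + 1)) : wp ω (.out e) s Q := by
  subst he; exact ⟨_, _, .out e s, h⟩

lemma wp_seq {p q : Prog} (h : wp ω p s fun s₁ t₁ => wp ω q s₁ fun s₂ t₂ => Q s₂ (t₁ + t₂)) :
    wp ω (.seq p q) s Q := by
  obtain ⟨s₁, t₁, h₁, s₂, t₂, h₂, h⟩ := h
  exact ⟨_, _, .seq h₁ h₂, h⟩

lemma wp_ite {e : Expr} {p q : Prog} {a : ℕ} (he : e.eval W s = a)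
    (h₁ : a ≠ 0 → wp ω p s fun s' t => Q s' (e.cost + 1 + t))
    (h₂ : a = 0 → wp ω q s fun s' t => Q s' (e.cost + 1 + t)) : wp ω (.ite e p q) s Q := by
  subst he
  by_cases h : e.eval W s = 0
  · obtain ⟨s', t, h', hq⟩ := h₂ h
    exact ⟨_, _, .ite_false h h', hq⟩
  · obtain ⟨s', t, h', hq⟩ := h₁ h
    exact ⟨_, _, .ite_true h h', hq⟩

lemma eval_lit {c : ℕ} (h : c < W) : (Expr.lit c).eval W s = c := Nat.mod_eq_of_lt h

lemma eval_var {x a : ℕ} (h : s.var x = a) : (Expr.var x).eval W s = a := h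

lemma eval_get {a : ℕ} {i : Expr} {j c : ℕ} (hi : i.eval W s = j) (h : s.arr a j = c) :
    (Expr.get a i).eval W s = c := by subst hi; exact h

lemma eval_add {e₁ e₂ : Expr} {a b : ℕ} (h₁ : e₁.eval W s = a) (h₂ : e₂.eval W s = b)
    (h : a + b < W) : (Expr.bin .add e₁ e₂).eval W s = a + b := by
  subst h₁ h₂; exact Nat.mod_eq_of_lt h

lemma eval_mul {e₁ e₂ : Expr} {a b : ℕ} (h₁ : e₁.eval W s = a) (h₂ : e₂.eval W s = b)
    (h : a * b < W) : (Expr.bin .mul e₁ e₂).eval W s = a * b := by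
  subst h₁ h₂; exact Nat.mod_eq_of_lt h

lemma eval_sub {e₁ e₂ : Expr} {a b : ℕ} (h₁ : e₁.eval W s = a) (h₂ : e₂.eval W s = b)
    (h : a < W) : (Expr.bin .sub e₁ e₂).eval W s = a - b := by
  subst h₁ h₂; exact Nat.mod_eq_of_lt (by omega)

lemma eval_div {e₁ e₂ : Expr} {a b : ℕ} (h₁ : e₁.eval W s = a) (h₂ : e₂.eval W s = b)
    (h : a < W) : (Expr.bin .div e₁ e₂).eval W s = a / b := by
  subst h₁ h₂; exact Nat.mod_eq_of_lt ((Nat.div_le_self _ _).trans_lt h)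

lemma eval_lt {e₁ e₂ : Expr} {a b : ℕ} (h₁ : e₁.eval W s = a) (h₂ : e₂.eval W s = b)
    (h : 1 < W) : (Expr.bin .lt e₁ e₂).eval W s = if a < b then 1 else 0 := by
  subst h₁ h₂; exact Nat.mod_eq_of_lt (by split_ifs <;> omega)

lemma eval_eq {e₁ e₂ : Expr} {a b : ℕ} (h₁ : e₁.eval W s = a) (h₂ : e₂.eval W s = b)
    (h : 1 < W) : (Expr.bin .eq e₁ e₂).eval W s = if a = b then 1 else 0 := by
  subst h₁ h₂; exact Nat.mod_eq_of_lt (by split_ifs <;> omega)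

/-- The rule for bounded loops; the invariant also tracks the number of steps. -/
lemma wp_forVar {i m : ℕ} {p : Prog} {N : ℕ} (Inv : ℕ → State → ℕ → Prop)
    (hi : i ∉ p.wv) (hm : m ∉ p.wv) (him : i ≠ m) (hN : s.var m = N) (hNW : N < W) (hW : 1 < W)
    (h₀ : Inv 0 (s.setv i 0) 2)
    (hstep : ∀ j s' t, j < N → s'.var i = j → Same (i :: p.wv) p.wa p.silent s s' →
      Inv j s' t → wp ω p s' fun s'' t' => Inv (j + 1) (s''.setv i (j + 1)) (t + t' + 8))
    (hend : ∀ s' t, s'.var i = N → Same (i :: p.wv) p.wa p.silent s s' →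
      Inv N s' t → Q s' (t + 4)) :
    wp ω (forVar i m p) s Q := by
  -- Induction on the number of remaining rounds. The test costs 4 steps and the increment 4, which
  -- explains the 8 per round; the initial assignment costs 2 and the last, failing test 4.
  have key : ∀ d j s' t, N - j = d → j ≤ N → s'.var i = j →
      Same (i :: p.wv) p.wa p.silent s s' → Inv j s' t →
      wp ω (.loop (.bin .lt (.var i) (.var m)) (.seq p (.set i (.bin .add (.var i) (.lit 1))))) s'
        fun s'' t' => Q s'' (t + t') := by
    intro d
    induction d with
    | zero =>
      intro j s' t hd hj hv hs hI
      obtain rfl : j = N := by omega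
      have hmv : s'.var m = j := by
        rw [hs.var m (by simp [hm, him.symm]), hN]
      have he : (Expr.bin .lt (.var i) (.var m)).eval W s' = 0 := by
        rw [eval_lt (eval_var hv) (eval_var hmv) hW]; simp
      exact ⟨_, _, .loop_done he, hend _ _ hv hs hI⟩
    | succ d ih =>
      intro j s' t hd hj hv hs hI
      have hmv : s'.var m = N := by
        rw [hs.var m (by simp [hm, him.symm]), hN]
      have he : (Expr.bin .lt (.var i) (.var m)).eval W s' ≠ 0 := by
        rw [eval_lt (eval_var hv) (eval_var hmv) hW, if_pos (by omega)]; simp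
      obtain ⟨s₁, t₁, h₁, hI₁⟩ := hstep j s' t (by omega) hv hs hI
      have hs₁ := h₁.same
      have hv₁ : s₁.var i = j := by rw [hs₁.var i hi, hv]
      have hs₂ : Same (i :: p.wv) p.wa p.silent s (s₁.setv i (j + 1)) := by
        refine hs.trans ((hs₁.mono (by simp) (by simp) id).trans ⟨fun x hx => ?_, ?_, ?_⟩)
        · simp only [List.mem_cons, not_or] at hx; simp [hx.1]
        · intro _ _; rfl
        · intro _; rfl
      obtain ⟨s₃, t₃, h₃, hq⟩ := ih (j + 1) (s₁.setv i (j + 1)) _ (by omega) (by omega)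
        (by simp) hs₂ hI₁
      have hset : Exec ω (.set i (.bin .add (.var i) (.lit 1))) s₁ (s₁.setv i (j + 1)) 4 := by
        have := Exec.set (ω := ω) i (.bin .add (.var i) (.lit 1)) s₁
        rw [eval_add (eval_var hv₁) (eval_lit hW) (by omega)] at this
        exact this
      refine ⟨_, _, .loop_step he (.seq h₁ hset) h₃, ?_⟩
      have : t + ((Expr.bin .lt (.var i) (.var m)).cost + 1 + (t₁ + 4) + t₃)
          = t + t₁ + 8 + t₃ := by simp only [Expr.cost]; omega
      simpa only [this] using hq
  refine wp_seq (wp_set (eval_lit (by omega)) ?_)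
  refine key N 0 _ _ (by omega) (by omega) (by simp) ⟨fun x hx => ?_, ?_, ?_⟩ h₀
  · simp only [List.mem_cons, not_or] at hx; simp [hx.1]
  · intro _ _; rfl
  · intro _; rfl

end

/-- The array `f` starts with the elements of the list `l`. -/
def Holds (f : ℕ → ℕ) (l : List ℕ) : Prop := ∀ j (h : j < l.length), f j = l[j]

lemma Holds.nil (f : ℕ → ℕ) : Holds f [] := fun j h => by simp at h

lemma Holds.append {f : ℕ → ℕ} {l : List ℕ} (h : Holds f l) {j : ℕ} (hj : j = l.length) (a : ℕ) :
    Holds (Function.update f j a) (l ++ [a]) := by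
  subst hj
  intro j hj
  rcases Nat.lt_or_ge j l.length with h' | h'
  · rw [Function.update_of_ne (by omega), List.getElem_append_left h', h j h']
  · obtain rfl : j = l.length := by simp at hj; omega
    simp

lemma Holds.get {f : ℕ → ℕ} {l : List ℕ} (h : Holds f l) {j a : ℕ} (hj : l[j]? = some a) :
    f j = a := by
  obtain ⟨hj', rfl⟩ := List.getElem?_eq_some_iff.1 hj
  exact h j hj'

end WordRam

namespace VertexConn

/-! ### Kernels -/

section Kernel

variable {V : Type*} {G : SimpleGraph V}

/-- A separator can be described by its source side alone. -/
lemma isSeparator_top_iff {x : V} {B S : Set V} (hB : B.Nonempty) :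
    IsSeparator (⊤ : G.Subgraph) {x} B S ↔
      ∃ L : Set V, x ∈ L ∧ Disjoint L S ∧ Disjoint L B ∧ Disjoint S B ∧
        ∀ u ∈ L, ∀ v, G.Adj u v → v ∈ L ∨ v ∈ S := by
  constructor
  · rintro ⟨L, R, h, hx, hR⟩
    refine ⟨L, hx rfl, h.disjoint_LS, h.disjoint_LR.mono_right hR, h.disjoint_SR.mono_right hR,
      fun u hu v huv => ?_⟩
    have hv : v ∈ L ∪ S ∪ R := by rw [h.union_eq]; trivial
    rcases hv with (hv | hv) | hv
    · exact Or.inl hv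
    · exact Or.inr hv
    · exact absurd (by simpa using huv) (h.not_adj u hu v hv)
  · rintro ⟨L, hx, h₁, h₂, h₃, h⟩
    have hBR : B ⊆ (L ∪ S)ᶜ := by
      intro b hb
      rw [Set.mem_compl_iff, Set.mem_union, not_or]
      exact ⟨fun h' => h₂.notMem_of_mem_left h' hb, fun h' => h₃.notMem_of_mem_left h' hb⟩
    refine ⟨L, (L ∪ S)ᶜ, ⟨?_, h₁, ?_, ?_, ⟨x, hx⟩, hB.mono hBR, ?_⟩, by simpa using hx, hBR⟩
    · rw [Set.union_compl_self]; rfl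
    · exact Set.disjoint_left.2 fun a ha h' => h' (Or.inl ha)
    · exact Set.disjoint_left.2 fun a ha h' => h' (Or.inr ha)
    · intro u hu v hv huv
      exact hv (h u hu v (by simpa using huv))

/-- Separators of a subgraph between two vertices, described by their source side. -/
lemma isSeparator_pair_iff {H : G.Subgraph} {a b : V} {S : Set V} (hb : b ∈ H.verts) :
    IsSeparator H {a} {b} S ↔
      S ⊆ H.verts ∧ b ∉ S ∧ ∃ L : Set V, L ⊆ H.verts ∧ a ∈ L ∧ b ∉ L ∧ Disjoint L S ∧
        ∀ u ∈ L, ∀ v, H.Adj u v → v ∈ L ∨ v ∈ S := by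
  constructor
  · rintro ⟨L, R, h, ha, hR⟩
    have hbR : b ∈ R := hR rfl
    refine ⟨?_, fun h' => h.disjoint_SR.notMem_of_mem_left h' hbR, L, ?_, ha rfl,
      fun h' => h.disjoint_LR.notMem_of_mem_left h' hbR, h.disjoint_LS, fun u hu v huv => ?_⟩
    · rw [← h.union_eq]; intro v hv; exact Or.inl (Or.inr hv)
    · rw [← h.union_eq]; intro v hv; exact Or.inl (Or.inl hv)
    · have hv : v ∈ L ∪ S ∪ R := by rw [h.union_eq]; exact H.edge_vert huv.symm
      rcases hv with (hv | hv) | hv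
      · exact Or.inl hv
      · exact Or.inr hv
      · exact absurd huv (h.not_adj u hu v hv)
  · rintro ⟨hS, hbS, L, hL, ha, hbL, h₁, h⟩
    refine ⟨L, H.verts \ (L ∪ S), ⟨?_, h₁, ?_, ?_, ⟨a, ha⟩, ⟨b, hb, ?_⟩, ?_⟩, by simpa using ha, ?_⟩
    · rw [Set.union_sdiff_cancel (Set.union_subset hL hS)]
    · exact Set.disjoint_left.2 fun a ha h' => h'.2 (Or.inl ha)
    · exact Set.disjoint_left.2 fun a ha h' => h'.2 (Or.inr ha)
    · rintro (h' | h')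
      exacts [hbL h', hbS h']
    · intro u hu v hv huv
      exact hv.2 (h u hu v huv)
    · rintro _ rfl
      refine ⟨hb, ?_⟩
      rintro (h' | h')
      exacts [hbL h', hbS h']

end Kernel

section KernelGraph

variable {n : ℕ} {G : SimpleGraph (Fin n)} {T : Set (Fin n)} {x : Fin n}

/-- Sufficient conditions for `H` and the common neighbours `Z` of `x` and `T_x` to be a kernel.
The set `K` of the vertices of `H` other than `t_x` contains the neighbours, outside of `Z`, of `x`
and of the elements of `K` that are not adjacent to `T_x`. The graph `H` is induced by `G`, except
that edges inside `N(x)` and edges inside the neighbourhood of `T_x` are optional. -/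
lemma isKernel_of_closed {H : KernelGraph n} {Z K : Set (Fin n)}
    (hB : (farTerminals G T x).Nonempty)
    (hZ : ∀ z, z ∈ Z ↔ G.Adj x z ∧ ∃ b ∈ farTerminals G T x, G.Adj z b)
    (hK : ∀ v, some v ∈ H.verts ↔ v ∈ K) (ht : none ∈ H.verts) (hx : x ∈ K)
    (hKZ : Disjoint K Z) (hKB : Disjoint K (farTerminals G T x))
    (hNx : ∀ v, G.Adj x v → v ∈ K ∨ v ∈ Z)
    (hNv : ∀ v ∈ K, (∀ b ∈ farTerminals G T x, ¬ G.Adj v b) → ∀ u, G.Adj v u → u ∈ K ∨ u ∈ Z)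
    (hadj : ∀ u v, H.Adj (some u) (some v) → G.Adj u v)
    (hadj' : ∀ u ∈ K, ∀ v ∈ K, G.Adj u v → (∀ b ∈ farTerminals G T x, ¬ G.Adj u b) →
      ¬ (G.Adj x u ∧ G.Adj x v) → H.Adj (some u) (some v))
    (hsink : ∀ u, H.Adj (some u) none ↔ u ∈ K ∧ ∃ b ∈ farTerminals G T x, G.Adj u b) :
    IsKernel G T x H Z := by
  set B := farTerminals G T x with hBdef
  have hxB : ∀ b ∈ B, ¬ G.Adj x b := fun b hb h => hb.2 (Or.inr h)
  have hZB : Disjoint Z B := Set.disjoint_left.2 fun z hz hb => hxB z hb ((hZ z).1 hz).1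
  -- A common neighbour of `x` and B is the middle of a path of length two, so every separator
  -- contains it.
  have hZS : ∀ S, IsSeparator (⊤ : G.Subgraph) {x} B S → Z ⊆ S := by
    intro S hS z hz
    obtain ⟨L, hxL, h₁, h₂, h₃, h⟩ := (isSeparator_top_iff hB).1 hS
    obtain ⟨hxz, b, hb, hzb⟩ := (hZ z).1 hz
    refine (h x hxL z hxz).resolve_left fun hzL => ?_
    rcases h z hzL b hzb with h' | h'
    · exact h₂.notMem_of_mem_left h' hb
    · exact h₃.notMem_of_mem_left h' hb
  -- Restriction to `K` stays closed in `H`: an edge to the sink would come from a neighbour of B on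
  -- the source side, which would put an element of B into `L` or `S`.
  have down : ∀ S, IsSeparator (⊤ : G.Subgraph) {x} B S →
      IsSeparator H {some x} {none} (some '' (S ∩ K)) := by
    intro S hS
    obtain ⟨L, hxL, h₁, h₂, h₃, h⟩ := (isSeparator_top_iff hB).1 hS
    rw [isSeparator_pair_iff ht]
    refine ⟨?_, by simp, some '' (L ∩ K), ?_, ⟨x, ⟨hxL, hx⟩, rfl⟩, by simp, ?_, ?_⟩
    · rintro _ ⟨v, hv, rfl⟩; exact (hK v).2 hv.2
    · rintro _ ⟨v, hv, rfl⟩; exact (hK v).2 hv.2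
    · rw [Set.disjoint_image_iff (Option.some_injective _)]
      exact h₁.mono Set.inter_subset_left Set.inter_subset_left
    · rintro _ ⟨u, hu, rfl⟩ (_ | v) huv
      · obtain ⟨_, b, hb, hub⟩ := (hsink u).1 huv
        rcases h u hu.1 b hub with h' | h'
        · exact absurd hb (h₂.notMem_of_mem_left h')
        · exact absurd hb (h₃.notMem_of_mem_left h')
      · have hvK := (hK v).1 (H.edge_vert huv.symm)
        rcases h u hu.1 v (hadj u v huv) with h' | h'
        · exact Or.inl ⟨v, ⟨h', hvK⟩, rfl⟩
        · exact Or.inr ⟨v, ⟨h', hvK⟩, rfl⟩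
  -- The source side in `H` serves unchanged as the source side in `G`. What must be checked is that
  -- edges of `G` absent from `H` cannot leave it.
  have up : ∀ Y : Set (Fin n), IsSeparator H {some x} {none} (some '' Y) →
      IsSeparator (⊤ : G.Subgraph) {x} B (Y ∪ Z) := by
    intro Y hY
    obtain ⟨hYK, -, L, hLK, hxL, htL, h₁, h⟩ := (isSeparator_pair_iff ht).1 hY
    have hYK' : Y ⊆ K := fun y hy => (hK y).1 (hYK ⟨y, hy, rfl⟩)
    have hLK' : some ⁻¹' L ⊆ K := fun y hy => (hK y).1 (hLK hy)
    have step : ∀ u v, some u ∈ L → H.Adj (some u) (some v) → some v ∈ L ∨ v ∈ Y := by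
      intro u v hu huv
      rcases h _ hu _ huv with h' | ⟨y, hy, h'⟩
      · exact Or.inl h'
      · obtain rfl := Option.some_injective _ h'
        exact Or.inr hy
    rw [isSeparator_top_iff hB]
    refine ⟨some ⁻¹' L, hxL, ?_, hKB.mono_left hLK', ?_, ?_⟩
    · rw [Set.disjoint_union_right]
      refine ⟨Set.disjoint_left.2 fun y hy hy' => ?_, hKZ.mono_left hLK'⟩
      exact h₁.notMem_of_mem_left hy ⟨y, hy', rfl⟩
    · rw [Set.disjoint_union_left]
      exact ⟨hKB.mono_left hYK', hZB⟩
    · intro u hu v huv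
      have hxadj : ∀ w, G.Adj x w → some w ∈ L ∨ w ∈ Y ∪ Z := by
        intro w hw
        rcases hNx w hw with h' | h'
        · rcases step x w hxL (hadj' x hx w h' hw hxB fun h' => G.irrefl h'.1) with h'' | h''
          · exact Or.inl h''
          · exact Or.inr (Or.inl h'')
        · exact Or.inr (Or.inr h')
      -- A vertex of the source side adjacent to B would be adjacent to the sink, which is neither
      -- in `L` nor in the separator.
      have hun : ∀ b ∈ B, ¬ G.Adj u b := by
        intro b hb hub
        rcases h _ hu _ ((hsink u).2 ⟨hLK' hu, b, hb, hub⟩) with h' | ⟨y, -, h'⟩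
        · exact htL h'
        · simp at h'
      rcases hNv u (hLK' hu) hun v huv with h' | h'
      -- An edge inside N(x) may be missing from `H`; then its end `v` is reached through the edge
      -- from `x` instead.
      · by_cases hc : G.Adj x u ∧ G.Adj x v
        · exact hxadj v hc.2
        · rcases step u v hu (hadj' u (hLK' hu) v h' huv hun hc) with h'' | h''
          · exact Or.inl h''
          · exact Or.inr (Or.inl h'')
      · exact Or.inr (Or.inr h')
  have card_image : ∀ Y : Set (Fin n), (some '' Y).ncard = Y.ncard := fun Y =>
    Set.ncard_image_of_injective _ (Option.some_injective _)
  -- Since every separator contains `Z`, restriction to `K` lowers the size by at least |Z|, and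
  -- adding `Z` raises it by at most |Z|. So the two minima differ by exactly |Z|.
  have card_down : ∀ S, IsSeparator (⊤ : G.Subgraph) {x} B S →
      (S ∩ K).ncard + Z.ncard ≤ S.ncard := by
    intro S hS
    rw [← Set.ncard_union_eq (hKZ.mono_left Set.inter_subset_right)]
    exact Set.ncard_le_ncard (Set.union_subset Set.inter_subset_left (hZS S hS))
  refine ⟨(hK x).2 hx, ht, fun z hz hzH => hKZ.notMem_of_mem_left ((hK z).1 hzH) hz,
    fun S hS => hZS S hS.1, fun Y hYZ => ⟨fun hY => ⟨up Y hY.1, fun S hS => ?_⟩, fun hY => ?_⟩⟩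
  · have h₁ := hY.2 _ (down S hS)
    rw [card_image, card_image] at h₁
    have h₂ := card_down S hS
    have h₃ := Set.ncard_union_le Y Z
    omega
  · have hYd := down _ hY.1
    have hYK : (Y ∪ Z) ∩ K = Y ∩ K := by
      rw [Set.union_inter_distrib_right, hKZ.symm.inter_eq, Set.union_empty]
    rw [hYK] at hYd
    have h₁ := hY.2 _ (up _ hYd)
    rw [Set.ncard_union_eq hYZ, Set.ncard_union_eq (hYZ.mono_left Set.inter_subset_left)] at h₁
    -- A minimum separator wastes no vertex outside `K ∪ Z`: dropping such vertices by `down`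
    -- followed by `up` would give a smaller separator.
    have hsub : Y ∩ K = Y := Set.eq_of_subset_of_ncard_le Set.inter_subset_left (by omega)
    rw [hsub] at hYd
    refine ⟨hYd, fun S' hS' => ?_⟩
    obtain ⟨hS'K, hS't, -⟩ := (isSeparator_pair_iff ht).1 hS'
    have hS'' : some '' (some ⁻¹' S') = S' := by
      rw [Set.image_preimage_eq_iff]
      rintro (_ | v) hv
      · exact absurd hv hS't
      · exact ⟨v, rfl⟩
    rw [← hS''] at hS' ⊢
    have h₂ := hY.2 _ (up _ hS')
    rw [Set.ncard_union_eq hYZ] at h₂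
    have h₃ := Set.ncard_union_le (some ⁻¹' S') Z
    rw [card_image, card_image]
    omega

end KernelGraph

end VertexConn

namespace VertexConn

/-! ### Hitting large sets -/

lemma setBernoulli_disjoint {ι : Type*} (p : unitInterval) (F : Finset ι) :
    setBernoulli (Set.univ : Set ι) p {t | Disjoint (F : Set ι) t}
      = (unitInterval.toNNReal (unitInterval.symm p) : ENNReal) ^ F.card := by
  rw [setBernoulli_apply']
  have : (fun p : ι → Prop => {i | p i}) ⁻¹' {t | Disjoint (F : Set ι) t}
      = Set.pi (F : Set ι) fun _ => {False} := by
    ext f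
    simp [Set.disjoint_left, Set.mem_pi]
  rw [this, Measure.infinitePi_pi _ (fun _ _ => MeasurableSet.of_discrete)]
  simp

/-- A random set with density `1 / (8 ℓ)` hits all the sets `F i` with at least `40 ℓ h` elements,
except with probability `e ^ (-5 h)` for each of them. -/
lemma setBernoulli_miss_le {ι κ : Type*} [Fintype κ] {ℓ : ℕ} (hℓ : 1 ≤ ℓ) (h : ℕ)
    (F : κ → Finset ι) :
    setBernoulli (Set.univ : Set ι) (sampleRate ℓ hℓ)
      {t | ∃ i, 40 * ℓ * h ≤ (F i).card ∧ Disjoint (F i : Set ι) t}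
      ≤ ENNReal.ofReal (Fintype.card κ * Real.exp (-(5 * h))) := by
  classical
  have hℓ' : (1 : ℝ) ≤ ℓ := by exact_mod_cast hℓ
  have hsub : {t | ∃ i, 40 * ℓ * h ≤ (F i).card ∧ Disjoint (F i : Set ι) t}
      ⊆ ⋃ i ∈ Finset.univ.filter (fun i => 40 * ℓ * h ≤ (F i).card),
        {t | Disjoint (F i : Set ι) t} := by
    rintro t ⟨i, hi, ht⟩
    simp only [Finset.mem_filter, Finset.mem_univ, true_and, Set.mem_iUnion]
    exact ⟨i, hi, ht⟩
  refine (measure_mono hsub).trans ((measure_biUnion_finset_le _ _).trans ?_)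
  have key : ∀ i ∈ Finset.univ.filter (fun i => 40 * ℓ * h ≤ (F i).card),
      setBernoulli (Set.univ : Set ι) (sampleRate ℓ hℓ) {t | Disjoint (F i : Set ι) t}
        ≤ ENNReal.ofReal (Real.exp (-(5 * h))) := by
    intro i hi
    simp only [Finset.mem_filter, Finset.mem_univ, true_and] at hi
    rw [setBernoulli_disjoint]
    have hp : (unitInterval.toNNReal (unitInterval.symm (sampleRate ℓ hℓ)) : ENNReal)
        = ENNReal.ofReal (1 - 1 / (8 * (ℓ : ℝ))) := by
      rw [ENNReal.ofReal, ENNReal.coe_inj]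
      ext
      rw [Real.coe_toNNReal]
      · rfl
      · rw [sub_nonneg, div_le_one (by positivity)]; linarith
    have h0 : (0 : ℝ) ≤ 1 - 1 / (8 * (ℓ : ℝ)) := by
      rw [sub_nonneg, div_le_one (by positivity)]; linarith
    rw [hp, ← ENNReal.ofReal_pow h0]
    apply ENNReal.ofReal_le_ofReal
    calc (1 - 1 / (8 * (ℓ : ℝ))) ^ (F i).card
        ≤ (1 - 1 / (8 * (ℓ : ℝ))) ^ (40 * ℓ * h) :=
          pow_le_pow_of_le_one h0 (by simp) hi
      -- 1 - y ≤ e^(-y) at y = 1/(8ℓ); raised to the power 40ℓh this becomes e^(-5h).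
      _ ≤ (Real.exp (-(1 / (8 * (ℓ : ℝ))))) ^ (40 * ℓ * h) :=
          pow_le_pow_left₀ h0 (by have := Real.add_one_le_exp (-(1 / (8 * (ℓ : ℝ)))); linarith) _
      _ = Real.exp (-(5 * h)) := by
          rw [← Real.exp_nat_mul]
          congr 1
          push_cast
          field_simp
          ring
  refine (Finset.sum_le_sum key).trans ?_
  rw [Finset.sum_const, nsmul_eq_mul, ENNReal.ofReal_mul (by positivity),
    ENNReal.ofReal_natCast]
  gcongr
  exact Finset.card_filter_le _ _

end VertexConn

/-! ### Good samples and the comparison of neighbourhoods -/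

namespace VertexConn

/-- An instance of the kernelization problem. -/
structure Inst where
  n : ℕ
  k : ℕ
  ℓ : ℕ
  G : SimpleGraph (Fin n)
  A : Fin n → List (Fin n)
  X : List (Fin n)
  T : Set (Fin n)
  hn : 400 ≤ n
  hℓ : 1 ≤ ℓ
  hk : 400 * ℓ ≤ k
  hkn : k < n
  hdeg : ∀ v, k ≤ (A v).length
  hX : X.Nodup
  hA : IsAdjList G A

namespace Inst

variable (I : Inst)

/-- The depth of the tries. -/
def h : ℕ := I.n.size

/-- The neighbourhood of `v`. -/
def N (v : Fin I.n) : Finset (Fin I.n) := (I.A v).toFinset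

/-- The neighbours of `v` outside of `N[x]`. -/
def F (x v : Fin I.n) : Finset (Fin I.n) := I.N v \ insert x (I.N x)

/-- `v` belongs to `T_x` or is adjacent to it. -/
def Bad (x v : Fin I.n) : Prop :=
  v ∈ farTerminals I.G I.T x ∨ ∃ b ∈ farTerminals I.G I.T x, I.G.Adj v b

/-- The sampled set hits every large difference of neighbourhoods. -/
def Good : Prop := ∀ x v, 40 * I.ℓ * I.h ≤ (I.F x v).card → ∃ b ∈ I.F x v, b ∈ I.T

variable {I}

@[simp] lemma mem_N {u v : Fin I.n} : u ∈ I.N v ↔ I.G.Adj v u := by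
  simp [N, (I.hA v).2]

lemma mem_A {u v : Fin I.n} : u ∈ I.A v ↔ I.G.Adj v u := (I.hA v).2 u

lemma card_N (v : Fin I.n) : (I.N v).card = (I.A v).length :=
  List.toFinset_card_of_nodup (I.hA v).1

lemma mem_F {x v u : Fin I.n} : u ∈ I.F x v ↔ I.G.Adj v u ∧ u ≠ x ∧ ¬ I.G.Adj x u := by
  simp [F]

lemma mem_farTerminals {x v : Fin I.n} :
    v ∈ farTerminals I.G I.T x ↔ v ∈ I.T ∧ v ≠ x ∧ ¬ I.G.Adj x v := by
  simp [farTerminals]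

lemma bad_iff {x v : Fin I.n} :
    I.Bad x v ↔ v ∈ farTerminals I.G I.T x ∨ ∃ b ∈ I.F x v, b ∈ I.T := by
  simp only [Bad, mem_F, mem_farTerminals]
  constructor <;> rintro (h | ⟨b, hb, hb'⟩)
  · exact Or.inl h
  · exact Or.inr ⟨b, ⟨hb', hb.2⟩, hb.1⟩
  · exact Or.inl h
  · exact Or.inr ⟨b, ⟨hb', hb.2⟩, hb.1⟩

/-- An element of T in F(x,v) avoids N[x], hence belongs to T_x, and it is adjacent to `v`. -/
lemma Good.bad (hG : I.Good) {x v : Fin I.n} (hF : 40 * I.ℓ * I.h ≤ (I.F x v).card) :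
    I.Bad x v := bad_iff.2 (Or.inr (hG x v hF))

lemma one_le_h : 1 ≤ I.h := Nat.size_pos.2 (by have := I.hn; omega)

lemma n_lt_two_pow : I.n < 2 ^ I.h := Nat.lt_size_self _

lemma two_pow_le : 2 ^ I.h ≤ 2 * I.n := by
  have h1 := I.one_le_h
  have : 2 ^ (I.h - 1) ≤ I.n := Nat.lt_size.1 (by unfold h at *; omega)
  calc 2 ^ I.h = 2 * 2 ^ (I.h - 1) := by rw [← pow_succ']; congr 1; omega
    _ ≤ 2 * I.n := by omega

/-! #### Differences of neighbourhoods -/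

/-- Since deg(v) ≥ k and deg(x) ≤ k + 2ℓ, the difference in one direction exceeds that in the other
by at most 2ℓ. N(v) \ N(x) has at most one element more than F(x,v), namely `x`; the strict
inequality absorbs it. -/
lemma card_N_sdiff_le {x v : Fin I.n} (hx : (I.N x).card ≤ I.k + 2 * I.ℓ)
    (hF : (I.F x v).card < 40 * I.ℓ * I.h) :
    (I.N x \ I.N v).card ≤ 40 * I.ℓ * I.h + 2 * I.ℓ ∧ (I.N v \ I.N x).card ≤ 40 * I.ℓ * I.h := by
  have h₁ : (I.N v \ I.N x).card ≤ (I.F x v).card + 1 := by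
    refine (Finset.card_le_card (t := insert x (I.F x v)) fun u hu => ?_).trans
      (Finset.card_insert_le _ _)
    simp only [Finset.mem_sdiff, mem_N, Finset.mem_insert, mem_F] at hu ⊢
    tauto
  have h₂ := Finset.card_sdiff_add_card_inter (I.N v) (I.N x)
  have h₃ := Finset.card_sdiff_add_card_inter (I.N x) (I.N v)
  rw [Finset.inter_comm] at h₃
  have h₄ := I.hdeg v
  rw [← card_N] at h₄
  omega

lemma mul_h_facts : I.ℓ ≤ I.ℓ * I.h ∧ I.ℓ * I.h ≤ I.ℓ * I.h * I.h :=
  ⟨Nat.le_mul_of_pos_right _ I.one_le_h, Nat.le_mul_of_pos_right _ I.one_le_h⟩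

/-! #### Tries -/

/-- `f v c` names the set of the neighbours of `v` below the node `c` of the complete binary tree
with root `1` in which the children of `c` are `2 c` and `2 c + 1`, and `2 ^ h + u` is the leaf of
the vertex `u`. -/
structure TrieOk (I : Inst) (f : ℕ → ℕ → ℕ) : Prop where
  node : ∀ (v x : Fin I.n) c, 0 < c → c < 2 ^ I.h →
    (f v c = f x c ↔ f v (2 * c) = f x (2 * c) ∧ f v (2 * c + 1) = f x (2 * c + 1))
  leaf : ∀ (v : Fin I.n) u, u < 2 ^ I.h →
    f v (2 ^ I.h + u) = open Classical in if ∃ h : u < I.n, I.G.Adj v ⟨u, h⟩ then 1 else 0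

variable {f : ℕ → ℕ → ℕ}

lemma TrieOk.leaf_fin (hf : TrieOk I f) (v u : Fin I.n) :
    f v (2 ^ I.h + u) = open Classical in if I.G.Adj v u then 1 else 0 := by
  rw [hf.leaf v u (u.2.trans I.n_lt_two_pow)]
  classical
  exact if_congr ⟨fun ⟨_, h⟩ => h, fun h => ⟨u.2, h⟩⟩ rfl rfl

lemma TrieOk.ne_of_child (hf : TrieOk I f) {v x : Fin I.n} {c : ℕ} (hc : 2 ≤ c)
    (hc' : c < 2 * 2 ^ I.h) (h : f v c ≠ f x c) : f v (c / 2) ≠ f x (c / 2) := by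
  intro h'
  rw [hf.node v x (c / 2) (by omega) (by omega)] at h'
  rcases Nat.even_or_odd' c with ⟨d, rfl | rfl⟩
  · exact h (by simpa using h'.1)
  · have : (2 * d + 1) / 2 = d := by omega
    rw [this] at h'
    exact h h'.2

lemma TrieOk.ne_of_descendant (hf : TrieOk I f) {v x : Fin I.n} {c : ℕ}
    (hc' : c < 2 * 2 ^ I.h) (h : f v c ≠ f x c) (i : ℕ) (hi : 0 < c / 2 ^ i) :
    f v (c / 2 ^ i) ≠ f x (c / 2 ^ i) := by
  induction i with
  | zero => simpa using h
  | succ i ih =>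
    rw [pow_succ, ← Nat.div_div_eq_div_mul] at hi ⊢
    refine hf.ne_of_child (by omega) ((Nat.div_le_self _ _).trans_lt hc') (ih (by omega))

/-- A differing inner node has a differing child, so the descent ends at a differing leaf after at
most `d` levels. Every differing node is thereby an ancestor of a differing leaf, which is how such
nodes are counted. -/
lemma TrieOk.exists_leaf (hf : TrieOk I f) {v x : Fin I.n} :
    ∀ d c, 2 ^ I.h ≤ c * 2 ^ d → 0 < c → c < 2 * 2 ^ I.h → f v c ≠ f x c →
      ∃ u i, u < 2 ^ I.h ∧ i ≤ d ∧ c = (2 ^ I.h + u) / 2 ^ i ∧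
        f v (2 ^ I.h + u) ≠ f x (2 ^ I.h + u) := by
  intro d
  induction d with
  | zero =>
    intro c h₁ h₂ h₃ h₄
    refine ⟨c - 2 ^ I.h, 0, by omega, le_rfl, ?_, ?_⟩
    · simp only [pow_zero, mul_one] at h₁; simp; omega
    · simp only [pow_zero, mul_one] at h₁; rwa [show 2 ^ I.h + (c - 2 ^ I.h) = c by omega]
  | succ d ih =>
    intro c h₁ h₂ h₃ h₄
    by_cases hc : 2 ^ I.h ≤ c
    · refine ⟨c - 2 ^ I.h, 0, by omega, by omega, ?_, ?_⟩
      · simp; omega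
      · rwa [show 2 ^ I.h + (c - 2 ^ I.h) = c by omega]
    · rw [Ne, hf.node v x c h₂ (by omega), not_and_or] at h₄
      have hpow : c * 2 ^ (d + 1) = 2 * c * 2 ^ d := by ring
      have key : ∀ e, e = 2 * c ∨ e = 2 * c + 1 → f v e ≠ f x e → ∃ u i, u < 2 ^ I.h ∧ i ≤ d + 1 ∧
          c = (2 ^ I.h + u) / 2 ^ i ∧ f v (2 ^ I.h + u) ≠ f x (2 ^ I.h + u) := by
        intro e he hne
        obtain ⟨u, i, hu, hi, hc', hne'⟩ := ih e
          (h₁.trans (hpow ▸ Nat.mul_le_mul_right _ (by omega))) (by omega) (by omega) hne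
        refine ⟨u, i + 1, hu, by omega, ?_, hne'⟩
        rw [pow_succ, ← Nat.div_div_eq_div_mul, ← hc']
        omega
      rcases h₄ with h₄ | h₄
      · exact key _ (Or.inl rfl) h₄
      · exact key _ (Or.inr rfl) h₄

/-- The state of the traversal of the nodes at which the tries of `v` and `x` differ: `p` lists the
nodes already visited, `r` those still to be visited, and `dl` the elements of `F x v` found. -/
structure Walk (I : Inst) (f : ℕ → ℕ → ℕ) (x v : Fin I.n) (p r : List ℕ) (dl : List (Fin I.n)) :
    Prop where
  sorted : (p ++ r).Pairwise (· < ·)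
  origin : ∀ c ∈ p ++ r, c = 1 ∨
    ∃ a ∈ p, f v a ≠ f x a ∧ a < 2 ^ I.h ∧ (c = 2 * a ∨ c = 2 * a + 1)
  range : ∀ c ∈ p ++ r, 0 < c ∧ c < 2 * 2 ^ I.h
  complete : ∀ c, 2 ^ I.h ≤ c → c < 2 * 2 ^ I.h → f v c ≠ f x c →
    c ∈ p ∨ ∃ i, c / 2 ^ i ∈ r
  nodup : dl.Nodup
  mem_dl : ∀ u, u ∈ dl ↔ 2 ^ I.h + (u : ℕ) ∈ p ∧ u ∈ I.F x v

lemma walk_init (x v : Fin I.n) : Walk I f x v [] [1] [] := by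
  refine ⟨by simp, by simp, ?_, ?_, by simp, by simp⟩
  · have := I.n_lt_two_pow; have := I.hn
    simp only [List.nil_append, List.mem_singleton]
    rintro _ rfl; omega
  · intro c h₁ h₂ _
    refine Or.inr ⟨I.h, ?_⟩
    rw [List.mem_singleton, Nat.div_eq_iff (by positivity)]
    omega

/-- A difference at a descendant propagates up to `a`. Equal names at `a` therefore exclude
differing leaves below it, and nothing is lost by not expanding `a`. -/
lemma Walk.skip {x v : Fin I.n} {p r : List ℕ} {dl : List (Fin I.n)} {a : ℕ}
    (hw : Walk I f x v p (a :: r) dl) (hf : TrieOk I f) (ha : f v a = f x a) :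
    Walk I f x v (p ++ [a]) r dl := by
  have e : p ++ [a] ++ r = p ++ a :: r := by simp
  refine ⟨e ▸ hw.sorted, fun c hc => ?_, e ▸ hw.range, fun c h₁ h₂ h₃ => ?_, hw.nodup,
    fun u => ?_⟩
  · rcases hw.origin c (e ▸ hc) with h | ⟨b, hb, h⟩
    · exact Or.inl h
    · exact Or.inr ⟨b, by simp [hb], h⟩
  · rcases hw.complete c h₁ h₂ h₃ with h | ⟨i, hi⟩
    · exact Or.inl (by simp [h])
    · rcases List.mem_cons.1 hi with hi' | hi'
      · have hr := hw.range _ (List.mem_append_right p hi)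
        exact absurd ha (hi' ▸ hf.ne_of_descendant h₂ h₃ i hr.1)
      · exact Or.inr ⟨i, hi'⟩
  · rw [hw.mem_dl]
    simp only [List.mem_append, List.mem_singleton]
    refine and_congr_left fun hu => ⟨Or.inl, Or.rec id fun h => ?_⟩
    rw [← h, hf.leaf_fin, hf.leaf_fin] at ha
    rw [mem_F] at hu
    simp [hu.1, hu.2.2] at ha

/-- Breadth-first order is increasing in the numbering of the nodes: everything queued so far is the
root or a child of some `b < a`, hence smaller than `2 * a`. So the queue stays strictly sorted and
never repeats a node. -/
lemma Walk.push {x v : Fin I.n} {p r : List ℕ} {dl : List (Fin I.n)} {a : ℕ}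
    (hw : Walk I f x v p (a :: r) dl) (ha : f v a ≠ f x a)
    (hS : a < 2 ^ I.h) : Walk I f x v (p ++ [a]) (r ++ [2 * a, 2 * a + 1]) dl := by
  have e : p ++ [a] ++ (r ++ [2 * a, 2 * a + 1]) = (p ++ a :: r) ++ [2 * a, 2 * a + 1] := by simp
  have hapos := (hw.range a (by simp)).1
  refine ⟨?_, fun c hc => ?_, fun c hc => ?_, fun c h₁ h₂ h₃ => ?_, hw.nodup, fun u => ?_⟩
  · rw [e, List.pairwise_append]
    refine ⟨hw.sorted, by simp, fun c hc d hd => ?_⟩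
    have hd' : 2 * a ≤ d := by
      simp only [List.mem_cons, List.not_mem_nil, or_false] at hd; omega
    have : c < 2 * a := by
      rcases hw.origin c hc with h | ⟨b, hb, -, -, h⟩
      · omega
      · have := (List.pairwise_append.1 hw.sorted).2.2 b hb a (by simp)
        omega
    omega
  · rw [e, List.mem_append] at hc
    rcases hc with hc | hc
    · rcases hw.origin c hc with h | ⟨b, hb, h⟩
      · exact Or.inl h
      · exact Or.inr ⟨b, by simp [hb], h⟩
    · exact Or.inr ⟨a, by simp, ha, hS, by simpa using hc⟩
  · rw [e, List.mem_append] at hc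
    rcases hc with hc | hc
    · exact hw.range c hc
    · simp only [List.mem_cons, List.not_mem_nil, or_false] at hc; omega
  · rcases hw.complete c h₁ h₂ h₃ with h | ⟨i, hi⟩
    · exact Or.inl (by simp [h])
    · rcases List.mem_cons.1 hi with hi' | hi'
      · rcases i with _ | i
        · simp at hi'; omega
        · rw [pow_succ, ← Nat.div_div_eq_div_mul] at hi'
          refine Or.inr ⟨i, ?_⟩
          simp only [List.mem_append, List.mem_cons, List.not_mem_nil, or_false]
          omega
      · exact Or.inr ⟨i, by simp [hi']⟩
  · rw [hw.mem_dl]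
    simp only [List.mem_append, List.mem_singleton]
    refine and_congr_left fun _ => ⟨Or.inl, Or.rec id fun h => ?_⟩
    omega

lemma Walk.visit_leaf {x v : Fin I.n} {p r : List ℕ} {dl dl' : List (Fin I.n)} {a : ℕ}
    (hw : Walk I f x v p (a :: r) dl) (hS : 2 ^ I.h ≤ a) (hdl : dl'.Nodup)
    (hmem : ∀ u, u ∈ dl' ↔ u ∈ dl ∨ (2 ^ I.h + (u : ℕ) = a ∧ u ∈ I.F x v)) :
    Walk I f x v (p ++ [a]) r dl' := by
  have e : p ++ [a] ++ r = p ++ a :: r := by simp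
  refine ⟨e ▸ hw.sorted, fun c hc => ?_, e ▸ hw.range, fun c h₁ h₂ h₃ => ?_, hdl,
    fun u => ?_⟩
  · rcases hw.origin c (e ▸ hc) with h | ⟨b, hb, h⟩
    · exact Or.inl h
    · exact Or.inr ⟨b, by simp [hb], h⟩
  · rcases hw.complete c h₁ h₂ h₃ with h | ⟨i, hi⟩
    · exact Or.inl (by simp [h])
    · rcases List.mem_cons.1 hi with hi' | hi'
      · refine Or.inl ?_
        rcases i with _ | i
        · simp at hi'; simp [hi']
        · exfalso
          -- A proper ancestor of a leaf is an inner node, so it cannot be the leaf `a`.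
          have h2 : c / 2 ^ (i + 1) ≤ c / 2 := Nat.div_le_div_left (by
            rw [pow_succ]; have := Nat.one_le_two_pow (n := i); omega) (by omega)
          omega
      · exact Or.inr ⟨i, hi'⟩
  · rw [hmem, hw.mem_dl]
    simp only [List.mem_append, List.mem_singleton]
    tauto

lemma Walk.notMem_dl {x v : Fin I.n} {p r : List ℕ} {dl : List (Fin I.n)} {a : ℕ}
    (hw : Walk I f x v p (a :: r) dl) {u : Fin I.n} (hu : 2 ^ I.h + (u : ℕ) = a) : u ∉ dl := by
  intro h
  have h₁ := ((hw.mem_dl u).1 h).1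
  have := (List.pairwise_append.1 hw.sorted).2.2 _ h₁ a (by simp)
  omega

lemma Walk.mem_dl_of_done {x v : Fin I.n} {p : List ℕ} {dl : List (Fin I.n)}
    (hw : Walk I f x v p [] dl) (hf : TrieOk I f) (u : Fin I.n) : u ∈ dl ↔ u ∈ I.F x v := by
  refine ⟨fun h => ((hw.mem_dl u).1 h).2, fun h => (hw.mem_dl u).2 ⟨?_, h⟩⟩
  have hu := u.2.trans I.n_lt_two_pow
  have hne : f v (2 ^ I.h + u) ≠ f x (2 ^ I.h + u) := by
    rw [hf.leaf_fin, hf.leaf_fin]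
    rw [mem_F] at h
    simp [h.1, h.2.2]
  simpa using hw.complete _ (by omega) (by omega) hne

/-- Every queued node is the root or one of the two children of a differing node. A differing node
is one of the `h + 1` ancestors, itself included, of a leaf in the symmetric difference of the
neighbourhoods. -/
lemma Walk.length_le {x v : Fin I.n} {p r : List ℕ} {dl : List (Fin I.n)}
    (hw : Walk I f x v p r dl) (hf : TrieOk I f) :
    (p ++ r).length ≤ 1 + 2 * (((I.N v \ I.N x).card + (I.N x \ I.N v).card) * (I.h + 1)) := by
  classical
  have hnd : (p ++ r).Nodup := hw.sorted.imp fun h => Nat.ne_of_lt h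
  set D : Finset (Fin I.n) := (I.N v \ I.N x) ∪ (I.N x \ I.N v) with hD
  set M : Finset ℕ := (D ×ˢ Finset.range (I.h + 1)).image
    fun y => (2 ^ I.h + (y.1 : ℕ)) / 2 ^ y.2 with hM
  have hsub : (p ++ r).toFinset ⊆ {1} ∪ (M.image (fun a => 2 * a) ∪ M.image fun a => 2 * a + 1) := by
    intro c hc
    rw [List.mem_toFinset] at hc
    rcases hw.origin c hc with rfl | ⟨a, ha, hne, haS, h⟩
    · simp
    · have hap := hw.range a (by simp [ha])
      have haM : a ∈ M := by
        obtain ⟨u, i, hu, hi, hau, hne'⟩ := hf.exists_leaf I.h a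
          (Nat.le_mul_of_pos_left _ hap.1) hap.1 hap.2 hne
        rw [hf.leaf v u hu, hf.leaf x u hu] at hne'
        -- Leaves beyond the vertex range hold 0 in every trie and so never differ.
        have hun : u < I.n := by
          by_contra hun
          simp [hun] at hne'
        rw [hM, Finset.mem_image]
        refine ⟨(⟨u, hun⟩, i), ?_, hau.symm⟩
        simp only [Finset.mem_product, Finset.mem_range, hD, Finset.mem_union, Finset.mem_sdiff,
          mem_N]
        refine ⟨?_, by omega⟩
        by_contra hcon
        apply hne'
        simp only [hun, exists_true_left]
        have : I.G.Adj v ⟨u, hun⟩ ↔ I.G.Adj x ⟨u, hun⟩ := by tauto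
        simp [this]
      simp only [Finset.mem_union, Finset.mem_image]
      rcases h with rfl | rfl
      · exact Or.inr (Or.inl ⟨a, haM, rfl⟩)
      · exact Or.inr (Or.inr ⟨a, haM, rfl⟩)
  have hMc : M.card ≤ ((I.N v \ I.N x).card + (I.N x \ I.N v).card) * (I.h + 1) := by
    refine Finset.card_image_le.trans ?_
    rw [Finset.card_product, Finset.card_range]
    exact Nat.mul_le_mul_right _ (Finset.card_union_le _ _)
  rw [← List.toFinset_card_of_nodup hnd]
  refine (Finset.card_le_card hsub).trans ((Finset.card_union_le _ _).trans ?_)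
  have h₁ := Finset.card_union_le (M.image (fun a => 2 * a)) (M.image fun a => 2 * a + 1)
  have h₂ := Finset.card_image_le (s := M) (f := fun a => 2 * a)
  have h₃ := Finset.card_image_le (s := M) (f := fun a => 2 * a + 1)
  simp only [Finset.card_singleton]
  omega

/-- A traversal that meets too many nodes certifies that `F x v` is large. -/
lemma Walk.large {x v : Fin I.n} {p r : List ℕ} {dl : List (Fin I.n)}
    (hw : Walk I f x v p r dl) (hf : TrieOk I f) (hx : (I.N x).card ≤ I.k + 2 * I.ℓ)
    (hlen : 400 * I.ℓ * I.h * I.h < (p ++ r).length) : 40 * I.ℓ * I.h ≤ (I.F x v).card := by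
  by_contra! hF
  have h₁ := card_N_sdiff_le hx hF
  have h₂ := hw.length_le hf
  have h₃ := I.one_le_h
  have h₅ := I.hℓ
  -- 82 = 40 + 2 + 40. With h + 1 ≤ 2h the traversal has at most 1 + 2 · 82 · 2 · ℓh² ≤ 329ℓh²
  -- nodes, below the cutoff 400ℓh².
  have h₄ : (I.N v \ I.N x).card + (I.N x \ I.N v).card ≤ 82 * I.ℓ * I.h := by
    nlinarith [h₁.1, h₁.2]
  have h₆ := Nat.mul_le_mul_right (I.h + 1) h₄
  have h₇ : I.ℓ * I.h ≤ I.ℓ * I.h * I.h := Nat.le_mul_of_pos_right _ h₃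
  have h₈ : 1 ≤ I.ℓ * I.h := Nat.mul_pos h₅ h₃
  nlinarith

end Inst

end VertexConn

namespace VertexConn
namespace Inst

variable {I : Inst}

/-! #### Candidates -/

lemma count_flatMap_A (lows : List (Fin I.n)) (w : Fin I.n) :
    (lows.flatMap I.A).count w = lows.countP fun u => decide (w ∈ I.N u) := by
  induction lows with
  | nil => simp
  | cons u l ih =>
    rw [List.flatMap_cons, List.count_append, ih, List.countP_cons, add_comm]
    congr 1
    by_cases h : I.G.Adj u w
    · rw [List.count_eq_one_of_mem (I.hA u).1 (mem_A.2 h)]; simp [h]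
    · rw [List.count_eq_zero_of_not_mem (fun h' => h (mem_A.1 h'))]; simp [h]

/-- A vertex that is not close to `T_x` is adjacent to most neighbours of `x`. -/
lemma Good.le_count (hG : I.Good) {x w : Fin I.n} (hx : (I.N x).card ≤ I.k + 2 * I.ℓ)
    {lows : List (Fin I.n)} (hnd : lows.Nodup) (hsub : ∀ u ∈ lows, I.G.Adj x u)
    (hlen : 84 * I.ℓ * I.h ≤ lows.length) (hw : ¬ I.Bad x w) :
    42 * I.ℓ * I.h ≤ (lows.flatMap I.A).count w := by
  have hF : (I.F x w).card < 40 * I.ℓ * I.h := by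
    by_contra! h; exact hw (hG.bad h)
  have h₁ := (card_N_sdiff_le hx hF).1
  rw [count_flatMap_A]
  have h₂ := List.length_eq_countP_add_countP (fun u => decide (w ∈ I.N u)) (l := lows)
  -- The listed neighbours of `x` that miss `w` lie in N(x) \ N(w), which has at most 40ℓh + 2ℓ ≤
  -- 42ℓh elements, half of the 84ℓh required.
  have h₃ : lows.countP (fun u => !decide (w ∈ I.N u)) ≤ (I.N x \ I.N w).card := by
    rw [List.countP_eq_length_filter, ← List.toFinset_card_of_nodup (hnd.filter _)]
    refine Finset.card_le_card fun u hu => ?_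
    simp only [List.mem_toFinset, List.mem_filter, mem_N, Bool.not_eq_true',
      decide_eq_false_iff_not, Finset.mem_sdiff] at hu ⊢
    exact ⟨hsub u hu.1, fun h => hu.2 h.symm⟩
  simp only [decide_not, Bool.decide_eq_true] at h₂
  have h₄ := I.mul_h_facts.1
  have e₁ : 40 * I.ℓ * I.h = 40 * (I.ℓ * I.h) := by ring
  have e₂ : 84 * I.ℓ * I.h = 84 * (I.ℓ * I.h) := by ring
  have e₃ : 42 * I.ℓ * I.h = 42 * (I.ℓ * I.h) := by ring
  rw [e₁] at h₁; rw [e₂] at hlen; rw [e₃]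
  omega

/-- Double counting. With `vis` the concatenated lists of 84ℓh vertices of degree at most 8k and
threshold 42ℓh, it bounds the number of candidates by 16k. -/
lemma length_mul_le_of_le_count {α : Type*} [DecidableEq α] {l vis : List α} (hl : l.Nodup) {q : ℕ}
    (h : ∀ w ∈ l, q ≤ vis.count w) : l.length * q ≤ vis.length := by
  rw [← List.toFinset_card_of_nodup hl, ← smul_eq_mul, ← Finset.sum_const]
  calc ∑ w ∈ l.toFinset, q ≤ ∑ w ∈ l.toFinset, vis.count w :=
        Finset.sum_le_sum fun w hw => h w (List.mem_toFinset.1 hw)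
    _ = ∑ w ∈ l.toFinset, (vis : Multiset α).count w := by simp
    _ ≤ ∑ w ∈ l.toFinset ∪ (vis : Multiset α).toFinset, (vis : Multiset α).count w :=
        Finset.sum_le_sum_of_subset Finset.subset_union_left
    _ = (vis : Multiset α).card := by
        refine Multiset.sum_count_eq_card fun a ha => ?_
        exact Finset.mem_union_right _ (Multiset.mem_toFinset.2 ha)
    _ = vis.length := by simp

/-! #### Scratches -/

lemma ncard_neighborSet (v : Fin I.n) : (I.G.neighborSet v).ncard = (I.A v).length := by
  rw [← card_N, ← Set.ncard_coe_finset]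
  congr 1
  ext u
  simp

lemma h_le_log : (I.h : ℝ) ≤ 1.5 * Real.log I.n + 1 := by
  have h1 := I.one_le_h
  have : 2 ^ (I.h - 1) ≤ I.n := Nat.lt_size.1 (by unfold h at *; omega)
  have h2 : ((2 : ℝ) ^ (I.h - 1)) ≤ I.n := by exact_mod_cast this
  have h3 := Real.log_le_log (by positivity) h2
  rw [Real.log_pow, Nat.cast_sub h1] at h3
  -- The factor 1.5 exceeds 1 / ln 2.
  have h4 := Real.log_two_gt_d9
  have h5 : (1 : ℝ) ≤ I.h := by exact_mod_cast h1
  push_cast at h3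
  nlinarith

lemma one_le_log : 1 ≤ Real.log I.n := by
  rw [Real.le_log_iff_exp_le (by have := I.hn; positivity)]
  have h1 := Real.exp_one_lt_d9
  have h2 : (400 : ℝ) ≤ I.n := by exact_mod_cast I.hn
  linarith

/-- A suitable scratch bounds the degree of `x` and provides many neighbours of low degree. -/
lemma low_of_scratch {x : Fin I.n} (hs : HasSuitableScratch I.G I.k I.ℓ I.T x) :
    (I.A x).length ≤ I.k + 2 * I.ℓ ∧
      84 * I.ℓ * I.h ≤ ((I.N x).filter fun u => (I.A u).length ≤ 8 * I.k).card := by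
  classical
  obtain ⟨L, S, R, hsc, -, -, hL₁, hL₂, hx⟩ := hs
  have hcut := hsc.isVertexCut
  have hN : ∀ u, I.G.Adj x u → u ∈ L ∨ u ∈ S := by
    intro u hu
    have hu' : u ∈ L ∪ S ∪ R := by rw [hcut.union_eq]; trivial
    rcases hu' with h | h
    · exact h
    · exact absurd (by simpa using hu) (hcut.not_adj x hx u h)
  have hLS := hcut.disjoint_LS
  lift L to Finset (Fin I.n) using L.toFinite
  lift S to Finset (Fin I.n) using S.toFinite
  simp only [Finset.mem_coe] at hN hx
  have hSk := hsc.card_S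
  have hlow := hsc.card_low
  rw [Set.ncard_coe_finset] at hL₁ hL₂ hSk hlow
  have hset : {v ∈ (S : Set (Fin I.n)) | (I.G.neighborSet v).ncard ≤ 8 * I.k}
      = ((S.filter fun v => (I.A v).length ≤ 8 * I.k : Finset (Fin I.n)) : Set (Fin I.n)) := by
    ext v; simp [ncard_neighborSet]
  rw [hset, Set.ncard_coe_finset, Fintype.card_fin] at hlow
  -- All neighbours of `x` lie in L ∪ S. Hence deg(x) < |L| + k, and |L| ≤ 2ℓ.
  have hNsub : I.N x ⊆ L.erase x ∪ (S ∩ I.N x) := by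
    intro u hu
    have hu' := mem_N.1 hu
    rcases hN u hu' with h | h
    · exact Finset.mem_union_left _ (Finset.mem_erase.2 ⟨hu'.ne', h⟩)
    · exact Finset.mem_union_right _ (Finset.mem_inter.2 ⟨h, hu⟩)
  have h₁ := (Finset.card_le_card hNsub).trans (Finset.card_union_le _ _)
  rw [Finset.card_erase_of_mem hx] at h₁
  have hLpos : 0 < L.card := Finset.card_pos.2 ⟨x, hx⟩
  have h₂ := I.hdeg x
  have h₃ := Finset.card_sdiff_add_card_inter S (I.N x)
  have hL₃ : L.card ≤ 2 * I.ℓ := by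
    have : (L.card : ℝ) ≤ 2 * I.ℓ := by linarith
    exact_mod_cast this
  rw [card_N] at h₁
  refine ⟨by omega, ?_⟩
  have h₄ : (S.filter fun v => (I.A v).length ≤ 8 * I.k).card
      ≤ ((I.N x).filter fun u => (I.A u).length ≤ 8 * I.k).card + (S \ I.N x).card := by
    refine (Finset.card_le_card fun v hv => ?_).trans (Finset.card_union_le _ _)
    simp only [Finset.mem_filter, Finset.mem_union, Finset.mem_sdiff] at hv ⊢
    tauto
  -- At least k neighbours of `x` lie in L ∪ S, and fewer than |L| of them in L. As |S| < k, fewer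
  -- than |L| elements of S are not neighbours of `x`.
  have h₅ : (S \ I.N x).card ≤ L.card := by omega
  have h₆ : ((S.filter fun v => (I.A v).length ≤ 8 * I.k).card : ℝ)
      ≤ ((I.N x).filter fun u => (I.A u).length ≤ 8 * I.k).card + (L.card : ℝ) := by
    exact_mod_cast h₄.trans (by omega)
  have hlog := I.one_le_log
  have hh := I.h_le_log
  have hL₂' : (I.ℓ : ℝ) ≤ L.card := by exact_mod_cast hL₂
  have hℓ0 : (0 : ℝ) ≤ I.ℓ := by positivity
  have : ((84 * I.ℓ * I.h : ℕ) : ℝ)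
      ≤ ((I.N x).filter fun u => (I.A u).length ≤ 8 * I.k).card := by
    push_cast
    have a₁ : 84 * (I.ℓ : ℝ) * I.h ≤ 84 * I.ℓ * (1.5 * Real.log I.n + 1) := by gcongr
    have a₂ : (I.ℓ : ℝ) * (300 * Real.log I.n - 1) ≤ L.card * (300 * Real.log I.n - 1) :=
      mul_le_mul_of_nonneg_right hL₂' (by linarith)
    -- 126 ln n + 84 ≤ 300 ln n - 1 because ln n ≥ 1. This is where the factor 300 in the definition
    -- of a scratch is used.
    have a₃ : (I.ℓ : ℝ) * (84 * (1.5 * Real.log I.n + 1)) ≤ I.ℓ * (300 * Real.log I.n - 1) :=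
      mul_le_mul_of_nonneg_left (by linarith) hℓ0
    nlinarith
  exact_mod_cast this

/-! #### Collecting the kernel -/

/-- The data collected for `x` after the vertices of `P` have been examined: `acc` lists those that
are not close to `T_x`, `arcs` are pairs of such a vertex and a neighbour of it outside of `N[x]`,
and `vs`, `es` and `zs` list vertices and edges of the kernel and elements of `Z`. -/
structure Collected (I : Inst) (x : Fin I.n) (P acc : List (Fin I.n))
    (arcs : Set (Fin I.n × Fin I.n)) (vs : List (Option (Fin I.n)))
    (es : List (Option (Fin I.n) × Option (Fin I.n))) (zs : List (Fin I.n)) : Prop where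
  acc_nodup : acc.Nodup
  acc_sub : ∀ v ∈ acc, v ∈ P
  acc_ne : ∀ v ∈ P, v ≠ x
  acc_ok : ∀ v ∈ acc, ¬ I.Bad x v ∧ (I.F x v).card ≤ 400 * I.ℓ * I.h * I.h
  rej : ∀ v ∈ P, v ∉ acc → I.Bad x v ∨ 40 * I.ℓ * I.h ≤ (I.F x v).card
  arcs_sub : ∀ a u, (a, u) ∈ arcs → a ∈ acc ∧ u ∈ I.F x a
  zs_nodup : zs.Nodup
  mem_zs : ∀ z, z ∈ zs ↔ z ∈ P ∧ I.G.Adj x z ∧ z ∉ acc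
  vs_nodup : vs.Nodup
  none_mem : none ∈ vs
  mem_vs : ∀ v, some v ∈ vs ↔ v = x ∨ v ∈ acc ∨ ∃ a, (a, v) ∈ arcs
  es_nodup : (es.map fun e => s(e.1, e.2)).Nodup
  mem_es : ∀ e, e ∈ (es.map fun e => s(e.1, e.2)) ↔
    (∃ a ∈ acc, I.G.Adj x a ∧ e = s(some x, some a)) ∨
      ∃ a u, (a, u) ∈ arcs ∧ e = s(some a, some u)

lemma collected_init (x : Fin I.n) : Collected I x [] [] ∅ [none, some x] [] [] where
  acc_nodup := by simp
  acc_sub := by simp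
  acc_ne := by simp
  acc_ok := by simp
  rej := by simp
  arcs_sub := by simp
  zs_nodup := by simp
  mem_zs := by simp
  vs_nodup := by simp
  none_mem := by simp
  mem_vs := by simp
  es_nodup := by simp
  mem_es := by simp

variable {x : Fin I.n} {P acc zs zs' : List (Fin I.n)} {arcs : Set (Fin I.n × Fin I.n)}
  {vs vs' : List (Option (Fin I.n))} {es es' : List (Option (Fin I.n) × Option (Fin I.n))}

/-- Examine a vertex that is found to be close to `T_x`. -/
lemma Collected.reject (hc : Collected I x P acc arcs vs es zs) {v : Fin I.n} (hv : v ∉ P)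
    (hvx : v ≠ x) (hbad : I.Bad x v ∨ 40 * I.ℓ * I.h ≤ (I.F x v).card)
    (hzs : I.G.Adj x v ∧ zs' = zs ++ [v] ∨ ¬ I.G.Adj x v ∧ zs' = zs) :
    Collected I x (P ++ [v]) acc arcs vs es zs' := by
  have hva : v ∉ acc := fun h => hv (hc.acc_sub v h)
  refine { hc with acc_sub := ?_, acc_ne := ?_, rej := ?_, zs_nodup := ?_, mem_zs := ?_ }
  · intro a ha; simp [hc.acc_sub a ha]
  · intro a ha
    rcases List.mem_append.1 ha with h | h
    · exact hc.acc_ne a h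
    · rw [List.mem_singleton.1 h]; exact hvx
  · intro a ha ha'
    rcases List.mem_append.1 ha with h | h
    · exact hc.rej a h ha'
    · rw [List.mem_singleton.1 h]; exact hbad
  · rcases hzs with ⟨-, rfl⟩ | ⟨-, rfl⟩
    · rw [List.nodup_append]
      refine ⟨hc.zs_nodup, by simp, ?_⟩
      rintro a ha b hb rfl
      rw [List.mem_singleton.1 hb] at ha
      exact hv ((hc.mem_zs v).1 ha).1
    · exact hc.zs_nodup
  · intro z
    rcases hzs with ⟨h, rfl⟩ | ⟨h, rfl⟩
    · simp only [List.mem_append, List.mem_singleton, hc.mem_zs]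
      constructor
      · rintro (h' | rfl)
        · tauto
        · tauto
      · tauto
    · rw [hc.mem_zs]
      simp only [List.mem_append, List.mem_singleton]
      constructor
      · tauto
      · rintro ⟨h₁ | rfl, h₂⟩
        · exact ⟨h₁, h₂⟩
        · exact absurd h₂.1 h

/-- Examine a vertex that is found not to be close to `T_x`. -/
lemma Collected.accept (hc : Collected I x P acc arcs vs es zs) {v : Fin I.n} (hv : v ∉ P)
    (hvx : v ≠ x) (hok : ¬ I.Bad x v ∧ (I.F x v).card ≤ 400 * I.ℓ * I.h * I.h)
    (hvs : some v ∈ vs ∧ vs' = vs ∨ some v ∉ vs ∧ vs' = vs ++ [some v])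
    (hes : I.G.Adj x v ∧ es' = es ++ [(some x, some v)] ∨ ¬ I.G.Adj x v ∧ es' = es) :
    Collected I x (P ++ [v]) (acc ++ [v]) arcs vs' es' zs := by
  have hva : v ∉ acc := fun h => hv (hc.acc_sub v h)
  have hvz : v ∉ zs := fun h => hv ((hc.mem_zs v).1 h).1
  refine ⟨?_, ?_, ?_, ?_, ?_, ?_, hc.zs_nodup, ?_, ?_, ?_, ?_, ?_, ?_⟩
  · rw [List.nodup_append]
    refine ⟨hc.acc_nodup, by simp, ?_⟩
    rintro a ha b hb rfl
    rw [List.mem_singleton.1 hb] at ha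
    exact hva ha
  · intro a ha
    rcases List.mem_append.1 ha with h | h
    · simp [hc.acc_sub a h]
    · simp [List.mem_singleton.1 h]
  · intro a ha
    rcases List.mem_append.1 ha with h | h
    · exact hc.acc_ne a h
    · rw [List.mem_singleton.1 h]; exact hvx
  · intro a ha
    rcases List.mem_append.1 ha with h | h
    · exact hc.acc_ok a h
    · rw [List.mem_singleton.1 h]; exact hok
  · intro a ha ha'
    simp only [List.mem_append, List.mem_singleton, not_or] at ha ha'
    exact hc.rej a (ha.resolve_right ha'.2) ha'.1
  · intro a u h
    have := hc.arcs_sub a u h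
    exact ⟨by simp [this.1], this.2⟩
  · intro z
    rw [hc.mem_zs]
    simp only [List.mem_append, List.mem_singleton, not_or]
    constructor
    · rintro ⟨h₁, h₂, h₃⟩
      exact ⟨Or.inl h₁, h₂, h₃, fun h => hv (h ▸ h₁)⟩
    · tauto
  · rcases hvs with ⟨-, rfl⟩ | ⟨h, rfl⟩
    · exact hc.vs_nodup
    · rw [List.nodup_append]
      refine ⟨hc.vs_nodup, by simp, ?_⟩
      rintro a ha b hb rfl
      rw [List.mem_singleton.1 hb] at ha
      exact h ha
  · rcases hvs with ⟨-, rfl⟩ | ⟨h, rfl⟩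
    · exact hc.none_mem
    · simp [hc.none_mem]
  · intro w
    rcases hvs with ⟨h, rfl⟩ | ⟨h, rfl⟩
    · have := (hc.mem_vs v).1 h
      rw [hc.mem_vs]
      simp only [List.mem_append, List.mem_singleton]
      constructor
      · tauto
      · rintro (h' | (h' | rfl) | h')
        · tauto
        · tauto
        · exact this
        · tauto
    · simp only [List.mem_append, List.mem_singleton, hc.mem_vs, Option.some.injEq]
      tauto
  · rcases hes with ⟨h, rfl⟩ | ⟨h, rfl⟩
    · rw [List.map_append, List.nodup_append]
      refine ⟨hc.es_nodup, by simp, ?_⟩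
      rintro e he b hb rfl
      simp only [List.map_cons, List.map_nil, List.mem_singleton] at hb
      subst hb
      -- The edge is new: an old edge from `x` to `v` would mean that `v` had been accepted before,
      -- and arcs never touch `x`.
      rcases (hc.mem_es _).1 he with ⟨a, ha, -, h'⟩ | ⟨a, u, hau, h'⟩
      · have : v = a := by simpa [hvx] using h'
        exact hva (this ▸ ha)
      · have h₁ := hc.arcs_sub a u hau
        have h₂ := mem_F.1 h₁.2
        have h₃ := hc.acc_ne a (hc.acc_sub a h₁.1)
        simp only [Sym2.eq_iff, Option.some.injEq] at h'
        rcases h' with ⟨h', -⟩ | ⟨h', -⟩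
        · exact h₃ h'.symm
        · exact h₂.2.1 h'.symm
    · exact hc.es_nodup
  · intro e
    rcases hes with ⟨h, rfl⟩ | ⟨h, rfl⟩
    · rw [List.map_append, List.mem_append, hc.mem_es]
      simp only [List.map_cons, List.map_nil, List.mem_singleton, List.mem_append]
      constructor
      · rintro ((⟨a, h₁, h₂⟩ | h') | rfl)
        · exact Or.inl ⟨a, Or.inl h₁, h₂⟩
        · exact Or.inr h'
        · exact Or.inl ⟨v, Or.inr rfl, h, rfl⟩
      · rintro (⟨a, h₁ | rfl, h₂⟩ | h')
        · exact Or.inl (Or.inl ⟨a, h₁, h₂⟩)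
        · exact Or.inr h₂.2
        · exact Or.inl (Or.inr h')
    · rw [hc.mem_es]
      simp only [List.mem_append, List.mem_singleton]
      constructor
      · rintro (⟨a, h₁, h₂⟩ | h')
        · exact Or.inl ⟨a, Or.inl h₁, h₂⟩
        · exact Or.inr h'
      · rintro (⟨a, h₁ | rfl, h₂⟩ | h₃)
        · exact Or.inl ⟨a, h₁, h₂⟩
        · exact absurd h₂.1 h
        · exact Or.inr h₃

/-- Record the pair of the accepted vertex `v` and a neighbour `u` of it. -/
lemma Collected.arc (hc : Collected I x P acc arcs vs es zs) {v u : Fin I.n} (hv : v ∈ acc)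
    (hu : u ∈ I.F x v) (hnew : (v, u) ∉ arcs)
    (hcomplete : ∀ a ∈ acc, a ≠ v → ∀ w ∈ I.F x a, (a, w) ∈ arcs)
    (hvs : some u ∈ vs ∧ vs' = vs ∨ some u ∉ vs ∧ vs' = vs ++ [some u])
    (hes : (u ∈ acc ∧ ¬ I.G.Adj x v) ∧ es' = es ∨
      ¬ (u ∈ acc ∧ ¬ I.G.Adj x v) ∧ es' = es ++ [(some v, some u)]) :
    Collected I x P acc (insert (v, u) arcs) vs' es' zs := by
  have hvx := hc.acc_ne v (hc.acc_sub v hv)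
  have hu' := mem_F.1 hu
  refine ⟨hc.acc_nodup, hc.acc_sub, hc.acc_ne, hc.acc_ok, hc.rej, ?_, hc.zs_nodup, hc.mem_zs, ?_,
    ?_, ?_, ?_, ?_⟩
  · rintro a w (h | h)
    · obtain ⟨rfl, rfl⟩ := Prod.mk.inj h
      exact ⟨hv, hu⟩
    · exact hc.arcs_sub a w h
  · rcases hvs with ⟨-, rfl⟩ | ⟨h, rfl⟩
    · exact hc.vs_nodup
    · rw [List.nodup_append]
      refine ⟨hc.vs_nodup, by simp, ?_⟩
      rintro a ha b hb rfl
      rw [List.mem_singleton.1 hb] at ha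
      exact h ha
  · rcases hvs with ⟨-, rfl⟩ | ⟨h, rfl⟩
    · exact hc.none_mem
    · simp [hc.none_mem]
  · intro w
    rcases hvs with ⟨h, rfl⟩ | ⟨h, rfl⟩
    · have := (hc.mem_vs u).1 h
      rw [hc.mem_vs]
      simp only [Set.mem_insert_iff, Prod.mk.injEq]
      constructor
      · rintro (h' | h' | ⟨a, h'⟩)
        · tauto
        · tauto
        · exact Or.inr (Or.inr ⟨a, Or.inr h'⟩)
      · rintro (h' | h' | ⟨a, ⟨-, rfl⟩ | h'⟩)
        · tauto
        · tauto
        · exact this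
        · exact Or.inr (Or.inr ⟨a, h'⟩)
    · simp only [List.mem_append, List.mem_singleton, hc.mem_vs, Option.some.injEq,
        Set.mem_insert_iff, Prod.mk.injEq]
      constructor
      · rintro ((h' | h' | ⟨a, h'⟩) | rfl)
        · tauto
        · tauto
        · exact Or.inr (Or.inr ⟨a, Or.inr h'⟩)
        · exact Or.inr (Or.inr ⟨v, Or.inl ⟨rfl, rfl⟩⟩)
      · rintro (h' | h' | ⟨a, ⟨-, rfl⟩ | h'⟩)
        · tauto
        · tauto
        · exact Or.inr rfl
        · exact Or.inl (Or.inr (Or.inr ⟨a, h'⟩))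
  · rcases hes with ⟨h, rfl⟩ | ⟨h, rfl⟩
    · exact hc.es_nodup
    · rw [List.map_append, List.nodup_append]
      refine ⟨hc.es_nodup, by simp, ?_⟩
      rintro e he b hb rfl
      simp only [List.map_cons, List.map_nil, List.mem_singleton] at hb
      subst hb
      rcases (hc.mem_es _).1 he with ⟨a, ha, -, h'⟩ | ⟨a, w, haw, h'⟩
      · simp only [Sym2.eq_iff, Option.some.injEq] at h'
        rcases h' with ⟨h', -⟩ | ⟨-, h'⟩
        · exact hvx h'
        · exact hu'.2.1 h'
      · simp only [Sym2.eq_iff, Option.some.injEq] at h'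
        rcases h' with ⟨rfl, rfl⟩ | ⟨rfl, rfl⟩
        · exact hnew haw
        -- Recorded already as the reverse arc, the edge would have an accepted end `u` and an end
        -- `v` outside N(x), the case in which it is not recorded again.
        · have h₁ := hc.arcs_sub _ _ haw
          exact h ⟨h₁.1, (mem_F.1 h₁.2).2.2⟩
  · intro e
    rcases hes with ⟨h, rfl⟩ | ⟨h, rfl⟩
    · rw [hc.mem_es]
      refine or_congr_right ⟨?_, ?_⟩
      · rintro ⟨a, w, haw, h'⟩
        exact ⟨a, w, Or.inr haw, h'⟩
      · rintro ⟨a, w, haw | haw, rfl⟩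
        · obtain ⟨rfl, rfl⟩ := Prod.mk.inj haw
          -- The omitted edge is present from its other end: when that end was accepted, all its
          -- neighbours outside N[x] were recorded.
          refine ⟨w, a, hcomplete w h.1 hu'.1.ne' a ?_, Sym2.eq_swap⟩
          exact mem_F.2 ⟨hu'.1.symm, hvx, h.2⟩
        · exact ⟨a, w, haw, rfl⟩
    · rw [List.map_append, List.mem_append, hc.mem_es]
      simp only [List.map_cons, List.map_nil, List.mem_singleton]
      constructor
      · rintro ((h' | ⟨a, w, haw, h'⟩) | rfl)
        · exact Or.inl h'
        · exact Or.inr ⟨a, w, Or.inr haw, h'⟩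
        · exact Or.inr ⟨v, u, Or.inl rfl, rfl⟩
      · rintro (h' | ⟨a, w, haw | haw, rfl⟩)
        · exact Or.inl (Or.inl h')
        · obtain ⟨rfl, rfl⟩ := Prod.mk.inj haw
          exact Or.inr rfl
        · exact Or.inl (Or.inr ⟨a, w, haw, rfl⟩)

/-- Each edge is charged to an accepted vertex. The bound `M` is left open because it is used twice:
with 400ℓh², which holds for every T, for the running time, and with 40ℓh, which needs `Good`, for
the size of the kernel. -/
lemma Collected.length_es_le (hc : Collected I x P acc arcs vs es zs) {M : ℕ}
    (hM : ∀ a ∈ acc, (I.F x a).card ≤ M) : es.length ≤ acc.length * (M + 1) := by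
  classical
  rw [← List.length_map (fun e : Option (Fin I.n) × Option (Fin I.n) => s(e.1, e.2)),
    ← List.toFinset_card_of_nodup hc.es_nodup]
  have hsub : (es.map fun e => s(e.1, e.2)).toFinset ⊆ acc.toFinset.biUnion fun a =>
      insert s(some x, some a) ((I.F x a).image fun u => s(some a, some u)) := by
    intro e he
    rw [List.mem_toFinset, hc.mem_es] at he
    simp only [Finset.mem_biUnion, List.mem_toFinset, Finset.mem_insert, Finset.mem_image]
    rcases he with ⟨a, ha, -, rfl⟩ | ⟨a, u, hau, rfl⟩
    · exact ⟨a, ha, Or.inl rfl⟩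
    · have := hc.arcs_sub a u hau
      exact ⟨a, this.1, Or.inr ⟨u, this.2, rfl⟩⟩
  refine (Finset.card_le_card hsub).trans ((Finset.card_biUnion_le_card_mul _ _ (M + 1) ?_).trans
    (Nat.mul_le_mul_right _ (List.toFinset_card_le _)))
  intro a ha
  refine (Finset.card_insert_le _ _).trans ?_
  have := hM a (List.mem_toFinset.1 ha)
  have := Finset.card_image_le (s := I.F x a) (f := fun u => s(some a, some u))
  omega

lemma Collected.length_vs_le (hc : Collected I x P acc arcs vs es zs) {M : ℕ}
    (hM : ∀ a ∈ acc, (I.F x a).card ≤ M) : vs.length ≤ 2 + acc.length * (M + 1) := by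
  classical
  rw [← List.toFinset_card_of_nodup hc.vs_nodup]
  have hsub : vs.toFinset ⊆ {none, some x} ∪ acc.toFinset.biUnion fun a =>
      insert (some a) ((I.F x a).image some) := by
    intro e he
    rw [List.mem_toFinset] at he
    simp only [Finset.mem_biUnion, List.mem_toFinset, Finset.mem_insert, Finset.mem_image,
      Finset.mem_union, Finset.mem_singleton]
    rcases e with _ | v
    · simp
    · rcases (hc.mem_vs v).1 he with rfl | h | ⟨a, h⟩
      · simp
      · exact Or.inr ⟨v, h, Or.inl rfl⟩
      · have := hc.arcs_sub a v h
        exact Or.inr ⟨a, this.1, Or.inr ⟨v, this.2, rfl⟩⟩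
  refine (Finset.card_le_card hsub).trans ((Finset.card_union_le _ _).trans
    (Nat.add_le_add Finset.card_le_two
      ((Finset.card_biUnion_le_card_mul _ _ (M + 1) ?_).trans
        (Nat.mul_le_mul_right _ (List.toFinset_card_le _)))))
  intro a ha
  refine (Finset.card_insert_le _ _).trans ?_
  have := hM a (List.mem_toFinset.1 ha)
  have := Finset.card_image_le (s := I.F x a) (f := some)
  omega

/-- The answer that describes a kernel. -/
def kernelWords (vs : List (Option (Fin I.n))) (es : List (Option (Fin I.n) × Option (Fin I.n)))
    (zs : List (Fin I.n)) : List ℕ :=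
  1 :: vs.length :: vs.map vertexCode
    ++ es.length :: (es.flatMap fun e => [vertexCode e.1, vertexCode e.2])
    ++ zs.length :: zs.map Fin.val

/-- On the event `Good` a rejected vertex is bad, so the accepted vertices are exactly the examined
ones that are not bad. A bad neighbour of `x` is not in T_x, hence is adjacent to T_x, and `zs` is
the required set Z. As all candidates have been examined, a vertex of the kernel other than `x` that
was not accepted is bad; being a neighbour of an accepted vertex it is not in T_x, so it is adjacent
to T_x and belongs next to the sink. -/
lemma Collected.isCorrectAnswer (hc : Collected I x P acc arcs vs es zs) (hG : I.Good)
    {C : ℝ} (hC : 5000 ≤ C) (hB : (farTerminals I.G I.T x).Nonempty)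
    (hNP : ∀ v, I.G.Adj x v → v ∈ P)
    (hcand : ∀ w, w ≠ x → ¬ I.G.Adj x w → ¬ I.Bad x w → w ∈ P) (hP : P.length ≤ 18 * I.k)
    (harcs : ∀ a ∈ acc, ∀ u ∈ I.F x a, (a, u) ∈ arcs)
    (hes_nodup : (es'.map fun e => s(e.1, e.2)).Nodup)
    (hlen : es'.length ≤ es.length + vs.length - 2)
    (hmem_es : ∀ e, e ∈ (es'.map fun e => s(e.1, e.2)) ↔
      e ∈ (es.map fun e => s(e.1, e.2)) ∨
        ∃ v, some v ∈ vs ∧ v ≠ x ∧ v ∉ acc ∧ e = s(some v, none)) :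
    IsCorrectAnswer C I.G I.k I.ℓ I.T x (kernelWords vs es' zs) := by
  classical
  have hacc : ∀ v, v ∈ acc ↔ v ∈ P ∧ ¬ I.Bad x v := fun v =>
    ⟨fun h => ⟨hc.acc_sub v h, (hc.acc_ok v h).1⟩, fun h => by
      by_contra h'
      rcases hc.rej v h.1 h' with h'' | h''
      · exact h.2 h''
      · exact h.2 (hG.bad h'')⟩
  have hxbad : ¬ I.Bad x x := by
    rintro (h | ⟨b, hb, h⟩)
    · exact (mem_farTerminals.1 h).2.1 rfl
    · exact (mem_farTerminals.1 hb).2.2 h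
  have hmem : ∀ a b, s(a, b) ∈ es'.map (fun e => s(e.1, e.2)) → a ∈ vs ∧ a ≠ b := by
    intro a b hab
    rw [hmem_es, hc.mem_es] at hab
    rcases hab with (⟨v, hv, hxv, h⟩ | ⟨v, u, hvu, h⟩) | ⟨v, hv, -, -, h⟩
    · have h₁ := (hc.mem_vs v).2 (Or.inr (Or.inl hv))
      have h₂ := (hc.mem_vs x).2 (Or.inl rfl)
      simp only [Sym2.eq_iff] at h
      rcases h with ⟨rfl, rfl⟩ | ⟨rfl, rfl⟩
      · exact ⟨h₂, by simpa using hxv.ne⟩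
      · exact ⟨h₁, by simpa using hxv.ne'⟩
    · have h₀ := hc.arcs_sub v u hvu
      have h₁ := (hc.mem_vs v).2 (Or.inr (Or.inl h₀.1))
      have h₂ := (hc.mem_vs u).2 (Or.inr (Or.inr ⟨v, hvu⟩))
      have h₃ := (mem_F.1 h₀.2).1.ne
      simp only [Sym2.eq_iff] at h
      rcases h with ⟨rfl, rfl⟩ | ⟨rfl, rfl⟩
      · exact ⟨h₁, by simpa using h₃⟩
      · exact ⟨h₂, by simpa using h₃.symm⟩
    · simp only [Sym2.eq_iff] at h
      rcases h with ⟨rfl, rfl⟩ | ⟨rfl, rfl⟩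
      · exact ⟨hv, by simp⟩
      · exact ⟨hc.none_mem, by simp⟩
  let H : KernelGraph I.n :=
    { verts := {v | v ∈ vs}
      Adj := fun a b => s(a, b) ∈ es'.map (fun e => s(e.1, e.2))
      adj_sub := fun h => (hmem _ _ h).2
      edge_vert := fun h => (hmem _ _ h).1
      symm := ⟨fun a b h => by rwa [Sym2.eq_swap]⟩ }
  have hedge : ∀ e, e ∈ es'.map (fun e => s(e.1, e.2)) ↔ e ∈ H.edgeSet := by
    intro e
    induction e using Sym2.ind with
    | _ a b => rfl
  have hHss : ∀ u v, H.Adj (some u) (some v) ↔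
      (∃ a ∈ acc, I.G.Adj x a ∧ s(some u, some v) = s(some x, some a)) ∨
      ∃ a w, (a, w) ∈ arcs ∧ s(some u, some v) = s(some a, some w) := by
    intro u v
    change s(some u, some v) ∈ _ ↔ _
    rw [hmem_es, hc.mem_es]
    constructor
    · rintro (h | ⟨w, -, -, -, h⟩)
      · exact h
      · simp at h
    · exact Or.inl
  -- The head of an arc lies outside N[x]; unless it is bad, it is a candidate, so it was examined
  -- and accepted.
  have hcl : ∀ v, some v ∈ vs → (v ∈ acc ∨ v = x) ∨ (I.Bad x v ∧ ¬ I.G.Adj x v ∧ v ≠ x) := by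
    intro v hv
    rcases (hc.mem_vs v).1 hv with h | h | ⟨a, h⟩
    · exact Or.inl (Or.inr h)
    · exact Or.inl (Or.inl h)
    · have h₀ := hc.arcs_sub a v h
      have h₁ := mem_F.1 h₀.2
      by_cases hbad : I.Bad x v
      · exact Or.inr ⟨hbad, h₁.2.2, h₁.2.1⟩
      · exact Or.inl (Or.inl ((hacc v).2 ⟨hcand v h₁.2.1 h₁.2.2 hbad, hbad⟩))
  have hNx : ∀ v, I.G.Adj x v → some v ∈ vs ∨ v ∈ zs := by
    intro v hv
    by_cases h : v ∈ acc
    · exact Or.inl ((hc.mem_vs v).2 (Or.inr (Or.inl h)))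
    · exact Or.inr ((hc.mem_zs v).2 ⟨hNP v hv, hv, h⟩)
  have hFvs : ∀ a ∈ acc, ∀ u ∈ I.F x a, some u ∈ vs := fun a ha u hu =>
    (hc.mem_vs u).2 (Or.inr (Or.inr ⟨a, harcs a ha u hu⟩))
  have hKB : ∀ v, some v ∈ vs → v ∉ farTerminals I.G I.T x := by
    intro v hv hvB
    rcases (hc.mem_vs v).1 hv with rfl | h | ⟨a, h⟩
    · exact (mem_farTerminals.1 hvB).2.1 rfl
    · exact ((hacc v).1 h).2 (Or.inl hvB)
    · have h₀ := hc.arcs_sub a v h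
      exact ((hacc a).1 h₀.1).2 (Or.inr ⟨v, hvB, (mem_F.1 h₀.2).1⟩)
  have hbadK : ∀ v, some v ∈ vs → (∀ b ∈ farTerminals I.G I.T x, ¬ I.G.Adj v b) →
      v ∈ acc ∨ v = x := by
    intro v hv hun
    rcases hcl v hv with h | ⟨h | ⟨b, hb, hvb⟩, -⟩
    · exact h
    · exact absurd h (hKB v hv)
    · exact absurd hvb (hun b hb)
  refine Or.inl ⟨H, {z | z ∈ zs}, ⟨vs, es', zs, ⟨hc.vs_nodup, fun v => Iff.rfl⟩,
    ⟨hes_nodup, hedge⟩, ⟨hc.zs_nodup, fun z => Iff.rfl⟩, ?_⟩, ?_, ?_⟩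
  · simp [kernelWords, List.map_eq_flatMap]
  · refine isKernel_of_closed (K := {v | some v ∈ vs}) hB ?_ (fun v => Iff.rfl) hc.none_mem
      ((hc.mem_vs x).2 (Or.inl rfl)) ?_ ?_ hNx ?_ ?_ ?_ ?_
    · intro z
      change z ∈ zs ↔ _
      rw [hc.mem_zs]
      constructor
      · rintro ⟨h₁, h₂, h₃⟩
        refine ⟨h₂, ?_⟩
        have hbad : I.Bad x z := by
          by_contra h; exact h₃ ((hacc z).2 ⟨h₁, h⟩)
        rcases hbad with h | h
        · exact absurd h₂ (mem_farTerminals.1 h).2.2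
        · exact h
      · rintro ⟨h₁, h₂⟩
        exact ⟨hNP z h₁, h₁, fun h => ((hacc z).1 h).2 (Or.inr h₂)⟩
    · rw [Set.disjoint_left]
      intro v hv hvz
      obtain ⟨-, h₁, h₂⟩ := (hc.mem_zs v).1 hvz
      rcases hcl v hv with (h | rfl) | h
      · exact h₂ h
      · exact I.G.irrefl h₁
      · exact h.2.1 h₁
    · exact Set.disjoint_left.2 hKB
    · intro v hv hun u hvu
      by_cases hxu : I.G.Adj x u
      · exact hNx u hxu
      rcases hbadK v hv hun with h | rfl
      · by_cases hux : u = x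
        · exact Or.inl ((hc.mem_vs u).2 (Or.inl hux))
        · exact Or.inl (hFvs v h u (mem_F.2 ⟨hvu, hux, hxu⟩))
      · exact absurd hvu hxu
    · intro u v huv
      rcases (hHss u v).1 huv with ⟨a, ha, hxa, h⟩ | ⟨a, w, haw, h⟩
      · simp only [Sym2.eq_iff, Option.some.injEq] at h
        rcases h with ⟨rfl, rfl⟩ | ⟨rfl, rfl⟩
        exacts [hxa, hxa.symm]
      · have h₁ := (mem_F.1 (hc.arcs_sub a w haw).2).1
        simp only [Sym2.eq_iff, Option.some.injEq] at h
        rcases h with ⟨rfl, rfl⟩ | ⟨rfl, rfl⟩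
        exacts [h₁, h₁.symm]
    · intro u hu v hv huv hun hne
      rw [hHss]
      have hxadj : ∀ w, some w ∈ vs → I.G.Adj x w → w ∈ acc := by
        intro w hw hxw
        rcases hcl w hw with (h | rfl) | h
        · exact h
        · exact absurd hxw (I.G.irrefl)
        · exact absurd hxw h.2.1
      rcases hbadK u hu hun with h | rfl
      · by_cases hvx : v = x
        · subst hvx
          exact Or.inl ⟨u, h, huv.symm, Sym2.eq_swap⟩
        · by_cases hxv : I.G.Adj x v
          -- An edge between N(x) and its outside is recorded from the end in N(x) only, because
          -- F(x,u) leaves out the neighbours of `x`.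
          · have hxu : ¬ I.G.Adj x u := fun h' => hne ⟨h', hxv⟩
            have hv' := hxadj v hv hxv
            refine Or.inr ⟨v, u, harcs v hv' u (mem_F.2 ⟨huv.symm, ?_, hxu⟩), Sym2.eq_swap⟩
            exact hc.acc_ne u (hc.acc_sub u h)
          · exact Or.inr ⟨u, v, harcs u h v (mem_F.2 ⟨huv, hvx, hxv⟩), rfl⟩
      · exact Or.inl ⟨v, hxadj v hv huv, huv, rfl⟩
    · intro u
      change s(some u, none) ∈ _ ↔ _
      rw [hmem_es, hc.mem_es]
      constructor
      · rintro ((⟨a, -, -, h⟩ | ⟨a, w, -, h⟩) | ⟨v, hv, hvx, hva, h⟩)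
        · simp at h
        · simp at h
        · obtain rfl : u = v := by simpa [Sym2.eq_iff] using h
          refine ⟨hv, ?_⟩
          rcases hcl u hv with h' | ⟨h' | h', -⟩
          · tauto
          · exact absurd h' (hKB u hv)
          · exact h'
      · rintro ⟨hu, b, hb, hub⟩
        refine Or.inr ⟨u, hu, ?_, fun h => ((hacc u).1 h).2 (Or.inr ⟨b, hb, hub⟩), rfl⟩
        rintro rfl
        exact hxbad (Or.inr ⟨b, hb, hub⟩)
  -- The traversal only guarantees 400ℓh²; on the event `Good` the bound improves to 40ℓh, saving a
  -- factor h in the size of the kernel.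
  · have hM : ∀ a ∈ acc, (I.F x a).card ≤ 40 * I.ℓ * I.h := by
      intro a ha
      by_contra! h
      exact ((hacc a).1 ha).2 (hG.bad h.le)
    have h₁ := hc.length_es_le hM
    have h₂ := hc.length_vs_le hM
    have h₃ : acc.length ≤ 18 * I.k := by
      refine le_trans ?_ hP
      exact List.Subperm.length_le (hc.acc_nodup.subperm fun v hv => hc.acc_sub v hv)
    have hcard : H.edgeSet.ncard = es'.length := by
      rw [← List.length_map (fun e : Option (Fin I.n) × Option (Fin I.n) => s(e.1, e.2)),
        ← List.toFinset_card_of_nodup hes_nodup, ← Set.ncard_coe_finset]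
      congr 1
      ext e
      rw [Finset.mem_coe, List.mem_toFinset, hedge]
    -- Edges of the kernel and edges to the sink each number at most 18k(40ℓh + 1), and 2 · 18 · 41
    -- = 1476. With h ≤ 2.5 ln n this gives the 3690 below.
    have h₄ : es'.length ≤ 1476 * (I.k * I.ℓ * I.h) := by
      have h₅ := Nat.mul_le_mul_right (40 * I.ℓ * I.h + 1) h₃
      have h₆ : 1 ≤ I.ℓ * I.h := Nat.mul_pos I.hℓ I.one_le_h
      have h₇ := Nat.mul_le_mul_left I.k h₆
      have h₈ : es'.length ≤ 2 * (18 * I.k * (40 * I.ℓ * I.h + 1)) := by omega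
      nlinarith
    have h₅ : (es'.length : ℝ) ≤ 1476 * (I.k * I.ℓ * I.h) := by exact_mod_cast h₄
    have h₆ := I.h_le_log
    have h₇ := I.one_le_log
    rw [hcard]
    calc (es'.length : ℝ) ≤ 1476 * (I.k * I.ℓ * I.h) := h₅
      _ ≤ 1476 * (I.k * I.ℓ * (2.5 * Real.log I.n)) := by gcongr; linarith
      _ = 3690 * (I.k * I.ℓ * Real.log I.n) := by ring
      _ ≤ C * (I.k * I.ℓ * Real.log I.n) := by
        gcongr
        linarith

end Inst
end VertexConn

namespace WordRam

infixr:30 ";;" => Prog.seq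

end WordRam

namespace VertexConn

open WordRam

/-! ### The program

Variables `0, …, 3` and arrays `0, …, 3` hold the input. Variables `4, …, 12` hold constants
computed from it: the base `B` of the pairing `a B + b`, the number `2 ^ h` of leaves of a trie, its
depth `h`, the bound on the length of a traversal, the number of low-degree neighbours to be used,
half of that number, `|T|`, `k + 2 ℓ` and `8 k`. Array `4` holds the tries. -/

namespace Alg

/-- The pairing of the values of two expressions. -/
abbrev pr (e₁ e₂ : Expr) : Expr := .bin .add (.bin .mul e₁ (.var 4)) e₂

/-- The degree of the vertex in variable `x`. -/
abbrev degE (x : ℕ) : Expr := .bin .sub (.get 0 (.bin .add (.var x) (.lit 1))) (.get 0 (.var x))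

/-- The neighbour of the vertex in variable `x` at the position in variable `r`. -/
abbrev nbrE (x r : ℕ) : Expr := .get 1 (.bin .add (.get 0 (.var x)) (.var r))

/-- The name of a node in the trie of the vertex in variable `x`. -/
abbrev idE (x : ℕ) (e : Expr) : Expr := .get 4 (pr (.var x) e)

/-- Whether the vertices in the variables `x` and `w` are adjacent. -/
abbrev adjE (x w : ℕ) : Expr := idE x (.bin .add (.var 5) (.var w))

/-- One step of the traversal of the nodes at which the tries of the vertices in the variables `31`
and `22` differ. The queue is array `10`, with head in variable `32` and tail in variable `33`;
array `11`, of length in variable `36`, lists the differences found, and variable `35` is set when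
one of them belongs to `T`. -/
def walkStep : Prog :=
  .ite (.bin .lt (.var 32) (.var 33))
    (.set 34 (.get 10 (.var 32)) ;;
      .ite (.bin .eq (idE 31 (.var 34)) (idE 22 (.var 34))) .skip
        (.ite (.bin .lt (.var 34) (.var 5))
          (.put 10 (.var 33) (.bin .add (.var 34) (.var 34)) ;;
            .put 10 (.bin .add (.var 33) (.lit 1))
              (.bin .add (.bin .add (.var 34) (.var 34)) (.lit 1)) ;;
            .set 33 (.bin .add (.var 33) (.lit 2)))
          (.set 42 (.bin .sub (.var 34) (.var 5)) ;;
            .ite (.bin .add (idE 22 (.var 34)) (.bin .eq (.var 42) (.var 22))) .skip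
              (.put 11 (.var 36) (.var 42) ;;
                .set 36 (.bin .add (.var 36) (.lit 1)) ;;
                .ite (.get 2 (.var 42)) (.set 35 (.lit 1)) .skip))))
    .skip

/-- List the neighbours of the vertex in variable `31` outside of the closed neighbourhood of the
vertex in variable `22`, and decide whether it is close to the terminals. -/
def walk : Prog :=
  .put 10 (.lit 0) (.lit 1) ;;
  .set 33 (.lit 1) ;;
  .set 36 (.lit 0) ;;
  .set 35 (.bin .lt (adjE 22 31) (.get 2 (.var 31))) ;;
  forVar 32 7 walkStep ;;
  .ite (.bin .lt (.var 7) (.var 33)) (.set 35 (.lit 1)) .skip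

end Alg

namespace Inst

variable {I : Inst}

variable (I) in
/-- The number of machine words. -/
abbrev W : ℕ := numWords 9 I.n

variable (I) in
/-- The base of the pairing. -/
def B : ℕ := I.n * I.n * I.n * I.n

variable (I) in
/-- The pairing of two words. -/
def pair (a b : ℕ) : ℕ := a * I.B + b

variable (I) in
/-- The bound on the number of steps of a traversal. -/
def NC : ℕ := 400 * I.ℓ * I.h * I.h

variable (I) in
/-- The position at which the adjacency list of the vertex `i` starts. -/
def off (i : ℕ) : ℕ := (((List.finRange I.n).take i).map fun v => (I.A v).length).sum

/-- Why words have nine times the bit length of n: a pair of numbers below B = n⁴ needs n⁸ values,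
and the ninth factor n ≥ 400 absorbs the constants. -/
lemma B_sq_le : 400 * (I.B * I.B) ≤ I.W := by
  have h₁ : I.W = (2 ^ I.h) ^ 9 := by
    rw [W, numWords, ← pow_mul, mul_comm]; rfl
  have h₂ : I.n ^ 9 ≤ I.W := h₁ ▸ Nat.pow_le_pow_left I.n_lt_two_pow.le 9
  have h₃ : I.B * I.B = I.n ^ 8 := by unfold B; ring
  rw [h₃]
  refine le_trans ?_ h₂
  rw [pow_succ' I.n 8]
  exact Nat.mul_le_mul_right _ I.hn

lemma B_ge : 400 * (I.n * I.n * I.n) ≤ I.B := by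
  unfold B
  rw [mul_comm]
  exact Nat.mul_le_mul_left _ I.hn

lemma n_cube_ge : 400 * (I.n * I.n) ≤ I.n * I.n * I.n := by
  rw [mul_comm]; exact Nat.mul_le_mul_left _ I.hn

lemma n_sq_ge : 400 * I.n ≤ I.n * I.n := Nat.mul_le_mul_right _ I.hn

lemma B_pos : 0 < I.B := by
  have := I.B_ge; have := I.n_cube_ge; have := I.n_sq_ge; have := I.hn; omega

lemma two_B_le : 400 * I.B ≤ I.W := by
  have h₁ := I.B_sq_le
  have h₂ : I.B ≤ I.B * I.B := Nat.le_mul_of_pos_left _ I.B_pos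
  omega

lemma h_le_n : I.h ≤ I.n := Nat.size_le.2 Nat.lt_two_pow_self

lemma NC_le : I.NC ≤ I.n * I.n * I.n := by
  have h₁ : 400 * I.ℓ ≤ I.n := I.hk.trans I.hkn.le
  exact Nat.mul_le_mul (Nat.mul_le_mul h₁ I.h_le_n) I.h_le_n

lemma ℓh_le : 400 * I.ℓ * I.h ≤ I.n * I.n :=
  Nat.mul_le_mul (I.hk.trans I.hkn.le) I.h_le_n

lemma pair_lt {a b : ℕ} (ha : a < I.B) (hb : b < I.B) : I.pair a b < I.W := by
  have h₁ := I.B_sq_le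
  have h₂ : (a + 1) * I.B ≤ I.B * I.B := Nat.mul_le_mul_right _ ha
  unfold pair
  rw [add_mul, one_mul] at h₂
  omega

lemma pair_inj {a b a' b' : ℕ} (hb : b < I.B) (hb' : b' < I.B) (h : I.pair a b = I.pair a' b') :
    a = a' ∧ b = b' := by
  unfold pair at h
  have h₁ : (a * I.B + b) / I.B = a := by
    rw [mul_comm, Nat.mul_add_div I.B_pos, Nat.div_eq_of_lt hb, add_zero]
  have h₂ : (a' * I.B + b') / I.B = a' := by
    rw [mul_comm, Nat.mul_add_div I.B_pos, Nat.div_eq_of_lt hb', add_zero]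
  have h₃ : a = a' := by rw [← h₁, ← h₂, h]
  subst h₃
  exact ⟨rfl, by omega⟩

lemma fin_lt_B (v : Fin I.n) : (v : ℕ) < I.B := by
  have := I.B_ge; have := I.n_cube_ge; have := I.n_sq_ge; have := v.2; omega

lemma node_lt_B {c : ℕ} (hc : c < 2 * 2 ^ I.h) : c < I.B := by
  have := I.B_ge; have := I.n_cube_ge; have := I.n_sq_ge; have := I.two_pow_le; omega

lemma off_succ (v : Fin I.n) : I.off (v + 1) = I.off v + (I.A v).length := by
  unfold off
  rw [List.take_add_one, List.map_append, List.sum_append]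
  congr 1
  rw [List.getElem?_eq_getElem (by simp)]
  simp

lemma length_A_le (v : Fin I.n) : (I.A v).length ≤ I.n := by
  rw [← card_N]; exact (Finset.card_le_univ _).trans_eq (Fintype.card_fin _)

lemma off_le (i : ℕ) : I.off i ≤ I.n * I.n := by
  unfold off
  refine (List.sum_le_card_nsmul _ I.n ?_).trans ?_
  · intro a ha
    obtain ⟨v, -, rfl⟩ := List.mem_map.1 ha
    exact I.length_A_le v
  · rw [smul_eq_mul, List.length_map]
    exact Nat.mul_le_mul_right _ (by simp)

variable (I) in
/-- The state holds the input. -/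
structure Base (s : State) : Prop where
  v0 : s.var 0 = I.n
  v1 : s.var 1 = I.k
  v2 : s.var 2 = I.ℓ
  v3 : s.var 3 = I.X.length
  off : ∀ i, i ≤ I.n → s.arr 0 i = I.off i
  adj : ∀ v r (h : r < (I.A v).length), s.arr 1 (I.off v + r) = (I.A v)[r]
  ter : ∀ v : Fin I.n, s.arr 2 v = open Classical in if v ∈ I.T then 1 else 0
  xs : ∀ i (h : i < I.X.length), s.arr 3 i = I.X[i]

variable (I) in
/-- The state holds the input, the constants and the tries. -/
structure Env (s : State) : Prop extends Base I s where
  v4 : s.var 4 = I.B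
  v5 : s.var 5 = 2 ^ I.h
  v7 : s.var 7 = I.NC
  v8 : s.var 8 = 84 * I.ℓ * I.h
  v9 : s.var 9 = 42 * I.ℓ * I.h
  v10 : s.var 10 = open Classical in (List.finRange I.n).countP fun v => decide (v ∈ I.T)
  v11 : s.var 11 = I.k + 2 * I.ℓ
  v12 : s.var 12 = 8 * I.k
  trie : I.TrieOk fun v c => s.arr 4 (I.pair v c)

lemma Base.congr {s s' : State} (h : I.Base s) (hv : ∀ x < 4, s'.var x = s.var x)
    (ha : ∀ a < 4, s'.arr a = s.arr a) : I.Base s' := by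
  constructor
  · rw [hv 0 (by omega), h.v0]
  · rw [hv 1 (by omega), h.v1]
  · rw [hv 2 (by omega), h.v2]
  · rw [hv 3 (by omega), h.v3]
  · rw [ha 0 (by omega)]; exact h.off
  · rw [ha 1 (by omega)]; exact h.adj
  · rw [ha 2 (by omega)]; exact h.ter
  · rw [ha 3 (by omega)]; exact h.xs

lemma Env.congr {s s' : State} (h : I.Env s) (hv : ∀ x < 13, s'.var x = s.var x)
    (ha : ∀ a < 5, s'.arr a = s.arr a) : I.Env s' := by
  refine ⟨h.toBase.congr (fun x hx => hv x (by omega)) (fun a h => ha a (by omega)),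
    ?_, ?_, ?_, ?_, ?_, ?_, ?_, ?_, ?_⟩
  · rw [hv 4 (by omega), h.v4]
  · rw [hv 5 (by omega), h.v5]
  · rw [hv 7 (by omega), h.v7]
  · rw [hv 8 (by omega), h.v8]
  · rw [hv 9 (by omega), h.v9]
  · rw [hv 10 (by omega), h.v10]
  · rw [hv 11 (by omega), h.v11]
  · rw [hv 12 (by omega), h.v12]
  · rw [ha 4 (by omega)]; exact h.trie

lemma Env.setv {s : State} (h : I.Env s) {x a : ℕ} (hx : 13 ≤ x) : I.Env (s.setv x a) :=
  h.congr (fun y hy => by rw [State.setv_var, if_neg (by omega)]) fun _ _ => rfl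

lemma Env.seta {s : State} (h : I.Env s) {x a b : ℕ} (hx : 5 ≤ x) : I.Env (s.seta x a b) :=
  h.congr (fun _ _ => rfl) fun y hy => by rw [State.seta_arr, if_neg (by omega)]

lemma Env.same {s s' : State} {vs as : List ℕ} {o : Bool} (h : I.Env s) (hs : Same vs as o s s')
    (hv : ∀ x ∈ vs, 13 ≤ x) (ha : ∀ a ∈ as, 5 ≤ a) : I.Env s' :=
  h.congr (fun x hx => hs.var x fun h' => by have := hv x h'; omega)
    fun a h => hs.arr a fun h' => by have := ha a h'; omega

section Eval

variable {s : State}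

lemma one_lt_W : 1 < I.W := by
  have := I.two_B_le; have := I.B_pos; omega

lemma eval_pr {e₁ e₂ : Expr} {a b : ℕ} (h4 : s.var 4 = I.B) (h₁ : e₁.eval I.W s = a)
    (h₂ : e₂.eval I.W s = b) (ha : a < I.B) (hb : b < I.B) :
    (Alg.pr e₁ e₂).eval I.W s = I.pair a b := by
  have h := I.pair_lt ha hb
  have h' : a * I.B + b = I.pair a b := rfl
  exact eval_add (eval_mul h₁ (eval_var h4) (by omega)) h₂ h

lemma Base.eval_deg (h : I.Base s) {x : ℕ} {v : Fin I.n} (hx : s.var x = v) :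
    (Alg.degE x).eval I.W s = (I.A v).length := by
  have h₁ := I.two_B_le
  have h₂ := I.fin_lt_B v
  have h₃ := I.off_le (v + 1)
  have h₄ := I.n_cube_ge
  have h₅ := I.B_ge
  have h₆ := I.one_lt_W
  rw [Alg.degE, eval_sub (eval_get (eval_add (eval_var hx) (eval_lit h₆) (by omega))
    (h.off _ v.2)) (eval_get (eval_var hx) (h.off _ v.2.le)) (by omega), off_succ]
  omega

lemma Base.eval_nbr (h : I.Base s) {x r j : ℕ} {v : Fin I.n} (hx : s.var x = v)
    (hr : s.var r = j) (hj : j < (I.A v).length) :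
    (Alg.nbrE x r).eval I.W s = (I.A v)[j] := by
  have h₁ := I.two_B_le
  have h₃ := I.off_le (v + 1)
  have h₄ := I.n_cube_ge
  have h₅ := I.B_ge
  rw [off_succ] at h₃
  exact eval_get (eval_add (eval_get (eval_var hx) (h.off _ v.2.le)) (eval_var hr) (by omega))
    (h.adj v j hj)

lemma eval_id (h4 : s.var 4 = I.B) {x : ℕ} {v : Fin I.n} {e : Expr} {c : ℕ} (hx : s.var x = v)
    (he : e.eval I.W s = c) (hc : c < 2 * 2 ^ I.h) :
    (Alg.idE x e).eval I.W s = s.arr 4 (I.pair v c) :=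
  eval_get (eval_pr h4 (eval_var hx) he (I.fin_lt_B v) (I.node_lt_B hc)) rfl

lemma eval_leaf (h5 : s.var 5 = 2 ^ I.h) {w : ℕ} {u : Fin I.n} (hw : s.var w = u) :
    (Expr.bin .add (.var 5) (.var w)).eval I.W s = 2 ^ I.h + u := by
  have h₁ := I.two_B_le
  have h₂ := I.n_lt_two_pow
  have h₃ : 2 ^ I.h + (u : ℕ) < I.B := I.node_lt_B (by omega)
  exact eval_add (eval_var h5) (eval_var hw) (by omega)

lemma Env.eval_adj (h : I.Env s) {x w : ℕ} {v u : Fin I.n} (hx : s.var x = v)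
    (hw : s.var w = u) :
    (Alg.adjE x w).eval I.W s = open Classical in if I.G.Adj v u then 1 else 0 := by
  have h₂ := I.n_lt_two_pow
  rw [eval_id h.v4 hx (eval_leaf h.v5 hw) (by omega)]
  exact h.trie.leaf_fin v u

lemma Base.eval_ter (h : I.Base s) {x : ℕ} {v : Fin I.n} (hx : s.var x = v) :
    (Expr.get 2 (.var x)).eval I.W s = open Classical in if v ∈ I.T then 1 else 0 :=
  eval_get (eval_var hx) (h.ter v)

end Eval

end Inst

end VertexConn

/-! ### Correctness of the traversal -/

namespace VertexConn

open WordRam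

lemma of_ite_ne_zero {p : Prop} [Decidable p] (h : (if p then 1 else 0 : ℕ) ≠ 0) : p := by
  by_contra hp; simp [hp] at h

lemma not_of_ite_eq_zero {p : Prop} [Decidable p] (h : (if p then 1 else 0 : ℕ) = 0) : ¬ p := by
  intro hp; simp [hp] at h

namespace Inst

variable {I : Inst} {ω : ℕ → Fin I.W}

/-- The words that name the vertices of a list. -/
abbrev codes (l : List (Fin I.n)) : List ℕ := l.map Fin.val

/-- The invariant of the traversal. -/
structure WalkInv (I : Inst) (f : ℕ → ℕ → ℕ) (x v : Fin I.n) (j : ℕ) (s : State)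
    (p r : List ℕ) (dl : List (Fin I.n)) : Prop where
  walk : Walk I f x v p r dl
  head : p.length = j ∨ r = [] ∧ p.length ≤ j
  queue : Holds (s.arr 10) (p ++ r)
  tail : s.var 33 = (p ++ r).length
  tail_le : (p ++ r).length ≤ 1 + 2 * j
  dl_le : dl.length ≤ j
  v36 : s.var 36 = dl.length
  list : Holds (s.arr 11) (codes dl)
  v35 : s.var 35 = open Classical in
    if v ∈ farTerminals I.G I.T x ∨ ∃ u ∈ dl, u ∈ I.T then 1 else 0

lemma wp_walkStep {f : ℕ → ℕ → ℕ} {x v : Fin I.n} {j : ℕ} {s : State} {p r : List ℕ}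
    {dl : List (Fin I.n)} (hI : WalkInv I f x v j s p r dl) (hE : I.Env s)
    (hf : f = fun v c => s.arr 4 (I.pair v c)) (hj : j < I.NC)
    (h31 : s.var 31 = v) (h22 : s.var 22 = x) (h32 : s.var 32 = j) :
    wp ω Alg.walkStep s fun s' t => t ≤ 70 ∧
      ∃ p r dl, WalkInv I f x v (j + 1) (s'.setv 32 (j + 1)) p r dl := by
  classical
  have hW := I.one_lt_W
  have hB := I.two_B_le
  have hB' := I.B_ge
  have hNC := I.NC_le
  have hn3 := I.n_cube_ge
  have hn2 := I.n_sq_ge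
  have hn := I.hn
  have hfT : TrieOk I f := hf ▸ hE.trie
  refine wp_ite (eval_lt (eval_var h32) (eval_var hI.tail) hW) (fun hlt => ?_) (fun hge => ?_)
  · have hlt' : j < (p ++ r).length := of_ite_ne_zero hlt
    obtain ⟨hpj, a, r', rfl⟩ : p.length = j ∧ ∃ a r', r = a :: r' := by
      rcases hI.head with h | ⟨rfl, h⟩
      · rcases r with _ | ⟨a, r'⟩
        · simp at hlt'; omega
        · exact ⟨h, a, r', rfl⟩
      · simp at hlt'; omega
    have hw := hI.walk
    have hget : s.arr 10 j = a := hI.queue.get (by simp [← hpj])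
    have har := hw.range a (by simp)
    have haB := I.node_lt_B har.2
    refine wp_seq (wp_set (eval_get (eval_var h32) hget) ?_)
    have hE₁ : I.Env (s.setv 34 a) := hE.setv (by omega)
    have i₁ : (Alg.idE 31 (.var 34)).eval I.W (s.setv 34 a) = f v a := by
      rw [eval_id hE₁.v4 (v := v) (c := a) (by simp [h31]) (by simp [Expr.eval]) har.2, hf]; rfl
    have i₂ : (Alg.idE 22 (.var 34)).eval I.W (s.setv 34 a) = f x a := by
      rw [eval_id hE₁.v4 (v := x) (c := a) (by simp [h22]) (by simp [Expr.eval]) har.2, hf]; rfl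
    refine wp_ite (eval_eq i₁ i₂ hW) (fun heq => ?_) (fun hne => ?_)
    · have heq' : f v a = f x a := of_ite_ne_zero heq
      refine wp_skip ⟨by simp only [Expr.cost]; omega, p ++ [a], r', dl, ?_⟩
      have e : p ++ [a] ++ r' = p ++ a :: r' := by simp
      exact ⟨hw.skip hfT heq', Or.inl (by simp [hpj]), e ▸ hI.queue, by simpa [e] using hI.tail,
        by have := hI.tail_le; rw [e]; omega, by have := hI.dl_le; omega, by simpa using hI.v36,
        hI.list, by simpa using hI.v35⟩
    · have hne' : f v a ≠ f x a := not_of_ite_eq_zero hne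
      refine wp_ite (eval_lt (a := a) (b := 2 ^ I.h) (eval_var (by simp))
        (eval_var (by simp [hE.v5])) hW) (fun hlt => ?_) (fun hge => ?_)
      · have haS : a < 2 ^ I.h := of_ite_ne_zero hlt
        have htl := hI.tail_le
        refine wp_seq (wp_put (j := (p ++ a :: r').length) (c := a + a)
          (eval_var (by simpa using hI.tail))
          (eval_add (eval_var (by simp)) (eval_var (by simp)) (by omega)) ?_)
        refine wp_seq (wp_put (j := (p ++ a :: r').length + 1) (c := a + a + 1)
          (eval_add (eval_var (by simpa using hI.tail)) (eval_lit hW) (by omega))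
          (eval_add (eval_add (eval_var (by simp)) (eval_var (by simp)) (by omega))
            (eval_lit hW) (by omega)) ?_)
        refine wp_set (a := (p ++ a :: r').length + 2)
          (eval_add (eval_var (by simpa using hI.tail)) (eval_lit (by omega)) (by omega)) ?_
        refine ⟨by simp only [Expr.cost]; omega, p ++ [a], r' ++ [2 * a, 2 * a + 1], dl, ?_⟩
        have e : p ++ [a] ++ (r' ++ [2 * a, 2 * a + 1])
            = (p ++ a :: r') ++ [a + a] ++ [a + a + 1] := by simp; omega
        refine ⟨hw.push hne' haS, Or.inl (by simp [hpj]), ?_, ?_, ?_,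
          by have := hI.dl_le; omega, by simpa using hI.v36, by simpa using hI.list,
          by simpa using hI.v35⟩
        · rw [e]
          simp only [State.setv_arr, State.seta_arr, if_true]
          exact (hI.queue.append rfl _).append (by simp; omega) _
        · rw [e]; simp; omega
        · rw [e]; simp at htl ⊢; omega
      · have haS : 2 ^ I.h ≤ a := not_lt.1 (not_of_ite_eq_zero hge)
        refine wp_seq (wp_set (a := a - 2 ^ I.h) (eval_sub (eval_var (by simp))
          (eval_var (by simp [hE.v5])) (by omega)) ?_)
        -- Only leaves of actual vertices can differ, since both tries hold 0 at the others.
        obtain ⟨u, hu⟩ : ∃ u : Fin I.n, 2 ^ I.h + (u : ℕ) = a := by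
          have h₁ := hfT.leaf v (a - 2 ^ I.h) (by omega)
          have h₂ := hfT.leaf x (a - 2 ^ I.h) (by omega)
          rw [show 2 ^ I.h + (a - 2 ^ I.h) = a by omega] at h₁ h₂
          by_cases hun : a - 2 ^ I.h < I.n
          · exact ⟨⟨_, hun⟩, by simp; omega⟩
          · simp [hun] at h₁ h₂; omega
        have hu' : a - 2 ^ I.h = u := by omega
        rw [hu']
        set s₂ := (s.setv 34 a).setv 42 u with hs₂
        have hE₂ : I.Env s₂ := hE₁.setv (by omega)
        have l₁ := hfT.leaf_fin v u
        have l₂ := hfT.leaf_fin x u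
        rw [hu] at l₁ l₂
        have i₃ : (Alg.idE 22 (.var 34)).eval I.W s₂ = f x a := by
          rw [eval_id hE₂.v4 (v := x) (c := a) (by simp [hs₂, h22]) (by simp [hs₂, Expr.eval])
            har.2, hf]; rfl
        have hle : f x a ≤ 1 := by rw [l₂]; split_ifs <;> simp
        -- The sum is nonzero exactly if `u` lies in N[x]. Otherwise the leaf is 0 for `x`, so it is
        -- 1 for `v`, and `u` is a new element of F(x,v).
        refine wp_ite (eval_add i₃ (eval_eq (a := (u : ℕ)) (b := x) (eval_var (by simp [hs₂]))
          (eval_var (by simp [hs₂, h22])) hW) (by split_ifs <;> omega))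
          (fun hskip => ?_) (fun hnew => ?_)
        · have hnF : u ∉ I.F x v := by
            rw [mem_F]; rintro ⟨-, h₂, h₃⟩
            rw [l₂, if_neg h₃, if_neg (fun h => h₂ (Fin.ext h))] at hskip
            exact hskip rfl
          refine wp_skip ⟨by simp only [Expr.cost]; omega, p ++ [a], r', dl, ?_⟩
          have e : p ++ [a] ++ r' = p ++ a :: r' := by simp
          refine ⟨hw.visit_leaf haS hw.nodup fun w => ?_, Or.inl (by simp [hpj]), e ▸ hI.queue,
            by simpa [e, hs₂] using hI.tail,
            by have := hI.tail_le; rw [e]; omega, by have := hI.dl_le; omega,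
            by simpa [hs₂] using hI.v36,
            hI.list, by simpa [hs₂] using hI.v35⟩
          refine ⟨Or.inl, Or.rec id fun h => ?_⟩
          exact absurd ((Fin.ext (by omega) : w = u) ▸ h.2) hnF
        · have hux : u ≠ x := by rintro rfl; simp at hnew
          have hxu : ¬ I.G.Adj x u := by
            intro h; rw [l₂, if_pos h] at hnew; omega
          have hvu : I.G.Adj v u := by
            by_contra h
            rw [l₁, l₂, if_neg h, if_neg hxu] at hne'; exact hne' rfl
          have hF : u ∈ I.F x v := mem_F.2 ⟨hvu, hux, hxu⟩
          have hdl := hI.dl_le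
          refine wp_seq (wp_put (j := dl.length) (c := u)
            (eval_var (by simpa [hs₂] using hI.v36)) (eval_var (by simp [hs₂])) ?_)
          refine wp_seq (wp_set (a := dl.length + 1)
            (eval_add (eval_var (by simpa [hs₂] using hI.v36)) (eval_lit hW) (by omega)) ?_)
          set s₃ := (s₂.seta 11 dl.length u).setv 36 (dl.length + 1) with hs₃
          have hE₃ : I.Env s₃ := (hE₂.seta (by omega)).setv (by omega)
          have e : p ++ [a] ++ r' = p ++ a :: r' := by simp
          have hnd : (dl ++ [u]).Nodup := by
            rw [List.nodup_append]
            refine ⟨hw.nodup, by simp, ?_⟩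
            rintro c hc b hb rfl
            rw [List.mem_singleton.1 hb] at hc
            exact hw.notMem_dl hu hc
          have hwalk : Walk I f x v (p ++ [a]) r' (dl ++ [u]) := by
            refine hw.visit_leaf haS hnd fun w => ?_
            rw [List.mem_append, List.mem_singleton]
            refine or_congr_right ⟨?_, fun h => Fin.ext (by omega)⟩
            rintro rfl
            exact ⟨hu, hF⟩
          have hlist : Holds (s₃.arr 11) (codes (dl ++ [u])) := by
            rw [codes, List.map_append]
            have := hI.list.append (j := dl.length) (by simp) (u : ℕ)
            simpa [hs₃, hs₂] using this
          have hcond : ∀ (b : ℕ), (b = if v ∈ farTerminals I.G I.T x ∨ ∃ w ∈ dl ++ [u], w ∈ I.T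
              then 1 else 0) → ∀ s₄ : State, s₄.arr = s₃.arr → s₄.var 33 = s₃.var 33 →
                s₄.var 36 = s₃.var 36 → s₄.var 35 = b →
              ∃ p r dl, WalkInv I f x v (j + 1) (s₄.setv 32 (j + 1)) p r dl := by
            intro b hb s₄ h₁ h₂ h₃ h₄
            refine ⟨p ++ [a], r', dl ++ [u], hwalk, Or.inl (by simp [hpj]), ?_, ?_, ?_, ?_, ?_,
              ?_, ?_⟩
            · rw [e, State.setv_arr, h₁]; simpa [hs₃, hs₂] using hI.queue
            · rw [e]; simp [h₂, hs₃, hs₂, hI.tail]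
            · have := hI.tail_le; rw [e]; omega
            · simp; omega
            · simp [h₃, hs₃]
            · rw [State.setv_arr, h₁]; exact hlist
            · simp [h₄, hb]
          refine wp_ite (hE₃.eval_ter (v := u) (by simp [hs₃, hs₂])) (fun hT => ?_) (fun hT => ?_)
          · have hT' : u ∈ I.T := of_ite_ne_zero hT
            refine wp_set (a := 1) (eval_lit hW) ⟨by simp only [Expr.cost]; omega,
              hcond 1 ?_ _ rfl (by simp) (by simp) (by simp)⟩
            rw [if_pos (Or.inr ⟨u, by simp, hT'⟩)]
          · have hT' : u ∉ I.T := not_of_ite_eq_zero hT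
            refine wp_skip ⟨by simp only [Expr.cost]; omega, hcond _ ?_ _ rfl rfl rfl rfl⟩
            have : s₃.var 35 = s.var 35 := by simp [hs₃, hs₂]
            rw [this, hI.v35]
            congr 1
            simp [hT', or_and_right, exists_or]
  -- The loop always runs `NC` rounds; once the queue is exhausted the remaining rounds do nothing.
  · have hr : r = [] := by
      rcases hI.head with h | ⟨h, -⟩
      · by_contra h'
        have := List.length_pos_of_ne_nil h'
        exact not_of_ite_eq_zero hge (by simp; omega)
      · exact h
    refine wp_skip ⟨by simp only [Expr.cost]; omega, p, r, dl, hI.walk, Or.inr ⟨hr, ?_⟩, hI.queue,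
      by simpa using hI.tail, by have := hI.tail_le; omega, by have := hI.dl_le; omega,
      by simpa using hI.v36, hI.list, by simpa using hI.v35⟩
    rcases hI.head with h | ⟨-, h⟩ <;> omega

/-- The verdict is one-sided. Flag 0 certifies for every T that `v` is not bad and comes with the
full list of F(x,v). Flag 1 leaves open which alternative holds; only on the event `Good` do both
mean that `v` is bad. The time bound does not depend on T. -/
lemma wp_walk {x v : Fin I.n} {s : State} (hE : I.Env s) (h31 : s.var 31 = v) (h22 : s.var 22 = x)
    (hvx : v ≠ x) (hx : (I.N x).card ≤ I.k + 2 * I.ℓ) :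
    wp ω Alg.walk s fun s' t => t ≤ 80 * I.NC + 60 ∧
      ((s'.var 35 = 0 ∧ ¬ I.Bad x v ∧ ∃ dl : List (Fin I.n), dl.Nodup ∧
          (∀ u, u ∈ dl ↔ u ∈ I.F x v) ∧ dl.length ≤ I.NC ∧ s'.var 36 = dl.length ∧
          Holds (s'.arr 11) (codes dl)) ∨
        s'.var 35 = 1 ∧ (I.Bad x v ∨ 40 * I.ℓ * I.h ≤ (I.F x v).card)) := by
  classical
  have hW := I.one_lt_W
  have hB := I.two_B_le
  have hB' := I.B_ge
  have hNC := I.NC_le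
  have hn3 := I.n_cube_ge
  have hn2 := I.n_sq_ge
  have hn := I.hn
  set f : ℕ → ℕ → ℕ := fun v c => s.arr 4 (I.pair v c) with hf
  refine wp_seq (wp_put (eval_lit (by omega)) (eval_lit hW) ?_)
  refine wp_seq (wp_set (eval_lit hW) ?_)
  refine wp_seq (wp_set (eval_lit (by omega)) ?_)
  set s₁ := ((s.seta 10 0 1).setv 33 1).setv 36 0 with hs₁
  have hE₁ : I.Env s₁ := ((hE.seta (by omega)).setv (by omega)).setv (by omega)
  refine wp_seq (wp_set (a := if v ∈ farTerminals I.G I.T x then 1 else 0) ?_ ?_)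
  · rw [eval_lt (hE₁.eval_adj (v := x) (u := v) (by simp [hs₁, h22]) (by simp [hs₁, h31]))
      (hE₁.eval_ter (v := v) (by simp [hs₁, h31])) hW, mem_farTerminals]
    -- As `v ≠ x`, membership in T_x means that the adjacency bit is 0 and the bit of T is 1, that
    -- is, that the former is smaller.
    by_cases h₁ : I.G.Adj x v <;> by_cases h₂ : v ∈ I.T <;> simp [h₁, h₂, hvx]
  set s₂ := s₁.setv 35 (if v ∈ farTerminals I.G I.T x then 1 else 0) with hs₂
  have hE₂ : I.Env s₂ := hE₁.setv (by omega)
  refine wp_seq (wp_forVar (N := I.NC)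
    (fun j s' t => t ≤ 2 + 78 * j ∧ ∃ p r dl, WalkInv I f x v j s' p r dl)
    (by decide) (by decide) (by decide) hE₂.v7 (by omega) hW ?_ ?_ ?_)
  · refine ⟨le_rfl, [], [1], [], walk_init x v, by simp, ?_, by simp [hs₂, hs₁], by simp, by simp,
      by simp [hs₂, hs₁], Holds.nil _, by simp [hs₂]⟩
    have := (Holds.nil (s.arr 10)).append (j := 0) rfl 1
    simpa [hs₂, hs₁] using this
  · rintro j s' t hj h32 hs ⟨ht, p, r, dl, hI⟩
    have hE' : I.Env s' := hE₂.same hs (by decide) (by decide)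
    refine wp_mono (wp_walkStep hI hE' ?_ hj ?_ ?_ h32) ?_
    · rw [hf, hs.arr 4 (by decide)]; simp [hs₂, hs₁]
    · rw [hs.var 31 (by decide)]; simp [hs₂, hs₁, h31]
    · rw [hs.var 22 (by decide)]; simp [hs₂, hs₁, h22]
    · rintro s'' t' ⟨ht', h⟩ -
      exact ⟨by omega, h⟩
  · rintro s' t h32 hs ⟨ht, p, r, dl, hI⟩
    have hE' : I.Env s' := hE₂.same hs (by decide) (by decide)
    have hfT : TrieOk I f := hE.trie
    refine wp_ite (eval_lt (eval_var hE'.v7) (eval_var hI.tail) hW) (fun hlt => ?_) (fun hge => ?_)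
    · have hlt' : I.NC < (p ++ r).length := of_ite_ne_zero hlt
      refine wp_set (a := 1) (eval_lit hW) ⟨by simp only [Expr.cost]; omega, Or.inr ⟨by simp, ?_⟩⟩
      exact Or.inr (hI.walk.large hfT hx hlt')
    -- `NC` rounds suffice to visit a queue of at most `NC` entries, so the traversal is complete.
    · have hge' : (p ++ r).length ≤ I.NC := not_lt.1 (not_of_ite_eq_zero hge)
      have hr : r = [] := by
        rcases hI.head with h | ⟨h, -⟩
        · rw [List.length_append] at hge'
          exact List.eq_nil_of_length_eq_zero (by omega)
        · exact h
      subst hr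
      have hmem := hI.walk.mem_dl_of_done hfT
      have hbad : I.Bad x v ↔ (v ∈ farTerminals I.G I.T x ∨ ∃ u ∈ dl, u ∈ I.T) := by
        rw [bad_iff]; simp only [hmem]
      refine wp_skip ⟨by simp only [Expr.cost]; omega, ?_⟩
      have h35 := hI.v35
      by_cases hb : I.Bad x v
      · exact Or.inr ⟨by rw [h35, if_pos (hbad.1 hb)], Or.inl hb⟩
      · exact Or.inl ⟨by rw [h35, if_neg (fun h => hb (hbad.2 h))], hb, dl, hI.walk.nodup, hmem,
          hI.dl_le, hI.v36, hI.list⟩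

end Inst

end VertexConn

/-! ### The search for candidates -/

namespace VertexConn

open WordRam

namespace Alg

/-- Count the neighbour of the vertex in variable `24` at the position in variable `25`. Array `6`
holds the counts, and array `9`, of length in variable `29`, lists the vertices to be examined. -/
def candStep : Prog :=
  .set 26 (nbrE 24 25) ;;
  .ite (.bin .add (.bin .eq (.var 26) (.var 22)) (adjE 22 26)) .skip
    (.put 6 (pr (.var 21) (.var 26)) (.bin .add (.get 6 (pr (.var 21) (.var 26))) (.lit 1)) ;;
      .ite (.bin .eq (.get 6 (pr (.var 21) (.var 26))) (.var 9))
        (.put 9 (.var 29) (.var 26) ;; .set 29 (.bin .add (.var 29) (.lit 1))) .skip)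

/-- Treat the neighbour of the vertex in variable `22` at the position in variable `23`. -/
def gatherStep : Prog :=
  .set 24 (nbrE 22 23) ;;
  .put 9 (.var 29) (.var 24) ;;
  .set 29 (.bin .add (.var 29) (.lit 1)) ;;
  .set 28 (.bin .add (.var 28) (.get 2 (.var 24))) ;;
  .set 44 (degE 24) ;;
  .ite (.bin .mul (.bin .lt (.var 44) (.bin .add (.var 12) (.lit 1))) (.bin .lt (.var 27) (.var 8)))
    (.set 27 (.bin .add (.var 27) (.lit 1)) ;; forVar 25 44 candStep) .skip

/-- List the neighbours of the vertex in variable `22` and the vertices that are adjacent to many of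
its neighbours of low degree. -/
def gather : Prog :=
  .set 27 (.lit 0) ;; .set 28 (.lit 0) ;; .set 29 (.lit 0) ;; forVar 23 43 gatherStep

end Alg

namespace Inst

variable {I : Inst} {ω : ℕ → Fin I.W}

/-- The cells of the array `f` that belong to later rounds than `i` are zero. -/
def Fresh (I : Inst) (f : ℕ → ℕ) (i : ℕ) : Prop := ∀ i', i < i' → ∀ w : Fin I.n, f (I.pair i' w) = 0

/-- Round `i` uses only cells with first coordinate `i`. Counts and marks thus start at zero in
every round without being cleared, which would cost n steps for each element of X. -/
lemma Fresh.update {f : ℕ → ℕ} {i : ℕ} (h : I.Fresh f i) (w : Fin I.n) (a : ℕ) :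
    I.Fresh (Function.update f (I.pair i w) a) i := by
  intro i' hi' w'
  rw [Function.update_of_ne, h i' hi' w']
  intro he
  have := (pair_inj (I.fin_lt_B _) (I.fin_lt_B _) he).1
  omega

lemma update_pair (f : ℕ → ℕ) (i : ℕ) (w w' : Fin I.n) (a : ℕ) :
    Function.update f (I.pair i w) a (I.pair i w') = if w' = w then a else f (I.pair i w') := by
  by_cases h : w' = w
  · subst h; simp
  · rw [if_neg h, Function.update_of_ne]
    intro he
    exact h (Fin.ext (pair_inj (I.fin_lt_B _) (I.fin_lt_B _) he).2)

lemma length_le_of_nodup {l : List (Fin I.n)} (h : l.Nodup) : l.length ≤ I.n := by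
  simpa using h.length_le_card

/-- The invariant of the search for candidates: `vis` lists the vertices counted so far and `ds`
the neighbours of `x` treated so far. -/
structure CandInv (I : Inst) (i : ℕ) (x : Fin I.n) (ds vis tst : List (Fin I.n)) (s : State) :
    Prop where
  count : ∀ w : Fin I.n, w ≠ x → ¬ I.G.Adj x w → s.arr 6 (I.pair i w) = vis.count w
  fresh : I.Fresh (s.arr 6) i
  nodup : tst.Nodup
  mem : ∀ v, v ∈ tst ↔ v ∈ ds ∨ (v ≠ x ∧ ¬ I.G.Adj x v ∧ 42 * I.ℓ * I.h ≤ vis.count v)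
  list : Holds (s.arr 9) (codes tst)
  v29 : s.var 29 = tst.length

lemma CandInv.congr {i : ℕ} {x : Fin I.n} {ds vis tst : List (Fin I.n)} {s s' : State}
    (h : CandInv I i x ds vis tst s) (h6 : s'.arr 6 = s.arr 6) (h9 : s'.arr 9 = s.arr 9)
    (h29 : s'.var 29 = s.var 29) : CandInv I i x ds vis tst s' :=
  ⟨h6 ▸ h.count, h6 ▸ h.fresh, h.nodup, h.mem, h9 ▸ h.list, h29 ▸ h.v29⟩

lemma wp_candStep {i : ℕ} {x u : Fin I.n} {r : ℕ} {ds vis tst : List (Fin I.n)} {s : State}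
    (hI : CandInv I i x ds vis tst s) (hds : ∀ v ∈ ds, I.G.Adj x v) (hi : i < I.n)
    (hr : r < (I.A u).length) (hvis : vis.length < I.n * I.n) (hE : I.Env s)
    (h21 : s.var 21 = i) (h22 : s.var 22 = x) (h24 : s.var 24 = u) (h25 : s.var 25 = r) :
    wp ω Alg.candStep s fun s' t => t ≤ 70 ∧
      ∃ tst', CandInv I i x ds (vis ++ [(I.A u)[r]]) tst' s' := by
  classical
  have hW := I.one_lt_W
  have hB := I.two_B_le
  have hB' := I.B_ge
  have hn3 := I.n_cube_ge
  have hn2 := I.n_sq_ge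
  have hn := I.hn
  set w := (I.A u)[r] with hw
  refine wp_seq (wp_set (a := w) (hE.eval_nbr h24 h25 hr) ?_)
  set s₁ := s.setv 26 w with hs₁
  have hE₁ : I.Env s₁ := hE.setv (by omega)
  have hI₁ : CandInv I i x ds vis tst s₁ := hI.congr rfl rfl (by simp [hs₁])
  have h26 : s₁.var 26 = w := by simp [hs₁]
  have h21' : s₁.var 21 = i := by simp [hs₁, h21]
  have h22' : s₁.var 22 = x := by simp [hs₁, h22]
  refine wp_ite (eval_add (eval_eq (eval_var h26) (eval_var h22') hW) (hE₁.eval_adj h22' h26)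
    (by split_ifs <;> omega)) (fun hskip => ?_) (fun hnew => ?_)
  · refine wp_skip ⟨by simp only [Expr.cost]; omega, tst, ?_⟩
    have hcnt : ∀ v, v ≠ x → ¬ I.G.Adj x v → (vis ++ [w]).count v = vis.count v := by
      intro v h₁ h₂
      rw [List.count_append, List.count_singleton, if_neg, add_zero]
      simp only [beq_iff_eq]
      rintro h
      rw [h, if_neg (fun h => h₁ (Fin.ext h)), if_neg h₂] at hskip
      exact hskip rfl
    refine ⟨fun v h₁ h₂ => by rw [hI₁.count v h₁ h₂, hcnt v h₁ h₂], hI₁.fresh, hI₁.nodup,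
      fun v => ?_, hI₁.list, hI₁.v29⟩
    rw [hI₁.mem]
    refine or_congr_right (and_congr_right fun h₁ => and_congr_right fun h₂ => ?_)
    rw [hcnt v h₁ h₂]
  · have hwx : w ≠ x := by rintro h; simp [h] at hnew
    have hxw : ¬ I.G.Adj x w := by intro h; simp [h] at hnew
    have hcw := hI₁.count w hwx hxw
    have hcle : vis.count w ≤ vis.length := List.count_le_length
    have hpr : ∀ s' : State, I.Env s' → s'.var 21 = i → s'.var 26 = w →
        (Alg.pr (.var 21) (.var 26)).eval I.W s' = I.pair i w := fun s' h₁ h₂ h₃ =>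
      eval_pr h₁.v4 (eval_var h₂) (eval_var h₃) (by omega) (I.fin_lt_B w)
    refine wp_seq (wp_put (j := I.pair i w) (c := vis.count w + 1) (hpr s₁ hE₁ h21' h26)
      (eval_add (eval_get (hpr s₁ hE₁ h21' h26) hcw) (eval_lit hW) (by omega)) ?_)
    set s₂ := s₁.seta 6 (I.pair i w) (vis.count w + 1) with hs₂
    have hE₂ : I.Env s₂ := hE₁.seta (by omega)
    have hnd : tst.length ≤ I.n := length_le_of_nodup hI.nodup
    have hcnt : ∀ v, (vis ++ [w]).count v = if v = w then vis.count w + 1 else vis.count v := by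
      intro v
      rw [List.count_append, List.count_singleton]
      by_cases h : v = w
      · subst h; simp
      · simp [h, Ne.symm h]
    have harr : ∀ v, v ≠ x → ¬ I.G.Adj x v → s₂.arr 6 (I.pair i v) = (vis ++ [w]).count v := by
      intro v h₁ h₂
      rw [hcnt, hs₂, State.seta_arr, if_pos rfl, update_pair]
      split_ifs with h
      · rfl
      · exact hI₁.count v h₁ h₂
    have hfresh : I.Fresh (s₂.arr 6) i := by
      rw [hs₂, State.seta_arr, if_pos rfl]
      exact hI₁.fresh.update w _
    have h29 : s₂.var 29 = tst.length := hI₁.v29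
    refine wp_ite (eval_eq (a := vis.count w + 1) (b := 42 * I.ℓ * I.h)
      (eval_get (hpr s₂ hE₂ h21' h26) ?_) (eval_var hE₂.v9) hW) (fun heq => ?_) (fun hne => ?_)
    · rw [harr w hwx hxw, hcnt, if_pos rfl]
    · have heq' := of_ite_ne_zero heq
      refine wp_seq (wp_put (j := tst.length) (c := w) (eval_var h29) (eval_var h26) ?_)
      refine wp_set (a := tst.length + 1) (eval_add (eval_var h29) (eval_lit hW) (by omega)) ?_
      -- The test is for equality with the threshold: before this increment the count was below it,
      -- so a vertex is listed once only.
      have hwt : w ∉ tst := by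
        rw [hI.mem]
        rintro (h | ⟨-, -, h⟩)
        · exact hxw (hds w h)
        · omega
      refine ⟨by simp only [Expr.cost]; omega, tst ++ [w], harr, hfresh, ?_, fun v => ?_, ?_,
        by simp⟩
      · rw [List.nodup_append]
        refine ⟨hI.nodup, by simp, ?_⟩
        rintro a ha b hb rfl
        rw [List.mem_singleton.1 hb] at ha
        exact hwt ha
      · rw [List.mem_append, List.mem_singleton, hI.mem, hcnt]
        by_cases h : v = w
        · subst h
          simp only [or_true, if_true, true_iff]
          exact Or.inr ⟨hwx, hxw, by omega⟩
        · simp [h]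
      · have := hI₁.list.append (j := tst.length) (by simp) (w : ℕ)
        rw [codes, List.map_append]
        simpa [hs₂] using this
    · have hne' := not_of_ite_eq_zero hne
      refine wp_skip ⟨by simp only [Expr.cost]; omega, tst, harr, hfresh, hI.nodup, fun v => ?_,
        by simpa [hs₂] using hI₁.list, h29⟩
      rw [hI.mem, hcnt]
      split_ifs with h
      · subst h
        refine or_congr_right (and_congr_right fun h₁ => and_congr_right fun h₂ => ?_)
        omega
      · rfl

/-- The invariant of the loop over the neighbours of `x`. -/
structure GatherInv (I : Inst) (i : ℕ) (x : Fin I.n) (p : ℕ) (lows tst : List (Fin I.n))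
    (s : State) (t : ℕ) : Prop where
  cand : CandInv I i x ((I.A x).take p) (lows.flatMap I.A) tst s
  nodup : lows.Nodup
  sub : ∀ u ∈ lows, u ∈ (I.A x).take p ∧ (I.A u).length ≤ 8 * I.k
  all : lows.length < 84 * I.ℓ * I.h → ∀ u ∈ (I.A x).take p, (I.A u).length ≤ 8 * I.k → u ∈ lows
  length_le : lows.length ≤ 84 * I.ℓ * I.h
  v27 : s.var 27 = lows.length
  v28 : s.var 28 = open Classical in ((I.A x).take p).countP fun v => decide (v ∈ I.T)
  time : t ≤ 12 + 80 * p + lows.length * (624 * I.k + 20)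

lemma length_flatMap_le {l : List (Fin I.n)} {M : ℕ} (h : ∀ u ∈ l, (I.A u).length ≤ M) :
    (l.flatMap I.A).length ≤ l.length * M := by
  induction l with
  | nil => simp
  | cons a l ih =>
    rw [List.flatMap_cons, List.length_append, List.length_cons, add_mul, one_mul]
    have h₁ := h a (by simp)
    have h₂ := ih fun u hu => h u (by simp [hu])
    omega

lemma wp_gatherStep {i : ℕ} {x : Fin I.n} {p : ℕ} {lows tst : List (Fin I.n)} {s : State} {t : ℕ}
    (hI : GatherInv I i x p lows tst s t) (hi : i < I.n) (hp : p < (I.A x).length) (hE : I.Env s)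
    (h21 : s.var 21 = i) (h22 : s.var 22 = x) (h23 : s.var 23 = p) :
    wp ω Alg.gatherStep s fun s' t' =>
      ∃ lows' tst', GatherInv I i x (p + 1) lows' tst' (s'.setv 23 (p + 1)) (t + t' + 8) := by
  classical
  have hW := I.one_lt_W
  have hB := I.two_B_le
  have hB' := I.B_ge
  have hn3 := I.n_cube_ge
  have hn2 := I.n_sq_ge
  have hn := I.hn
  set u := (I.A x)[p] with hu
  have htake : (I.A x).take (p + 1) = (I.A x).take p ++ [u] := by
    rw [List.take_add_one, List.getElem?_eq_getElem hp]; rfl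
  have hnodA := (I.hA x).1
  have hu_notin : u ∉ (I.A x).take p := by
    have := hnodA.sublist (List.take_sublist (p + 1) _)
    rw [htake, List.nodup_append] at this
    exact fun h => this.2.2 u h u (by simp) rfl
  have hxu : I.G.Adj x u := mem_A.1 (List.getElem_mem hp)
  have hnd : tst.length ≤ I.n := length_le_of_nodup hI.cand.nodup
  have hcp : ((I.A x).take p).countP (fun v => decide (v ∈ I.T)) ≤ I.n := by
    refine List.countP_le_length.trans ((List.length_take_le _ _).trans ?_)
    have := I.length_A_le x; omega
  refine wp_seq (wp_set (a := u) (hE.eval_nbr h22 h23 hp) ?_)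
  refine wp_seq (wp_put (j := tst.length) (c := u) (eval_var (by simpa using hI.cand.v29))
    (eval_var (by simp)) ?_)
  refine wp_seq (wp_set (a := tst.length + 1) (eval_add (eval_var (by simpa using hI.cand.v29))
    (eval_lit hW) (by omega)) ?_)
  set s₁ := ((s.setv 24 u).seta 9 tst.length u).setv 29 (tst.length + 1) with hs₁
  have hE₁ : I.Env s₁ := ((hE.setv (by omega)).seta (by omega)).setv (by omega)
  have hT1 : (if u ∈ I.T then 1 else 0 : ℕ) ≤ 1 := by split_ifs <;> omega
  refine wp_seq (wp_set (eval_add (eval_var (by simpa [hs₁] using hI.v28))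
    (hE₁.eval_ter (v := u) (by simp [hs₁])) (by omega)) ?_)
  have e28 : ((I.A x).take p).countP (fun v => decide (v ∈ I.T)) + (if u ∈ I.T then 1 else 0)
      = ((I.A x).take (p + 1)).countP (fun v => decide (v ∈ I.T)) := by
    rw [htake, List.countP_append, List.countP_singleton]
    simp
  rw [e28]
  set s₂ := s₁.setv 28 (((I.A x).take (p + 1)).countP (fun v => decide (v ∈ I.T))) with hs₂
  have hE₂ : I.Env s₂ := hE₁.setv (by omega)
  refine wp_seq (wp_set (a := (I.A u).length) (hE₂.eval_deg (v := u) (by simp [hs₂, hs₁])) ?_)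
  set s₃ := s₂.setv 44 (I.A u).length with hs₃
  have hE₃ : I.Env s₃ := hE₂.setv (by omega)
  have hk := I.hkn
  have hlow8 := I.length_A_le u
  have h27 : s₃.var 27 = lows.length := by simpa [hs₃, hs₂, hs₁] using hI.v27
  have h28 : s₃.var 28 = ((I.A x).take (p + 1)).countP (fun v => decide (v ∈ I.T)) := by
    simp [hs₃, hs₂]
  have hcand₃ : CandInv I i x ((I.A x).take (p + 1)) (lows.flatMap I.A) (tst ++ [u]) s₃ := by
    refine ⟨by simpa [hs₃, hs₂, hs₁] using hI.cand.count,
      by simpa [hs₃, hs₂, hs₁] using hI.cand.fresh, ?_, fun v => ?_, ?_, by simp [hs₃, hs₂, hs₁]⟩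
    · rw [List.nodup_append]
      refine ⟨hI.cand.nodup, by simp, ?_⟩
      rintro a ha b hb rfl
      rw [List.mem_singleton.1 hb] at ha
      rcases (hI.cand.mem u).1 ha with h | ⟨-, h, -⟩
      · exact hu_notin h
      · exact h hxu
    · rw [List.mem_append, hI.cand.mem, htake, List.mem_append]; tauto
    · have := hI.cand.list.append (j := tst.length) (by simp) (u : ℕ)
      rw [codes, List.map_append]
      simpa [hs₃, hs₂, hs₁] using this
  have hlq : lows.length ≤ 84 * I.ℓ * I.h := hI.length_le
  have hℓh := I.ℓh_le
  have hA84 : 84 * I.ℓ * I.h ≤ 400 * I.ℓ * I.h := by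
    rw [mul_assoc, mul_assoc]; exact Nat.mul_le_mul_right _ (by omega)
  refine wp_ite (eval_mul (a := if (I.A u).length < 8 * I.k + 1 then 1 else 0)
    (b := if lows.length < 84 * I.ℓ * I.h then 1 else 0)
    (eval_lt (eval_var (by simp [hs₃])) (eval_add (eval_var hE₃.v12) (eval_lit hW) (by omega)) hW)
    (eval_lt (eval_var h27) (eval_var hE₃.v8) hW) (by split_ifs <;> omega))
    (fun hyes => ?_) (fun hno => ?_)
  · have hboth : (I.A u).length < 8 * I.k + 1 ∧ lows.length < 84 * I.ℓ * I.h := by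
      rw [← not_not (a := _ ∧ _), not_and_or]
      rintro (h | h) <;> simp [h] at hyes
    refine wp_seq (wp_set (a := lows.length + 1) (eval_add (eval_var h27) (eval_lit hW)
      (by omega)) ?_)
    set s₄ := s₃.setv 27 (lows.length + 1) with hs₄
    have hE₄ : I.Env s₄ := hE₃.setv (by omega)
    have hvis : (lows.flatMap I.A).length ≤ p * I.n := by
      refine (length_flatMap_le fun v _ => I.length_A_le v).trans (Nat.mul_le_mul_right _ ?_)
      refine (List.Subperm.length_le (hI.nodup.subperm fun v hv => (hI.sub v hv).1)).trans ?_
      exact List.length_take_le _ _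
    have hpn : (p + 1) * I.n ≤ I.n * I.n :=
      Nat.mul_le_mul_right _ (by have := I.length_A_le x; omega)
    rw [add_mul, one_mul] at hpn
    refine wp_forVar (N := (I.A u).length)
      (fun r s' t' => t' ≤ 2 + 78 * r ∧ ∃ tst', CandInv I i x ((I.A x).take (p + 1))
        (lows.flatMap I.A ++ (I.A u).take r) tst' s')
      (by decide) (by decide) (by decide) (by simp [hs₄, hs₃]) (by omega) hW ?_ ?_ ?_
    · refine ⟨le_rfl, tst ++ [u], ?_⟩
      rw [List.take_zero, List.append_nil]
      exact hcand₃.congr rfl rfl (by simp [hs₄])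
    · rintro r s' t' hr h25 hs ⟨ht', tst', hI'⟩
      refine wp_mono (wp_candStep (u := u) hI' ?_ hi hr ?_ (hE₄.same hs (by decide) (by decide))
        ?_ ?_ ?_ h25) ?_
      · intro v hv; exact mem_A.1 (List.mem_of_mem_take hv)
      · rw [List.length_append, List.length_take]; omega
      · rw [hs.var 21 (by decide)]; simp [hs₄, hs₃, hs₂, hs₁, h21]
      · rw [hs.var 22 (by decide)]; simp [hs₄, hs₃, hs₂, hs₁, h22]
      · rw [hs.var 24 (by decide)]; simp [hs₄, hs₃, hs₂, hs₁]
      · rintro s'' t'' ⟨ht'', tst'', h⟩ -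
        refine ⟨by omega, tst'', ?_⟩
        rw [List.take_add_one (l := I.A u), List.getElem?_eq_getElem hr, ← List.append_assoc]
        exact h.congr rfl rfl (by simp)
    · rintro s' t' h25 hs ⟨ht', tst', hI'⟩
      rw [List.take_length] at hI'
      have hcond : ∀ v ∈ lows ++ [u], v ∈ (I.A x).take (p + 1) ∧ (I.A v).length ≤ 8 * I.k := by
        intro v hv
        rw [htake]
        rcases List.mem_append.1 hv with h | h
        · exact ⟨by simp [(hI.sub v h).1], (hI.sub v h).2⟩
        · rw [List.mem_singleton.1 h]; exact ⟨by simp, by omega⟩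
      refine ⟨lows ++ [u], tst', ?_, ?_, hcond, ?_, ?_, ?_, ?_, ?_⟩
      · rw [List.flatMap_append, List.flatMap_singleton]
        exact hI'.congr rfl rfl (by simp)
      · rw [List.nodup_append]
        refine ⟨hI.nodup, by simp, ?_⟩
        rintro a ha b hb rfl
        rw [List.mem_singleton.1 hb] at ha
        exact hu_notin (hI.sub u ha).1
      · intro _ v hv hv'
        rw [htake] at hv
        rcases List.mem_append.1 hv with h | h
        · exact List.mem_append_left _ (hI.all hboth.2 v h hv')
        · exact List.mem_append_right _ h
      · simp; omega
      · simp only [State.setv_var]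
        rw [if_neg (by omega), hs.var 27 (by decide)]; simp [hs₄]
      · simp only [State.setv_var]
        rw [if_neg (by omega), hs.var 28 (by decide)]; simpa [hs₄] using h28
      -- A scan of at most 8k neighbours at 78 steps each gives the 624k charged to every neighbour
      -- of low degree.
      · have := hI.time
        simp only [Expr.cost, List.length_append, List.length_singleton]
        rw [add_mul, one_mul]
        omega
  · have hcond : lows.length < 84 * I.ℓ * I.h → ¬ (I.A u).length ≤ 8 * I.k := by
      intro h h'
      rw [if_pos (by omega), if_pos h] at hno
      omega
    refine wp_skip ⟨lows, tst ++ [u], ?_, hI.nodup, ?_, ?_, hI.length_le, ?_, ?_, ?_⟩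
    · exact hcand₃.congr rfl rfl (by simp)
    · intro v hv; rw [htake]; exact ⟨by simp [(hI.sub v hv).1], (hI.sub v hv).2⟩
    · intro h v hv hv'
      rw [htake] at hv
      rcases List.mem_append.1 hv with h₁ | h₁
      · exact hI.all h v h₁ hv'
      · rw [List.mem_singleton.1 h₁] at hv'; exact absurd hv' (hcond h)
    · simpa using h27
    · simpa using h28
    · have := hI.time
      simp only [Expr.cost]
      omega

lemma wp_gather {i : ℕ} {x : Fin I.n} {s : State} (hi : i < I.n) (hE : I.Env s)
    (h21 : s.var 21 = i) (h22 : s.var 22 = x) (h43 : s.var 43 = (I.A x).length)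
    (h0 : ∀ i', i ≤ i' → ∀ w : Fin I.n, s.arr 6 (I.pair i' w) = 0) :
    wp ω Alg.gather s fun s' t =>
      ∃ lows tst, GatherInv I i x (I.A x).length lows tst s' t := by
  classical
  have hW := I.one_lt_W
  have hB := I.two_B_le
  have hB' := I.B_ge
  have hn3 := I.n_cube_ge
  have hn2 := I.n_sq_ge
  have hn := I.hn
  have hAx := I.length_A_le x
  refine wp_seq (wp_set (eval_lit (by omega)) ?_)
  refine wp_seq (wp_set (eval_lit (by omega)) ?_)
  refine wp_seq (wp_set (eval_lit (by omega)) ?_)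
  set s₁ := ((s.setv 27 0).setv 28 0).setv 29 0 with hs₁
  have hE₁ : I.Env s₁ := ((hE.setv (by omega)).setv (by omega)).setv (by omega)
  -- A positive threshold ensures that vertices with count 0 are not candidates.
  have hq : 1 ≤ 42 * I.ℓ * I.h := Nat.mul_pos (Nat.mul_pos (by omega) I.hℓ) I.one_le_h
  refine wp_forVar (N := (I.A x).length)
    (fun p s' t => ∃ lows tst, GatherInv I i x p lows tst s' (t + 10))
    (by decide) (by decide) (by decide) (by simp [hs₁, h43]) (by omega) hW ?_ ?_ ?_
  · refine ⟨[], [], ⟨fun w _ _ => ?_, fun i' hi' w => ?_, by simp, fun v => ?_, Holds.nil _,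
      by simp [hs₁]⟩, by simp, by simp, by simp, by simp, by simp [hs₁], by simp [hs₁], by simp⟩
    · simpa [hs₁] using h0 i le_rfl w
    · simpa [hs₁] using h0 i' hi'.le w
    · simp only [List.take_zero, List.flatMap_nil, List.count_nil, List.not_mem_nil, false_or]
      exact ⟨False.elim, fun h => by omega⟩
  · rintro p s' t hp h23 hs ⟨lows, tst, hI⟩
    refine wp_mono (wp_gatherStep hI hi hp (hE₁.same hs (by decide) (by decide)) ?_ ?_ h23) ?_
    · rw [hs.var 21 (by decide)]; simp [hs₁, h21]
    · rw [hs.var 22 (by decide)]; simp [hs₁, h22]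
    · rintro s'' t'' ⟨lows', tst', h⟩ -
      exact ⟨lows', tst', { h with time := by have := h.time; omega }⟩
  · rintro s' t h23 hs ⟨lows, tst, hI⟩
    refine ⟨lows, tst, { hI with time := ?_ }⟩
    have := hI.time
    simp only [Expr.cost]
    omega

end Inst

end VertexConn

/-! ### Assembling the kernel -/

namespace VertexConn

open WordRam

namespace Alg

/-- Add the vertex in variable `y` to the kernel unless it is there already. Array `8` marks the
vertices of the kernel, and array `12`, of length in variable `38`, lists them. -/
def addVertex (y : ℕ) : Prog :=
  .ite (.get 8 (pr (.var 21) (.var y))) .skip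
    (.put 8 (pr (.var 21) (.var y)) (.lit 1) ;; .put 12 (.var 38) (.var y) ;;
      .set 38 (.bin .add (.var 38) (.lit 1)))

/-- Add the edge between the vertices in the variables `a` and `b`. The arrays `13` and `14`, of
length in variable `39`, list the edges. -/
def addEdge (a b : ℕ) : Prog :=
  .put 13 (.var 39) (.var a) ;; .put 14 (.var 39) (.var b) ;;
    .set 39 (.bin .add (.var 39) (.lit 1))

/-- Treat the neighbour at the position in variable `37` of the list in array `11`. Array `7` marks
the accepted vertices. -/
def arcStep : Prog :=
  .set 42 (.get 11 (.var 37)) ;;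
  addVertex 42 ;;
  .ite (.bin .lt (.get 7 (pr (.var 21) (.var 42))) (.bin .add (.lit 1) (adjE 22 31)))
    (addEdge 31 42) .skip

/-- Add the vertex in variable `31`, its edge to the vertex in variable `22` and the neighbours
listed in array `11`. -/
def accept : Prog :=
  .put 7 (pr (.var 21) (.var 31)) (.lit 1) ;;
  addVertex 31 ;;
  .ite (adjE 22 31) (addEdge 22 31) .skip ;;
  forVar 37 36 arcStep

/-- Examine the vertex at the position in variable `30` of the list in array `9`. Array `15`, of
length in variable `40`, lists the elements of `Z`. -/
def examine : Prog :=
  .set 31 (.get 9 (.var 30)) ;;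
  walk ;;
  .ite (.var 35)
    (.ite (adjE 22 31)
      (.put 15 (.var 40) (.var 31) ;; .set 40 (.bin .add (.var 40) (.lit 1))) .skip)
    accept

/-- Join the vertex at the position in variable `41` to the sink if it is close to the
terminals. -/
def sinkStep : Prog :=
  .ite (.bin .lt (.lit 1) (.var 41))
    (.set 31 (.get 12 (.var 41)) ;;
      .ite (.get 7 (pr (.var 21) (.var 31))) .skip (addEdge 31 0)) .skip

end Alg

namespace Inst

variable {I : Inst} {ω : ℕ → Fin I.W}

/-- The state of the round `i` represents the data collected for `x`. -/
structure Rep (I : Inst) (i : ℕ) (acc : List (Fin I.n)) (vs : List (Option (Fin I.n)))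
    (es : List (Option (Fin I.n) × Option (Fin I.n))) (zs : List (Fin I.n)) (s : State) :
    Prop where
  a7 : ∀ v : Fin I.n, s.arr 7 (I.pair i v) = if v ∈ acc then 1 else 0
  a8 : ∀ v : Fin I.n, s.arr 8 (I.pair i v) = if some v ∈ vs then 1 else 0
  fresh7 : I.Fresh (s.arr 7) i
  fresh8 : I.Fresh (s.arr 8) i
  a12 : Holds (s.arr 12) (vs.map vertexCode)
  v38 : s.var 38 = vs.length
  a13 : Holds (s.arr 13) (es.map fun e => vertexCode e.1)
  a14 : Holds (s.arr 14) (es.map fun e => vertexCode e.2)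
  v39 : s.var 39 = es.length
  a15 : Holds (s.arr 15) (codes zs)
  v40 : s.var 40 = zs.length

lemma Rep.congr {i : ℕ} {acc zs : List (Fin I.n)} {vs : List (Option (Fin I.n))}
    {es : List (Option (Fin I.n) × Option (Fin I.n))} {s s' : State} (h : Rep I i acc vs es zs s)
    (ha : ∀ a ∈ [7, 8, 12, 13, 14, 15], s'.arr a = s.arr a)
    (hv : ∀ x ∈ [38, 39, 40], s'.var x = s.var x) : Rep I i acc vs es zs s' := by
  simp only [List.mem_cons, List.not_mem_nil, or_false, forall_eq_or_imp, forall_eq] at ha hv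
  obtain ⟨h7, h8, h12, h13, h14, h15⟩ := ha
  obtain ⟨h38, h39, h40⟩ := hv
  exact ⟨h7 ▸ h.a7, h8 ▸ h.a8, h7 ▸ h.fresh7, h8 ▸ h.fresh8, h12 ▸ h.a12, h38 ▸ h.v38, h13 ▸ h.a13,
    h14 ▸ h.a14, h39 ▸ h.v39, h15 ▸ h.a15, h40 ▸ h.v40⟩

lemma Rep.setv {i : ℕ} {acc zs : List (Fin I.n)} {vs : List (Option (Fin I.n))}
    {es : List (Option (Fin I.n) × Option (Fin I.n))} {s : State} (h : Rep I i acc vs es zs s)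
    {x a : ℕ} (hx : x ∉ [38, 39, 40]) : Rep I i acc vs es zs (s.setv x a) :=
  h.congr (fun _ _ => rfl) fun y hy => by
    rw [State.setv_var, if_neg]; rintro rfl; exact hx hy

lemma Rep.same {i : ℕ} {acc zs : List (Fin I.n)} {vs : List (Option (Fin I.n))}
    {es : List (Option (Fin I.n) × Option (Fin I.n))} {s s' : State} (h : Rep I i acc vs es zs s)
    {ws as : List ℕ} {o : Bool} (hs : Same ws as o s s')
    (ha : ∀ a ∈ [7, 8, 12, 13, 14, 15], a ∉ as) (hv : ∀ x ∈ [38, 39, 40], x ∉ ws) :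
    Rep I i acc vs es zs s' :=
  h.congr (fun a h => hs.arr a (ha a h)) fun x h => hs.var x (hv x h)

lemma length_vs_le {vs : List (Option (Fin I.n))} (h : vs.Nodup) : vs.length ≤ I.n + 1 := by
  simpa using h.length_le_card

lemma length_es_le {es : List (Option (Fin I.n) × Option (Fin I.n))}
    (h : (es.map fun e => s(e.1, e.2)).Nodup) : es.length ≤ (I.n + 1) * (I.n + 1) := by
  simpa using (List.Nodup.of_map _ h).length_le_card

lemma wp_addVertex {y i : ℕ} {u : Fin I.n} {acc zs : List (Fin I.n)}
    {vs : List (Option (Fin I.n))} {es : List (Option (Fin I.n) × Option (Fin I.n))} {s : State}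
    (hR : Rep I i acc vs es zs s) (hE : I.Env s) (hi : i < I.n) (hvs : vs.length ≤ I.n + 1)
    (h21 : s.var 21 = i) (hy : s.var y = u) :
    wp ω (Alg.addVertex y) s fun s' t => t ≤ 30 ∧ ∃ vs',
      (some u ∈ vs ∧ vs' = vs ∨ some u ∉ vs ∧ vs' = vs ++ [some u]) ∧
      Rep I i acc vs' es zs s' := by
  classical
  have hW := I.one_lt_W
  have hB := I.two_B_le
  have hB' := I.B_ge
  have hn3 := I.n_cube_ge
  have hn2 := I.n_sq_ge
  have hn := I.hn
  have hpr : (Alg.pr (.var 21) (.var y)).eval I.W s = I.pair i u :=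
    eval_pr hE.v4 (eval_var h21) (eval_var hy) (by omega) (I.fin_lt_B u)
  refine wp_ite (eval_get hpr (hR.a8 u)) (fun h => ?_) (fun h => ?_)
  · exact wp_skip ⟨by simp only [Expr.cost]; omega, vs, Or.inl ⟨of_ite_ne_zero h, rfl⟩, hR⟩
  · have h' := not_of_ite_eq_zero h
    refine wp_seq (wp_put hpr (eval_lit hW) ?_)
    refine wp_seq (wp_put (j := vs.length) (c := u) (eval_var (by simpa using hR.v38))
      (eval_var (by simpa using hy)) ?_)
    refine wp_set (a := vs.length + 1) (eval_add (eval_var (by simpa using hR.v38)) (eval_lit hW)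
      (by omega)) ?_
    refine ⟨by simp only [Expr.cost]; omega, vs ++ [some u], Or.inr ⟨h', rfl⟩, ?_⟩
    refine ⟨by simpa using hR.a7, fun v => ?_, by simpa using hR.fresh7,
      by simpa using hR.fresh8.update u 1, ?_, by simp, by simpa using hR.a13,
      by simpa using hR.a14, by simpa using hR.v39, by simpa using hR.a15, by simpa using hR.v40⟩
    · simp only [State.setv_arr, State.seta_arr]
      rw [if_neg (by decide), if_pos trivial, update_pair, hR.a8 v]
      by_cases hv : v = u <;> simp [hv]
    · have := hR.a12.append (j := vs.length) (by simp) (u : ℕ)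
      rw [List.map_append]
      simpa [vertexCode] using this

lemma wp_addEdge {a b i : ℕ} {e : Option (Fin I.n) × Option (Fin I.n)} {acc zs : List (Fin I.n)}
    {vs : List (Option (Fin I.n))} {es : List (Option (Fin I.n) × Option (Fin I.n))} {s : State}
    (hR : Rep I i acc vs es zs s) (hes : es.length ≤ (I.n + 1) * (I.n + 1))
    (ha : s.var a = vertexCode e.1) (hb : s.var b = vertexCode e.2) :
    wp ω (Alg.addEdge a b) s fun s' t => t ≤ 20 ∧ Rep I i acc vs (es ++ [e]) zs s' := by
  have hW := I.one_lt_W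
  have hB := I.two_B_le
  have hB' := I.B_ge
  have hn3 := I.n_cube_ge
  have hn2 := I.n_sq_ge
  have hn := I.hn
  have hnn : (I.n + 1) * (I.n + 1) = I.n * I.n + 2 * I.n + 1 := by ring
  refine wp_seq (wp_put (eval_var hR.v39) (eval_var ha) ?_)
  refine wp_seq (wp_put (j := es.length) (eval_var (by simpa using hR.v39))
    (eval_var (by simpa using hb)) ?_)
  refine wp_set (a := es.length + 1) (eval_add (eval_var (by simpa using hR.v39)) (eval_lit hW)
    (by omega)) ?_
  refine ⟨by simp only [Expr.cost]; omega, ?_⟩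
  refine ⟨by simpa using hR.a7, by simpa using hR.a8, by simpa using hR.fresh7,
    by simpa using hR.fresh8, by simpa using hR.a12, by simpa using hR.v38, ?_, ?_,
    by simp, by simpa using hR.a15, by simpa using hR.v40⟩
  · have := hR.a13.append (j := es.length) (by simp) (vertexCode e.1)
    rw [List.map_append]
    simpa using this
  · have := hR.a14.append (j := es.length) (by simp) (vertexCode e.2)
    rw [List.map_append]
    simpa using this

lemma wp_arcStep {i r : ℕ} {x v : Fin I.n} {P acc zs dl : List (Fin I.n)}
    {vs : List (Option (Fin I.n))} {es : List (Option (Fin I.n) × Option (Fin I.n))}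
    {arcs : Set (Fin I.n × Fin I.n)} {s : State}
    (hC : Collected I x P acc arcs vs es zs) (hR : Rep I i acc vs es zs s) (hE : I.Env s)
    (hi : i < I.n) (hr : r < dl.length) (hv : v ∈ acc) (hu : dl[r] ∈ I.F x v)
    (hnew : (v, dl[r]) ∉ arcs)
    (hcomplete : ∀ a ∈ acc, a ≠ v → ∀ w ∈ I.F x a, (a, w) ∈ arcs)
    (hdl : Holds (s.arr 11) (codes dl))
    (h21 : s.var 21 = i) (h22 : s.var 22 = x) (h31 : s.var 31 = v) (h37 : s.var 37 = r) :
    wp ω Alg.arcStep s fun s' t => t ≤ 80 ∧ ∃ vs' es' arcs' : _, arcs' = insert (v, dl[r]) arcs ∧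
      (∃ l, vs' = vs ++ l) ∧
      Collected I x P acc arcs' vs' es' zs ∧ Rep I i acc vs' es' zs s' := by
  classical
  have hW := I.one_lt_W
  have hB := I.two_B_le
  have hB' := I.B_ge
  have hn3 := I.n_cube_ge
  have hn2 := I.n_sq_ge
  have hn := I.hn
  set u := dl[r] with hu_def
  refine wp_seq (wp_set (a := (u : ℕ)) (eval_get (eval_var h37) (hdl.get (by simp [codes, hr, hu_def]))) ?_)
  set s₁ := s.setv 42 u with hs₁
  have hE₁ : I.Env s₁ := hE.setv (by omega)
  refine wp_seq (wp_mono (wp_addVertex (u := u) (hR.setv (by decide)) hE₁ hi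
    (length_vs_le hC.vs_nodup) (by simp [hs₁, h21]) (by simp [hs₁])) ?_)
  rintro s₂ t₂ ⟨ht₂, vs', hvs', hR₂⟩ hs
  have hE₂ : I.Env s₂ := hE₁.same hs (by decide) (by decide)
  have v21 : s₂.var 21 = i := by rw [hs.var 21 (by decide)]; simp [hs₁, h21]
  have v22 : s₂.var 22 = x := by rw [hs.var 22 (by decide)]; simp [hs₁, h22]
  have v31 : s₂.var 31 = v := by rw [hs.var 31 (by decide)]; simp [hs₁, h31]
  have v42 : s₂.var 42 = u := by rw [hs.var 42 (by decide)]; simp [hs₁]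
  have hl : ∃ l, vs' = vs ++ l := by
    rcases hvs' with ⟨-, h⟩ | ⟨-, h⟩
    · exact ⟨[], by simp [h]⟩
    · exact ⟨_, h⟩
  have hpr : (Alg.pr (.var 21) (.var 42)).eval I.W s₂ = I.pair i u :=
    eval_pr hE₂.v4 (eval_var v21) (eval_var v42) (by omega) (I.fin_lt_B u)
  -- The mark of `u`, 0 or 1, is compared with 1 plus the adjacency bit of `x` and `v`. The test
  -- fails only if `u` is accepted and `v` lies outside N(x), the case in which the edge was
  -- recorded from `u`.
  refine wp_ite (eval_lt (eval_get hpr (hR₂.a7 u)) (eval_add (eval_lit hW)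
    (hE₂.eval_adj v22 v31) (by split_ifs <;> omega)) hW) (fun h => ?_) (fun h => ?_)
  · have h' := of_ite_ne_zero h
    refine wp_mono (wp_addEdge (e := (some v, some u)) hR₂ (length_es_le hC.es_nodup) v31 v42) ?_
    rintro s₃ t₃ ⟨ht₃, hR₃⟩ -
    refine ⟨by simp only [Expr.cost]; omega, vs', es ++ [(some v, some u)], _, rfl, hl, ?_, hR₃⟩
    refine hC.arc hv hu hnew hcomplete hvs' (Or.inr ⟨?_, rfl⟩)
    rintro ⟨h₁, h₂⟩
    simp [h₁, h₂] at h'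
  · have h' := not_of_ite_eq_zero h
    refine wp_skip ⟨by simp only [Expr.cost]; omega, vs', es, _, rfl, hl, ?_, hR₂⟩
    refine hC.arc hv hu hnew hcomplete hvs' (Or.inl ⟨⟨?_, ?_⟩, rfl⟩)
    · by_contra h₁; simp [h₁] at h'
    · intro h₁; apply h'; simp only [h₁, if_true]; split_ifs <;> omega

/-- The data collected for `x` from the vertices of `P` are complete and represented by `s`. -/
def Examined (I : Inst) (i : ℕ) (x : Fin I.n) (P : List (Fin I.n)) (s : State) : Prop :=
  ∃ acc arcs vs es zs, Collected I x P acc arcs vs es zs ∧ Rep I i acc vs es zs s ∧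
    (∀ a ∈ acc, ∀ u ∈ I.F x a, (a, u) ∈ arcs) ∧ ∃ l, vs = none :: some x :: l

lemma wp_accept {i : ℕ} {x v : Fin I.n} {P dl : List (Fin I.n)} {s : State}
    (hX : Examined I i x P s) (hE : I.Env s) (hi : i < I.n) (hvP : v ∉ P) (hvx : v ≠ x)
    (hbad : ¬ I.Bad x v) (hnd : dl.Nodup) (hmem : ∀ u, u ∈ dl ↔ u ∈ I.F x v)
    (hlen : dl.length ≤ I.NC) (h36 : s.var 36 = dl.length) (hdl : Holds (s.arr 11) (codes dl))
    (h21 : s.var 21 = i) (h22 : s.var 22 = x) (h31 : s.var 31 = v) :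
    wp ω Alg.accept s fun s' t => t ≤ 88 * I.NC + 100 ∧ Examined I i x (P ++ [v]) s' := by
  classical
  have hW := I.one_lt_W
  have hB := I.two_B_le
  have hB' := I.B_ge
  have hn3 := I.n_cube_ge
  have hn2 := I.n_sq_ge
  have hn := I.hn
  have hNC := I.NC_le
  obtain ⟨acc, arcs, vs, es, zs, hC, hR, hcomplete, lvs, hlvs⟩ := hX
  have hva : v ∉ acc := fun h => hvP (hC.acc_sub v h)
  have hF : (I.F x v).card ≤ 400 * I.ℓ * I.h * I.h := by
    have : I.F x v = dl.toFinset := by ext u; simp [hmem]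
    rw [this]
    exact (List.toFinset_card_le _).trans hlen
  have hpr : (Alg.pr (.var 21) (.var 31)).eval I.W s = I.pair i v :=
    eval_pr hE.v4 (eval_var h21) (eval_var h31) (by omega) (I.fin_lt_B v)
  refine wp_seq (wp_put hpr (eval_lit hW) ?_)
  set s₁ := s.seta 7 (I.pair i v) 1 with hs₁
  have hE₁ : I.Env s₁ := hE.seta (by omega)
  have hR₁ : Rep I i (acc ++ [v]) vs es zs s₁ := by
    refine ⟨fun w => ?_, by simpa [hs₁] using hR.a8, ?_, by simpa [hs₁] using hR.fresh8,
      by simpa [hs₁] using hR.a12, hR.v38, by simpa [hs₁] using hR.a13,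
      by simpa [hs₁] using hR.a14, hR.v39, by simpa [hs₁] using hR.a15, hR.v40⟩
    · rw [hs₁, State.seta_arr, if_pos rfl, update_pair, hR.a7 w]
      by_cases hw : w = v <;> simp [hw]
    · rw [hs₁, State.seta_arr, if_pos rfl]
      exact hR.fresh7.update v 1
  refine wp_seq (wp_mono (wp_addVertex (u := v) hR₁ hE₁ hi (length_vs_le hC.vs_nodup)
    (by simp [hs₁, h21]) (by simp [hs₁, h31])) ?_)
  rintro s₂ t₂ ⟨ht₂, vs₂, hvs₂, hR₂⟩ hs₂
  have hE₂ : I.Env s₂ := hE₁.same hs₂ (by decide) (by decide)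
  have v21 : s₂.var 21 = i := by rw [hs₂.var 21 (by decide)]; simp [hs₁, h21]
  have v22 : s₂.var 22 = x := by rw [hs₂.var 22 (by decide)]; simp [hs₁, h22]
  have v31 : s₂.var 31 = v := by rw [hs₂.var 31 (by decide)]; simp [hs₁, h31]
  have v36 : s₂.var 36 = dl.length := by rw [hs₂.var 36 (by decide)]; simp [hs₁, h36]
  have a11 : s₂.arr 11 = s.arr 11 := by rw [hs₂.arr 11 (by decide)]; simp [hs₁]
  have hlvs₂ : ∃ l, vs₂ = none :: some x :: l := by
    rcases hvs₂ with ⟨-, h⟩ | ⟨-, h⟩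
    · exact ⟨lvs, by rw [h, hlvs]⟩
    · exact ⟨lvs ++ [some v], by rw [h, hlvs]; rfl⟩
  refine wp_seq (p := .ite (Alg.adjE 22 31) (Alg.addEdge 22 31) .skip) ?_
  have hedge : wp ω (.ite (Alg.adjE 22 31) (Alg.addEdge 22 31) .skip) s₂ fun s₃ t₃ =>
      t₃ ≤ 35 ∧ ∃ es₃, Collected I x (P ++ [v]) (acc ++ [v]) arcs vs₂ es₃ zs ∧
        Rep I i (acc ++ [v]) vs₂ es₃ zs s₃ := by
    refine wp_ite (hE₂.eval_adj v22 v31) (fun h => ?_) (fun h => ?_)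
    · refine wp_mono (wp_addEdge (e := (some x, some v)) hR₂ (length_es_le hC.es_nodup) v22 v31) ?_
      rintro s₃ t₃ ⟨ht₃, hR₃⟩ -
      exact ⟨by simp only [Expr.cost]; omega, _, hC.accept hvP hvx ⟨hbad, hF⟩ hvs₂
        (Or.inl ⟨of_ite_ne_zero h, rfl⟩), hR₃⟩
    · exact wp_skip ⟨by simp only [Expr.cost]; omega, _, hC.accept hvP hvx ⟨hbad, hF⟩ hvs₂
        (Or.inr ⟨not_of_ite_eq_zero h, rfl⟩), hR₂⟩
  refine wp_mono hedge ?_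
  rintro s₃ t₃ ⟨ht₃, es₃, hC₃, hR₃⟩ hs₃
  have hE₃ : I.Env s₃ := hE₂.same hs₃ (by decide) (by decide)
  -- While the list is processed the arcs of `v` are incomplete; those of all earlier accepted
  -- vertices are complete, which is what the omission of duplicate edges relies on.
  refine wp_forVar (N := dl.length) (fun r s' t => t ≤ 2 + 88 * r ∧ ∃ vs' es',
    (∃ l, vs' = none :: some x :: l) ∧
    Collected I x (P ++ [v]) (acc ++ [v]) (arcs ∪ {y | y.1 = v ∧ y.2 ∈ dl.take r}) vs' es' zs ∧
    Rep I i (acc ++ [v]) vs' es' zs s') (by decide) (by decide) (by decide)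
    (by rw [hs₃.var 36 (by decide), v36]) (by omega) hW ?_ ?_ ?_
  · exact ⟨le_rfl, vs₂, es₃, hlvs₂, by simpa using hC₃, hR₃.setv (by decide)⟩
  · rintro r s' t hr h37 hs ⟨ht, vs', es', ⟨l, hl⟩, hC', hR'⟩
    have htake : dl.take (r + 1) = dl.take r ++ [dl[r]] := by
      rw [List.take_add_one, List.getElem?_eq_getElem hr]; rfl
    have hnot : dl[r] ∉ dl.take r := by
      have := hnd.sublist (List.take_sublist (r + 1) _)
      rw [htake, List.nodup_append] at this
      exact fun h => this.2.2 _ h _ (by simp) rfl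
    refine wp_mono (wp_arcStep (dl := dl) (v := v) hC' hR' (hE₃.same hs (by decide) (by decide)) hi
      hr (by simp) ((hmem _).1 (List.getElem_mem hr)) ?_ ?_ ?_ ?_ ?_ ?_ h37) ?_
    · rintro (h | h)
      · exact hva (hC.arcs_sub _ _ h).1
      · exact hnot h.2
    · intro a ha hav w hw
      have ha' : a ∈ acc := by simpa [hav] using ha
      exact Or.inl (hcomplete a ha' w hw)
    · rw [hs.arr 11 (by decide), hs₃.arr 11 (by decide), a11]; exact hdl
    · rw [hs.var 21 (by decide), hs₃.var 21 (by decide), v21]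
    · rw [hs.var 22 (by decide), hs₃.var 22 (by decide), v22]
    · rw [hs.var 31 (by decide), hs₃.var 31 (by decide), v31]
    · rintro s'' t'' ⟨ht'', vs'', es'', arcs'', harcs, ⟨l', hl'⟩, hC'', hR''⟩ -
      refine ⟨by omega, vs'', es'', ⟨l ++ l', by rw [hl', hl]; rfl⟩, ?_, hR''.setv (by decide)⟩
      convert hC'' using 1
      rw [harcs, htake]
      ext ⟨a, w⟩
      simp only [Set.mem_union, Set.mem_ofPred_eq, List.mem_append, List.mem_singleton,
        Set.mem_insert_iff, Prod.mk.injEq]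
      tauto
  · rintro s' t h37 hs ⟨ht, vs', es', hl, hC', hR'⟩
    refine ⟨by simp only [Expr.cost]; omega, _, _, vs', es', zs, hC', hR', ?_, hl⟩
    intro a ha u hu
    rw [List.take_length]
    rcases List.mem_append.1 ha with h | h
    · exact Or.inl (hcomplete a h u hu)
    · rw [List.mem_singleton.1 h] at hu ⊢
      exact Or.inr ⟨rfl, (hmem u).2 hu⟩

lemma wp_examine {i j : ℕ} {x v : Fin I.n} {P tst : List (Fin I.n)} {s : State}
    (hX : Examined I i x P s) (hE : I.Env s) (hi : i < I.n) (hx : (I.N x).card ≤ I.k + 2 * I.ℓ)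
    (hvP : v ∉ P) (hvx : v ≠ x) (hj : tst[j]? = some v) (htst : Holds (s.arr 9) (codes tst))
    (h21 : s.var 21 = i) (h22 : s.var 22 = x) (h30 : s.var 30 = j) :
    wp ω Alg.examine s fun s' t => t ≤ 168 * I.NC + 200 ∧ Examined I i x (P ++ [v]) s' := by
  classical
  have hW := I.one_lt_W
  have hB := I.two_B_le
  have hB' := I.B_ge
  have hn3 := I.n_cube_ge
  have hn2 := I.n_sq_ge
  have hn := I.hn
  refine wp_seq (wp_set (a := (v : ℕ)) (eval_get (eval_var h30) (htst.get (by simp [codes, hj]))) ?_)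
  set s₁ := s.setv 31 v with hs₁
  have hE₁ : I.Env s₁ := hE.setv (by omega)
  refine wp_seq (wp_mono (wp_walk (x := x) (v := v) hE₁ (by simp [hs₁]) (by simp [hs₁, h22]) hvx
    hx) ?_)
  rintro s₂ t₂ ⟨ht₂, hcase⟩ hs₂
  have hE₂ : I.Env s₂ := hE₁.same hs₂ (by decide) (by decide)
  have v21 : s₂.var 21 = i := by rw [hs₂.var 21 (by decide)]; simp [hs₁, h21]
  have v22 : s₂.var 22 = x := by rw [hs₂.var 22 (by decide)]; simp [hs₁, h22]
  have v31 : s₂.var 31 = v := by rw [hs₂.var 31 (by decide)]; simp [hs₁]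
  obtain ⟨acc, arcs, vs, es, zs, hC, hR, hcomplete, lvs, hlvs⟩ := hX
  have hR₂ : Rep I i acc vs es zs s₂ :=
    (hR.setv (by decide)).same hs₂ (by decide) (by decide)
  rcases hcase with ⟨h35, hbad, dl, hnd, hmem, hlen, h36, hdl⟩ | ⟨h35, hbad⟩
  · refine wp_ite (eval_var h35) (fun h => absurd rfl h) (fun _ => ?_)
    refine wp_mono (wp_accept ⟨acc, arcs, vs, es, zs, hC, hR₂, hcomplete, lvs, hlvs⟩ hE₂ hi hvP hvx
      hbad hnd hmem hlen h36 hdl v21 v22 v31) ?_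
    rintro s₃ t₃ ⟨ht₃, h⟩ -
    exact ⟨by simp only [Expr.cost]; omega, h⟩
  · refine wp_ite (eval_var h35) (fun _ => ?_) (fun h => absurd h (by decide))
    refine wp_ite (hE₂.eval_adj v22 v31) (fun h => ?_) (fun h => ?_)
    · have hz : zs.length ≤ I.n := length_le_of_nodup hC.zs_nodup
      refine wp_seq (wp_put (j := zs.length) (c := v) (eval_var hR₂.v40) (eval_var v31) ?_)
      refine wp_set (a := zs.length + 1) (eval_add (eval_var (by simpa using hR₂.v40))
        (eval_lit hW) (by omega)) ?_
      refine ⟨by simp only [Expr.cost]; omega, acc, arcs, vs, es, zs ++ [v],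
        hC.reject hvP hvx hbad (Or.inl ⟨of_ite_ne_zero h, rfl⟩), ?_, hcomplete, lvs, hlvs⟩
      refine ⟨by simpa using hR₂.a7, by simpa using hR₂.a8, by simpa using hR₂.fresh7,
        by simpa using hR₂.fresh8, by simpa using hR₂.a12, by simpa using hR₂.v38,
        by simpa using hR₂.a13, by simpa using hR₂.a14, by simpa using hR₂.v39, ?_, by simp⟩
      have := hR₂.a15.append (j := zs.length) (by simp) (v : ℕ)
      rw [codes, List.map_append]
      simpa using this
    · exact wp_skip ⟨by simp only [Expr.cost]; omega, acc, arcs, vs, es, zs,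
        hC.reject hvP hvx hbad (Or.inr ⟨not_of_ite_eq_zero h, rfl⟩), hR₂, hcomplete, lvs, hlvs⟩

/-- The edges listed in `es'` are those of `es` and the edges to the sink from the vertices of `vs`
that have not been accepted. -/
structure Sunk (I : Inst) (x : Fin I.n) (acc : List (Fin I.n)) (vs : List (Option (Fin I.n)))
    (es es' : List (Option (Fin I.n) × Option (Fin I.n))) : Prop where
  nodup : (es'.map fun e => s(e.1, e.2)).Nodup
  mem : ∀ e, e ∈ (es'.map fun e => s(e.1, e.2)) ↔ e ∈ (es.map fun e => s(e.1, e.2)) ∨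
    ∃ v, some v ∈ vs ∧ v ≠ x ∧ v ∉ acc ∧ e = s(some v, none)

lemma wp_sinkStep {i j : ℕ} {x : Fin I.n} {P acc zs : List (Fin I.n)}
    {vs : List (Option (Fin I.n))} {es es' : List (Option (Fin I.n) × Option (Fin I.n))}
    {arcs : Set (Fin I.n × Fin I.n)} {s : State}
    (hC : Collected I x P acc arcs vs es zs) (hl : ∃ l, vs = none :: some x :: l)
    (hR : Rep I i acc vs es' zs s) (hS : Sunk I x acc (vs.take j) es es')
    (hlen : es'.length ≤ es.length + (j - 2)) (hE : I.Env s) (hi : i < I.n) (hj : j < vs.length)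
    (h21 : s.var 21 = i) (h41 : s.var 41 = j) :
    wp ω Alg.sinkStep s fun s' t => t ≤ 50 ∧ ∃ es'', Sunk I x acc (vs.take (j + 1)) es es'' ∧
      es''.length ≤ es.length + (j + 1 - 2) ∧ Rep I i acc vs es'' zs s' := by
  classical
  have hW := I.one_lt_W
  have hB := I.two_B_le
  have hB' := I.B_ge
  have hn3 := I.n_cube_ge
  have hn2 := I.n_sq_ge
  have hn := I.hn
  have htake : vs.take (j + 1) = vs.take j ++ [vs[j]] := by
    rw [List.take_add_one, List.getElem?_eq_getElem hj]; rfl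
  obtain ⟨l, hl⟩ := hl
  have hstay : (∀ v, vs[j] = some v → v = x ∨ v ∈ acc) → Sunk I x acc (vs.take (j + 1)) es es' := by
    intro h
    refine ⟨hS.nodup, fun e => ?_⟩
    rw [hS.mem]
    refine or_congr_right (exists_congr fun v => ?_)
    rw [htake, List.mem_append, List.mem_singleton]
    constructor
    · rintro ⟨h₁, h₂⟩; exact ⟨Or.inl h₁, h₂⟩
    · rintro ⟨h₁ | h₁, h₂, h₃, h₄⟩
      · exact ⟨h₁, h₂, h₃, h₄⟩
      · rcases h v h₁.symm with h' | h'
        · exact absurd h' h₂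
        · exact absurd h' h₃
  refine wp_ite (eval_lt (eval_lit hW) (eval_var h41) hW) (fun h => ?_) (fun h => ?_)
  · have h' := of_ite_ne_zero h
    -- Positions 0 and 1 hold the sink and `x`, and the list has no repetitions, so every later
    -- position holds another vertex of the input graph.
    obtain ⟨v, hv⟩ : ∃ v, vs[j] = some v := by
      rcases hvj : vs[j] with _ | v
      · exfalso
        have h₀ : vs[0]'(by omega) = none := by simp [hl]
        have := (hC.vs_nodup.getElem_inj_iff (hi := hj) (hj := by omega)).1 (hvj.trans h₀.symm)
        omega
      · exact ⟨v, rfl⟩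
    have hvx : v ≠ x := by
      rintro rfl
      have h₁ : vs[1]'(by omega) = some v := by simp [hl]
      have := (hC.vs_nodup.getElem_inj_iff (hi := hj) (hj := by omega)).1 (hv.trans h₁.symm)
      omega
    refine wp_seq (wp_set (a := (v : ℕ)) (eval_get (eval_var h41)
      (hR.a12.get (by simp [hj, hv, vertexCode]))) ?_)
    set s₁ := s.setv 31 v with hs₁
    have hE₁ : I.Env s₁ := hE.setv (by omega)
    have hR₁ : Rep I i acc vs es' zs s₁ := hR.setv (by decide)
    have hpr : (Alg.pr (.var 21) (.var 31)).eval I.W s₁ = I.pair i v :=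
      eval_pr hE₁.v4 (eval_var (by simp [hs₁, h21])) (eval_var (by simp [hs₁])) (by omega)
        (I.fin_lt_B v)
    refine wp_ite (eval_get hpr (hR₁.a7 v)) (fun h => ?_) (fun h => ?_)
    · have hacc := of_ite_ne_zero h
      refine wp_skip ⟨by simp only [Expr.cost]; omega, es', hstay ?_, by omega, hR₁⟩
      intro w hw
      rw [hv] at hw
      exact Or.inr (Option.some_injective _ hw ▸ hacc)
    · have hacc := not_of_ite_eq_zero h
      -- Variable 0 contains n, which is also the code of the sink.
      refine wp_mono (wp_addEdge (e := (some v, none)) hR₁ (length_es_le hS.nodup) (by simp [hs₁, vertexCode])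
        (by simpa [vertexCode] using hE₁.v0)) ?_
      rintro s₂ t₂ ⟨ht₂, hR₂⟩ -
      refine ⟨by simp only [Expr.cost]; omega, es' ++ [(some v, none)], ⟨?_, fun e => ?_⟩,
        by simp; omega, hR₂⟩
      · rw [List.map_append, List.nodup_append]
        refine ⟨hS.nodup, by simp, ?_⟩
        rintro e he b hb rfl
        simp only [List.map_cons, List.map_nil, List.mem_singleton] at hb
        subst hb
        rcases (hS.mem _).1 he with h₁ | ⟨w, hw, -, -, h₁⟩
        · rcases (hC.mem_es _).1 h₁ with ⟨a, -, -, h₂⟩ | ⟨a, u, -, h₂⟩ <;> simp at h₂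
        · have hwv : v = w := by simpa using h₁
          have := hC.vs_nodup.sublist (List.take_sublist (j + 1) _)
          rw [htake, List.nodup_append] at this
          exact this.2.2 _ hw vs[j] (by simp) (by rw [hv, hwv])
      · rw [List.map_append, List.mem_append, hS.mem, htake, or_assoc]
        refine or_congr_right ?_
        simp only [List.map_cons, List.map_nil, List.mem_singleton, List.mem_append, hv,
          Option.some.injEq]
        constructor
        · rintro (⟨w, h₁, h₂⟩ | rfl)
          · exact ⟨w, Or.inl h₁, h₂⟩
          · exact ⟨v, Or.inr rfl, hvx, hacc, rfl⟩
        · rintro ⟨w, h₁ | rfl, h₂⟩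
          · exact Or.inl ⟨w, h₁, h₂⟩
          · exact Or.inr h₂.2.2
  · have h' := not_of_ite_eq_zero h
    refine wp_skip ⟨by simp only [Expr.cost]; omega, es', hstay ?_, by omega, hR⟩
    intro w hw
    have : j = 0 ∨ j = 1 := by omega
    rcases this with rfl | rfl
    · simp [hl] at hw
    · simp [hl] at hw; exact Or.inl hw.symm

end Inst

end VertexConn

/-! ### Output, and the answer for a single vertex -/

namespace VertexConn

open WordRam

namespace Alg

/-- Output the first entries of the array `a`, as many as the variable `m` says. -/
def outList (a m : ℕ) : Prog := forVar 41 m (.out (.get a (.var 41)))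

/-- Output the edges. -/
def outEdges : Prog := forVar 41 39 (.out (.get 13 (.var 41)) ;; .out (.get 14 (.var 41)))

/-- Output the kernel. -/
def output : Prog :=
  .out (.lit 1) ;; .out (.var 38) ;; outList 12 38 ;; .out (.var 39) ;; outEdges ;;
    .out (.var 40) ;; outList 15 40

/-- Compute and output the kernel from the list of vertices to be examined. -/
def kernel : Prog :=
  .put 12 (.lit 0) (.var 0) ;; .put 12 (.lit 1) (.var 22) ;; .set 38 (.lit 2) ;;
  .put 8 (pr (.var 21) (.var 22)) (.lit 1) ;; .set 39 (.lit 0) ;; .set 40 (.lit 0) ;;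
  forVar 30 29 examine ;; forVar 41 38 sinkStep ;; output

/-- Answer for the vertex at the position in variable `21` of the list `X`. -/
def round : Prog :=
  .set 22 (.get 3 (.var 21)) ;;
  .set 43 (degE 22) ;;
  .ite (.bin .lt (.var 11) (.var 43)) (.out (.lit 0))
    (gather ;;
      .ite (.bin .add (.bin .lt (.var 27) (.var 8))
          (.bin .lt (.var 10) (.bin .add (.bin .add (.var 28) (.get 2 (.var 22))) (.lit 1))))
        (.out (.lit 0)) kernel)

end Alg

namespace Inst

variable {I : Inst} {ω : ℕ → Fin I.W}

lemma wp_outList {a m : ℕ} {l : List ℕ} {s : State} (hl : Holds (s.arr a) l)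
    (hm : s.var m = l.length) (hm' : 41 ≠ m) (hW : l.length < I.W) :
    wp ω (Alg.outList a m) s fun s' t => s'.out = s.out ++ l ∧ t ≤ 6 + 11 * l.length := by
  refine wp_forVar (fun j s' t => s'.out = s.out ++ l.take j ∧ t ≤ 2 + 11 * j) (by simp [Prog.wv])
    (by simp [Prog.wv]) hm' hm hW I.one_lt_W ?_ ?_ ?_
  · simp
  · rintro j s' t hj h41 hs ⟨ho, ht⟩
    refine wp_out (a := l[j]) (eval_get (eval_var h41) ?_) ⟨?_, by simp only [Expr.cost]; omega⟩
    · rw [hs.arr a (by simp [Prog.wa])]; exact hl j hj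
    · rw [State.setv_out, State.emit_out, ho, List.take_add_one, List.getElem?_eq_getElem hj]
      simp
  · rintro s' t h41 hs ⟨ho, ht⟩
    exact ⟨by rw [ho, List.take_length], by omega⟩

lemma wp_outEdges {es : List (Option (Fin I.n) × Option (Fin I.n))} {s : State}
    (h13 : Holds (s.arr 13) (es.map fun e => vertexCode e.1))
    (h14 : Holds (s.arr 14) (es.map fun e => vertexCode e.2))
    (h39 : s.var 39 = es.length) (hW : es.length < I.W) :
    wp ω Alg.outEdges s fun s' t =>
      s'.out = s.out ++ (es.flatMap fun e => [vertexCode e.1, vertexCode e.2]) ∧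
        t ≤ 6 + 14 * es.length := by
  refine wp_forVar (fun j s' t => s'.out = s.out ++
    ((es.take j).flatMap fun e => [vertexCode e.1, vertexCode e.2]) ∧ t ≤ 2 + 14 * j)
    (by decide) (by decide) (by decide) h39 hW I.one_lt_W ?_ ?_ ?_
  · simp
  · rintro j s' t hj h41 hs ⟨ho, ht⟩
    refine wp_seq (wp_out (a := vertexCode es[j].1) (eval_get (eval_var h41) ?_)
      (wp_out (a := vertexCode es[j].2) (eval_get (eval_var h41) ?_)
        ⟨?_, by simp only [Expr.cost]; omega⟩))
    · rw [hs.arr 13 (by decide)]; exact h13.get (by simp [hj])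
    · rw [State.emit_arr, hs.arr 14 (by decide)]; exact h14.get (by simp [hj])
    · have htake : es.take (j + 1) = es.take j ++ [es[j]] := by
        rw [List.take_add_one, List.getElem?_eq_getElem hj]; rfl
      rw [State.setv_out, State.emit_out, State.emit_out, ho, htake, List.flatMap_append]
      simp only [List.flatMap_cons, List.flatMap_nil, List.append_assoc, List.cons_append,
        List.nil_append, List.append_nil]
  · rintro s' t h41 hs ⟨ho, ht⟩
    exact ⟨by rw [ho, List.take_length], by omega⟩

lemma wp_output {i : ℕ} {acc zs : List (Fin I.n)} {vs : List (Option (Fin I.n))}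
    {es : List (Option (Fin I.n) × Option (Fin I.n))} {s : State} (hR : Rep I i acc vs es zs s)
    (hvs : vs.length < I.W) (hes : es.length < I.W) (hzs : zs.length < I.W) :
    wp ω Alg.output s fun s' t => s'.out = s.out ++ kernelWords vs es zs ∧
      t ≤ 30 + 11 * vs.length + 14 * es.length + 11 * zs.length := by
  refine wp_seq (wp_out (eval_lit I.one_lt_W) ?_)
  refine wp_seq (wp_out (a := vs.length) (eval_var (by simpa using hR.v38)) ?_)
  refine wp_seq (wp_mono (wp_outList (l := vs.map vertexCode) (by simpa using hR.a12)
    (by simpa using hR.v38) (by decide) (by simpa using hvs)) ?_)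
  rintro s₁ t₁ ⟨ho₁, ht₁⟩ hs₁
  refine wp_seq (wp_out (a := es.length) (eval_var (by
    rw [hs₁.var 39 (by decide)]; simpa using hR.v39)) ?_)
  refine wp_seq (wp_mono (wp_outEdges (es := es)
    (by rw [State.emit_arr, hs₁.arr 13 (by decide)]; simpa using hR.a13)
    (by rw [State.emit_arr, hs₁.arr 14 (by decide)]; simpa using hR.a14)
    (by rw [State.emit_var, hs₁.var 39 (by decide)]; simpa using hR.v39) hes) ?_)
  rintro s₂ t₂ ⟨ho₂, ht₂⟩ hs₂
  have v40 : s₂.var 40 = zs.length := by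
    rw [hs₂.var 40 (by decide), State.emit_var, hs₁.var 40 (by decide)]; simpa using hR.v40
  refine wp_seq (wp_out (a := zs.length) (eval_var v40) ?_)
  refine wp_mono (wp_outList (l := codes zs) ?_ (by simpa using v40) (by decide)
    (by simpa using hzs)) ?_
  · rw [State.emit_arr, hs₂.arr 15 (by decide), State.emit_arr, hs₁.arr 15 (by decide)]
    simpa using hR.a15
  · rintro s₃ t₃ ⟨ho₃, ht₃⟩ -
    refine ⟨?_, ?_⟩
    · rw [ho₃, State.emit_out, ho₂, State.emit_out, ho₁]
      simp [kernelWords, codes]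
    · simp only [List.length_map] at ht₁ ht₃
      simp only [Expr.cost]
      omega

/-- The number of terminals, by their position relative to `x`. -/
lemma countP_terminals (x : Fin I.n) : open Classical in
    (List.finRange I.n).countP (fun v => decide (v ∈ I.T)) =
      (I.A x).countP (fun v => decide (v ∈ I.T)) + (if x ∈ I.T then 1 else 0) +
        (Finset.univ.filter fun v => v ∈ farTerminals I.G I.T x).card := by
  classical
  have h₁ : ∀ l : List (Fin I.n), l.Nodup → l.countP (fun v => decide (v ∈ I.T)) =
      (l.toFinset.filter fun v => v ∈ I.T).card := by
    intro l hl
    rw [List.countP_eq_length_filter, ← List.toFinset_card_of_nodup (hl.filter _),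
      List.toFinset_filter]
    simp
  rw [h₁ _ (List.nodup_finRange _), h₁ _ (I.hA x).1]
  change _ = ((I.N x).filter fun v => v ∈ I.T).card + _ + _
  have h₂ : ((List.finRange I.n).toFinset.filter fun v => v ∈ I.T)
      = ((I.N x).filter fun v => v ∈ I.T) ∪ (if x ∈ I.T then {x} else ∅) ∪
        (Finset.univ.filter fun v => v ∈ farTerminals I.G I.T x) := by
    ext v
    by_cases hx : x ∈ I.T
    · simp only [hx, if_true, Finset.mem_filter, List.mem_toFinset, List.mem_finRange, true_and,
        Finset.mem_union, mem_N, Finset.mem_singleton, Finset.mem_univ, mem_farTerminals]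
      constructor
      · tauto
      · rintro ((h | rfl) | h) <;> tauto
    · simp only [hx, if_false, Finset.mem_filter, List.mem_toFinset, List.mem_finRange, true_and,
        Finset.mem_union, mem_N, Finset.notMem_empty, Finset.mem_univ, mem_farTerminals]
      constructor
      · intro h
        have : v ≠ x := by rintro rfl; exact hx h
        tauto
      · tauto
  rw [h₂, Finset.card_union_of_disjoint, Finset.card_union_of_disjoint]
  · congr 2
    split_ifs <;> simp
  · split_ifs
    · rw [Finset.disjoint_singleton_right]; simp
    · simp
  · rw [Finset.disjoint_left]
    intro v hv hv'
    simp only [Finset.mem_filter, Finset.mem_univ, true_and, mem_farTerminals] at hv'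
    rcases Finset.mem_union.1 hv with h | h
    · simp only [Finset.mem_filter, mem_N] at h; exact hv'.2.2 h.1
    · split_ifs at h
      · exact hv'.2.1 (Finset.mem_singleton.1 h)
      · simp at h

lemma wp_kernel {i : ℕ} {x : Fin I.n} {tst : List (Fin I.n)} {s : State} {C : ℝ} (hC5 : 5000 ≤ C)
    (hE : I.Env s) (hi : i < I.n) (hx : (I.N x).card ≤ I.k + 2 * I.ℓ)
    (h21 : s.var 21 = i) (h22 : s.var 22 = x) (h29 : s.var 29 = tst.length)
    (htst : Holds (s.arr 9) (codes tst)) (hnd : tst.Nodup) (hxt : x ∉ tst)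
    (hNt : ∀ v, I.G.Adj x v → v ∈ tst) (hlen : tst.length ≤ 18 * I.k)
    (hcand : I.Good → ∀ w, w ≠ x → ¬ I.G.Adj x w → ¬ I.Bad x w → w ∈ tst)
    (hB : (farTerminals I.G I.T x).Nonempty)
    (h7 : ∀ i', i ≤ i' → ∀ w : Fin I.n, s.arr 7 (I.pair i' w) = 0)
    (h8 : ∀ i', i ≤ i' → ∀ w : Fin I.n, s.arr 8 (I.pair i' w) = 0) :
    wp ω Alg.kernel s fun s' t => t ≤ 200 + tst.length * (300 * I.NC + 400) ∧
      (∃ ws, s'.out = s.out ++ ws ∧ (I.Good → IsCorrectAnswer C I.G I.k I.ℓ I.T x ws)) ∧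
      I.Fresh (s'.arr 7) i ∧ I.Fresh (s'.arr 8) i := by
  classical
  have hW := I.one_lt_W
  have hBB := I.two_B_le
  have hB' := I.B_ge
  have hn3 := I.n_cube_ge
  have hn2 := I.n_sq_ge
  have hn := I.hn
  have htn : tst.length ≤ I.n := length_le_of_nodup hnd
  refine wp_seq (wp_put (eval_lit (by omega)) (eval_var hE.v0) ?_)
  refine wp_seq (wp_put (eval_lit hW) (eval_var (by simpa using h22)) ?_)
  refine wp_seq (wp_set (eval_lit (by omega)) ?_)
  refine wp_seq (wp_put (j := I.pair i x) (eval_pr (by simpa using hE.v4)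
    (eval_var (by simpa using h21))
    (eval_var (by simpa using h22)) (by omega) (I.fin_lt_B x)) (eval_lit hW) ?_)
  refine wp_seq (wp_set (eval_lit (by omega)) ?_)
  refine wp_seq (wp_set (eval_lit (by omega)) ?_)
  set s₁ := (((((s.seta 12 0 I.n).seta 12 1 x).setv 38 2).seta 8 (I.pair i x) 1).setv 39 0).setv 40 0
    with hs₁
  have hE₁ : I.Env s₁ := (((((hE.seta (by omega)).seta (by omega)).setv (by omega)).seta
    (by omega)).setv (by omega)).setv (by omega)
  have hX₁ : Examined I i x [] s₁ := by
    refine ⟨[], ∅, [none, some x], [], [], collected_init x, ?_, by simp, [], rfl⟩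
    refine ⟨fun v => ?_, fun v => ?_, fun i' hi' w => ?_, ?_, ?_, by simp [hs₁], Holds.nil _,
      Holds.nil _, by simp [hs₁], Holds.nil _, by simp [hs₁]⟩
    · simpa [hs₁] using h7 i le_rfl v
    · simp only [hs₁, State.setv_arr, State.seta_arr]
      rw [if_pos trivial, if_neg (by decide), if_neg (by decide), update_pair, h8 i le_rfl v]
      simp
    · simpa [hs₁] using h7 i' hi'.le w
    · have : I.Fresh (s.arr 8) i := fun i' hi' w => h8 i' hi'.le w
      simpa [hs₁] using this.update x 1
    · have := ((Holds.nil (s.arr 12)).append (j := 0) rfl I.n).append (j := 1) rfl x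
      simpa [hs₁, vertexCode] using this
  refine wp_seq (wp_forVar (N := tst.length)
    (fun j s' t => t ≤ 2 + j * (168 * I.NC + 208) ∧ Examined I i x (tst.take j) s')
    (by decide) (by decide) (by decide) (by simpa [hs₁] using h29) (by omega) hW ?_ ?_ ?_)
  · refine ⟨by simp, ?_⟩
    obtain ⟨acc, arcs, vs, es, zs, h₁, h₂, h₃⟩ := hX₁
    exact ⟨acc, arcs, vs, es, zs, by simpa using h₁, h₂.setv (by decide), h₃⟩
  · rintro j s' t hj h30 hs ⟨ht, hX⟩
    have htake : tst.take (j + 1) = tst.take j ++ [tst[j]] := by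
      rw [List.take_add_one, List.getElem?_eq_getElem hj]; rfl
    refine wp_mono (wp_examine (v := tst[j]) (j := j) (tst := tst) hX
      (hE₁.same hs (by decide) (by decide)) hi hx ?_ ?_ ?_ ?_ ?_ ?_ h30) ?_
    · have := hnd.sublist (List.take_sublist (j + 1) _)
      rw [htake, List.nodup_append] at this
      exact fun h => this.2.2 _ h _ (by simp) rfl
    · intro h; exact hxt (h ▸ List.getElem_mem hj)
    · exact List.getElem?_eq_getElem hj
    · rw [hs.arr 9 (by decide)]; simpa [hs₁] using htst
    · rw [hs.var 21 (by decide)]; simpa [hs₁] using h21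
    · rw [hs.var 22 (by decide)]; simpa [hs₁] using h22
    · rintro s'' t'' ⟨ht'', acc, arcs, vs, es, zs, h₁, h₂, h₃⟩ -
      refine ⟨by rw [add_mul, one_mul]; omega, acc, arcs, vs, es, zs, ?_, h₂.setv (by decide), h₃⟩
      rw [htake]; exact h₁
  rintro s₂ t₂ - hs₂ ⟨ht₂, hX⟩
  rw [List.take_length] at hX
  have hE₂ : I.Env s₂ := hE₁.same hs₂ (by decide) (by decide)
  obtain ⟨acc, arcs, vs, es, zs, hCol, hR, hcomplete, hl⟩ := hX
  have v21 : s₂.var 21 = i := by rw [hs₂.var 21 (by decide)]; simpa [hs₁] using h21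
  have o₂ : s₂.out = s.out := by rw [hs₂.out (by decide)]; simp [hs₁]
  have hvsn := length_vs_le hCol.vs_nodup
  -- Only the cutoff of the traversal is used here, because the number of steps must be bounded for
  -- every T.
  have hM : ∀ a ∈ acc, (I.F x a).card ≤ I.NC := fun a ha => (hCol.acc_ok a ha).2
  have haccl : acc.length ≤ tst.length :=
    List.Subperm.length_le (hCol.acc_nodup.subperm fun v hv => hCol.acc_sub v hv)
  have hzl : zs.length ≤ tst.length :=
    List.Subperm.length_le (hCol.zs_nodup.subperm fun v hv => ((hCol.mem_zs v).1 hv).1)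
  have hvsl : vs.length ≤ 2 + tst.length * (I.NC + 1) :=
    (hCol.length_vs_le hM).trans (Nat.add_le_add_left (Nat.mul_le_mul_right _ haccl) 2)
  have hesl : es.length ≤ tst.length * (I.NC + 1) :=
    (hCol.length_es_le hM).trans (Nat.mul_le_mul_right _ haccl)
  have hv2 : 2 ≤ vs.length := by obtain ⟨l, rfl⟩ := hl; simp
  refine wp_seq (wp_forVar (N := vs.length)
    (fun j s' t => t ≤ 2 + 58 * j ∧ ∃ es', Sunk I x acc (vs.take j) es es' ∧
      es'.length ≤ es.length + (j - 2) ∧ Rep I i acc vs es' zs s')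
    (by decide) (by decide) (by decide) hR.v38 (by omega) hW ?_ ?_ ?_)
  · exact ⟨le_rfl, es, ⟨hCol.es_nodup, by simp⟩, by simp, hR.setv (by decide)⟩
  · rintro j s' t hj h41 hs ⟨ht, es', hS, hle, hR'⟩
    refine wp_mono (wp_sinkStep hCol hl hR' hS hle (hE₂.same hs (by decide) (by decide)) hi hj
      (by rw [hs.var 21 (by decide), v21]) h41) ?_
    rintro s'' t'' ⟨ht'', es'', hS'', hle'', hR''⟩ -
    exact ⟨by omega, es'', hS'', hle'', hR''.setv (by decide)⟩
  rintro s₃ t₃ - hs₃ ⟨ht₃, es', hS, hle, hR₃⟩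
  rw [List.take_length] at hS
  have o₃ : s₃.out = s.out := by rw [hs₃.out (by decide), o₂]
  have hnn : (I.n + 1) * (I.n + 1) = I.n * I.n + 2 * I.n + 1 := by ring
  have hesn := length_es_le hS.nodup
  refine wp_mono (wp_output hR₃ (by omega) (by omega) (by omega)) ?_
  rintro s₄ t₄ ⟨ho, ht₄⟩ hs₄
  refine ⟨?_, ⟨_, by rw [ho, o₃], fun hG => ?_⟩, ?_, ?_⟩
  · simp only [Expr.cost]
    rw [Nat.mul_add, Nat.mul_one] at hvsl hesl
    have e₁ : tst.length * (168 * I.NC + 208) = 168 * (tst.length * I.NC) + 208 * tst.length := by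
      ring
    have e₂ : tst.length * (300 * I.NC + 400) = 300 * (tst.length * I.NC) + 400 * tst.length := by
      ring
    rw [e₁] at ht₂
    rw [e₂]
    omega
  · exact hCol.isCorrectAnswer hG hC5 hB hNt (hcand hG) hlen hcomplete hS.nodup (by omega) hS.mem
  · rw [hs₄.arr 7 (by decide)]; exact hR₃.fresh7
  · rw [hs₄.arr 8 (by decide)]; exact hR₃.fresh8

variable (I) in
/-- A bound on the number of steps of a round. -/
def roundCost : ℕ := 4000000 * (I.k * I.ℓ * I.h * I.h)

lemma wp_round {i : ℕ} {s : State} {C : ℝ} (hC5 : 5000 ≤ C)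
    (hE : I.Env s) (hi : i < I.X.length) (h21 : s.var 21 = i)
    (h6 : ∀ i', i ≤ i' → ∀ w : Fin I.n, s.arr 6 (I.pair i' w) = 0)
    (h7 : ∀ i', i ≤ i' → ∀ w : Fin I.n, s.arr 7 (I.pair i' w) = 0)
    (h8 : ∀ i', i ≤ i' → ∀ w : Fin I.n, s.arr 8 (I.pair i' w) = 0) :
    wp ω Alg.round s fun s' t => t ≤ I.roundCost ∧
      (∃ ws, s'.out = s.out ++ ws ∧ (I.Good → IsCorrectAnswer C I.G I.k I.ℓ I.T I.X[i] ws)) ∧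
      I.Fresh (s'.arr 6) i ∧ I.Fresh (s'.arr 7) i ∧ I.Fresh (s'.arr 8) i := by
  classical
  have hW := I.one_lt_W
  have hBB := I.two_B_le
  have hB' := I.B_ge
  have hn3 := I.n_cube_ge
  have hn2 := I.n_sq_ge
  have hn := I.hn
  have hℓ := I.hℓ
  have hk := I.hk
  have hin : i < I.n := hi.trans_le (length_le_of_nodup I.hX)
  have hf6 : I.Fresh (s.arr 6) i := fun i' hi' w => h6 i' hi'.le w
  have hf7 : I.Fresh (s.arr 7) i := fun i' hi' w => h7 i' hi'.le w
  have hf8 : I.Fresh (s.arr 8) i := fun i' hi' w => h8 i' hi'.le w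
  have hh := I.one_le_h
  set Y := I.k * I.ℓ * I.h * I.h with hY
  have hkY : I.k * (I.ℓ * I.h) ≤ Y := by
    rw [hY, ← mul_assoc]; exact Nat.le_mul_of_pos_right _ hh
  have hkY' : I.k ≤ I.k * (I.ℓ * I.h) := Nat.le_mul_of_pos_right _ (Nat.mul_pos hℓ hh)
  have hℓY : I.ℓ * I.h ≤ I.k * (I.ℓ * I.h) := Nat.le_mul_of_pos_left _ (by omega)
  set x := I.X[i] with hx
  refine wp_seq (wp_set (a := (x : ℕ)) (eval_get (eval_var h21) (hE.xs i hi)) ?_)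
  have hE₁ : I.Env (s.setv 22 x) := hE.setv (by omega)
  refine wp_seq (wp_set (a := (I.A x).length) (hE₁.eval_deg (v := x) (by simp)) ?_)
  set s₁ := (s.setv 22 x).setv 43 (I.A x).length with hs₁
  have hE₂ : I.Env s₁ := hE₁.setv (by omega)
  refine wp_ite (eval_lt (eval_var hE₂.v11) (eval_var (x := 43) (a := (I.A x).length)
    (by simp [hs₁])) hW) (fun h => ?_) (fun h => ?_)
  · have h' := of_ite_ne_zero h
    refine wp_out (a := 0) (eval_lit (by omega)) ⟨?_, ⟨[0], rfl, fun _ => ?_⟩, hf6, hf7, hf8⟩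
    · simp only [Expr.cost, roundCost]; omega
    · refine Or.inr ⟨rfl, Or.inr fun hsc => ?_⟩
      have := (low_of_scratch hsc).1
      omega
  have hdeg : (I.A x).length ≤ I.k + 2 * I.ℓ := not_lt.1 (not_of_ite_eq_zero h)
  refine wp_seq (wp_mono (wp_gather (x := x) hin hE₂ (by simp [hs₁, h21]) (by simp [hs₁])
    (by simp [hs₁]) (by simpa [hs₁] using h6)) ?_)
  rintro s₂ t₂ ⟨lows, tst, hG⟩ hs₂
  have hE₃ : I.Env s₂ := hE₂.same hs₂ (by decide) (by decide)
  have v21 : s₂.var 21 = i := by rw [hs₂.var 21 (by decide)]; simp [hs₁, h21]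
  have v22 : s₂.var 22 = x := by rw [hs₂.var 22 (by decide)]; simp [hs₁]
  have a7 : s₂.arr 7 = s.arr 7 := by rw [hs₂.arr 7 (by decide)]; simp [hs₁]
  have a8 : s₂.arr 8 = s.arr 8 := by rw [hs₂.arr 8 (by decide)]; simp [hs₁]
  have o₂ : s₂.out = s.out := by rw [hs₂.out (by decide)]; simp [hs₁]
  have hv28 := hG.v28
  have hall := hG.all
  have hcand := hG.cand
  have hsub := hG.sub
  rw [List.take_length] at hv28 hall hcand
  have htime := hG.time
  have hlows := hG.length_le
  have hT1 : (if x ∈ I.T then 1 else 0 : ℕ) ≤ 1 := by split_ifs <;> omega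
  have hcp : (I.A x).countP (fun v => decide (v ∈ I.T)) ≤ I.n :=
    List.countP_le_length.trans (I.length_A_le x)
  have hbnd : t₂ ≤ 12 + 80 * (I.k + 2 * I.ℓ) + 84 * (624 * (I.k * (I.ℓ * I.h)) + 20 * (I.ℓ * I.h)) := by
    have := Nat.mul_le_mul_right (624 * I.k + 20) hlows
    have e : 84 * I.ℓ * I.h * (624 * I.k + 20)
        = 84 * (624 * (I.k * (I.ℓ * I.h)) + 20 * (I.ℓ * I.h)) := by ring
    omega
  refine wp_ite (eval_add (eval_lt (eval_var hG.v27) (eval_var hE₃.v8) hW)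
    (eval_lt (eval_var hE₃.v10) (eval_add (eval_add (eval_var hv28) (hE₃.eval_ter v22)
      (by omega)) (eval_lit hW) (by omega)) hW) (by split_ifs <;> omega))
    (fun h => ?_) (fun h => ?_)
  · refine wp_out (a := 0) (eval_lit (by omega)) ⟨?_, ⟨[0], by rw [State.emit_out, o₂],
      fun _ => ?_⟩, hcand.fresh, by rw [State.emit_arr, a7]; exact hf7,
      by rw [State.emit_arr, a8]; exact hf8⟩
    · simp only [Expr.cost, roundCost]; omega
    · refine Or.inr ⟨rfl, ?_⟩
      -- As long as the quota of 84ℓh is not filled, all neighbours of low degree are listed. A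
      -- short list thus contradicts the number that a suitable scratch provides.
      by_cases hlow : lows.length < 84 * I.ℓ * I.h
      · refine Or.inr fun hsc => ?_
        have h₁ := (low_of_scratch hsc).2
        have h₂ : ((I.N x).filter fun u => (I.A u).length ≤ 8 * I.k).card ≤ lows.length := by
          refine le_trans (Finset.card_le_card fun u hu => ?_) (List.toFinset_card_le lows)
          rw [Finset.mem_filter, mem_N] at hu
          exact List.mem_toFinset.2 (hall hlow u (mem_A.2 hu.1) hu.2)
        omega
      -- The second test says that T has no more elements than T ∩ N[x], so no terminal is far from
      -- `x`.
      · left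
        rw [if_neg hlow, zero_add] at h
        have h' := of_ite_ne_zero h
        have hct := I.countP_terminals x
        have h0 : (Finset.univ.filter fun v => v ∈ farTerminals I.G I.T x).card = 0 := by omega
        rw [Finset.card_eq_zero, Finset.filter_eq_empty_iff] at h0
        exact Set.eq_empty_iff_forall_notMem.2 fun v => h0 (Finset.mem_univ v)
  · have hlow : 84 * I.ℓ * I.h ≤ lows.length := by
      by_contra hlt
      rw [if_pos (by omega)] at h
      omega
    have hB : (farTerminals I.G I.T x).Nonempty := by
      by_contra hem
      rw [Set.not_nonempty_iff_eq_empty] at hem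
      have hct := I.countP_terminals x
      simp only [hem, Set.mem_empty_iff_false, Finset.filter_false, Finset.card_empty] at hct
      rw [if_pos (c := _ < _ + 1) (by omega)] at h
      omega
    have hcard : (I.N x).card ≤ I.k + 2 * I.ℓ := by rw [card_N]; exact hdeg
    have hxt : x ∉ tst := by
      rw [hcand.mem]
      rintro (h | h)
      · exact I.G.irrefl (mem_A.1 h)
      · exact h.1 rfl
    have hvis : (lows.flatMap I.A).length ≤ 84 * I.ℓ * I.h * (8 * I.k) :=
      (length_flatMap_le fun u hu => (hsub u hu).2).trans (Nat.mul_le_mul_right _ hlows)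
    -- The candidates number at most 84ℓh · 8k / (42ℓh) = 16k, and deg(x) ≤ k + 2ℓ ≤ 2k.
    have hlen : tst.length ≤ 18 * I.k := by
      set cs := tst.filter fun v => v ∉ I.A x with hcs
      have h₁ : cs.length * (42 * I.ℓ * I.h) ≤ (lows.flatMap I.A).length := by
        refine length_mul_le_of_le_count (hcand.nodup.filter _) fun w hw => ?_
        rw [List.mem_filter, decide_eq_true_eq, hcand.mem] at hw
        exact (hw.1.resolve_left hw.2).2.2
      have h₂ : cs.length ≤ 16 * I.k := by
        have hpos : 0 < 42 * I.ℓ * I.h := Nat.mul_pos (Nat.mul_pos (by omega) hℓ) hh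
        refine Nat.le_of_mul_le_mul_right ?_ hpos
        calc cs.length * (42 * I.ℓ * I.h) ≤ 84 * I.ℓ * I.h * (8 * I.k) := h₁.trans hvis
          _ = 16 * I.k * (42 * I.ℓ * I.h) := by ring
      have h₃ : tst.length ≤ (I.A x).length + cs.length := by
        rw [← List.length_append]
        refine List.Subperm.length_le (hcand.nodup.subperm fun v hv => ?_)
        rw [List.mem_append, hcs, List.mem_filter, decide_eq_true_eq]
        tauto
      omega
    refine wp_mono (wp_kernel hC5 hE₃ hin hcard v21 v22 hcand.v29 hcand.list hcand.nodup hxt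
      (fun v hv => (hcand.mem v).2 (Or.inl (mem_A.2 hv))) hlen ?_ hB
      (by rw [a7]; exact h7) (by rw [a8]; exact h8)) ?_
    · intro hGood w hwx hxw hbad
      rw [hcand.mem]
      exact Or.inr ⟨hwx, hxw, hGood.le_count hcard hG.nodup
        (fun u hu => mem_A.1 (List.mem_of_mem_take (hsub u hu).1)) hlow hbad⟩
    · rintro s₃ t₃ ⟨ht₃, ⟨ws, ho, hws⟩, hfr7, hfr8⟩ hs₃
      refine ⟨?_, ⟨ws, by rw [ho, o₂], hws⟩, ?_, hfr7, hfr8⟩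
      · have h₁ := Nat.mul_le_mul_right (300 * I.NC + 400) hlen
        have e : 18 * I.k * (300 * I.NC + 400) = 18 * (300 * (400 * Y) + 400 * I.k) := by
          rw [hY, NC]; ring
        simp only [Expr.cost, roundCost]
        omega
      · rw [hs₃.arr 6 (by decide)]; exact hcand.fresh

end Inst

end VertexConn

namespace VertexConn

open WordRam

/-! ### Preprocessing -/

namespace Alg

/-- Compute the constants. -/
def setup : Prog :=
  .set 4 (.bin .mul (.bin .mul (.bin .mul (.var 0) (.var 0)) (.var 0)) (.var 0)) ;;
  .set 5 (.lit 1) ;; .set 6 (.lit 0) ;;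
  forVar 13 0 (.ite (.bin .lt (.var 0) (.var 5)) .skip
    (.set 5 (.bin .add (.var 5) (.var 5)) ;; .set 6 (.bin .add (.var 6) (.lit 1)))) ;;
  .set 7 (.bin .mul (.bin .mul (.bin .mul (.lit 400) (.var 2)) (.var 6)) (.var 6)) ;;
  .set 8 (.bin .mul (.bin .mul (.lit 84) (.var 2)) (.var 6)) ;;
  .set 9 (.bin .mul (.bin .mul (.lit 42) (.var 2)) (.var 6)) ;;
  .set 11 (.bin .add (.var 1) (.bin .mul (.lit 2) (.var 2))) ;;
  .set 12 (.bin .mul (.lit 8) (.var 1)) ;;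
  .set 10 (.lit 0) ;;
  forVar 13 0 (.set 10 (.bin .add (.var 10) (.get 2 (.var 13))))

/-- Update the parent of the node in variable `17` of the trie of the vertex in variable `14`. Array
`5` maps the pairs of names of children to the names of nodes, and variable `19` is the largest name
in use. -/
def parentStep : Prog :=
  .set 17 (.bin .div (.var 17) (.lit 2)) ;;
  .set 20 (pr (idE 14 (.bin .add (.var 17) (.var 17)))
    (idE 14 (.bin .add (.bin .add (.var 17) (.var 17)) (.lit 1)))) ;;
  .ite (.get 5 (.var 20)) .skip
    (.set 19 (.bin .add (.var 19) (.lit 1)) ;; .put 5 (.var 20) (.var 19)) ;;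
  .put 4 (pr (.var 14) (.var 17)) (.get 5 (.var 20))

/-- Insert the neighbour at the position in variable `15` into the trie of the vertex in variable
`14`. -/
def insertStep : Prog :=
  .set 16 (nbrE 14 15) ;;
  .set 17 (.bin .add (.var 5) (.var 16)) ;;
  .put 4 (pr (.var 14) (.var 17)) (.lit 1) ;;
  forVar 13 6 parentStep

/-- Build the tries. -/
def tries : Prog :=
  .set 19 (.lit 1) ;;
  forVar 14 0 (.set 18 (degE 14) ;; forVar 15 18 insertStep)

end Alg

namespace Inst

variable {I : Inst} {ω : ℕ → Fin I.W}

variable (I) in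
/-- The invariant of the construction of the tries: `g` holds the names of the nodes and `D` maps
the pairs of names of children to the names of nodes, `m` is the largest name in use, `S v u` says
that the leaf `u` of the trie of `v` is present. The node `c₀` of the trie of `v₀` is excepted. -/
structure Build (D g : ℕ → ℕ) (m : ℕ) (S : Fin I.n → ℕ → Prop) (v₀ : Fin I.n) (c₀ : ℕ) :
    Prop where
  zero : D 0 = 0
  le : ∀ a, D a ≤ m
  inj : ∀ a b, D a = D b → D a ≠ 0 → a = b
  pos : 1 ≤ m
  name_le : ∀ a, g a ≤ m
  leaf : ∀ (v : Fin I.n) u, u < 2 ^ I.h →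
    g (I.pair v (2 ^ I.h + u)) = open Classical in if S v u then 1 else 0
  node : ∀ (v : Fin I.n) c, 0 < c → c < 2 ^ I.h → ¬ (v = v₀ ∧ c = c₀) →
    g (I.pair v c) = D (I.pair (g (I.pair v (2 * c))) (g (I.pair v (2 * c + 1)))) ∧
      (g (I.pair v c) = 0 → I.pair (g (I.pair v (2 * c))) (g (I.pair v (2 * c + 1))) = 0)

lemma pair_eq_zero {a b : ℕ} : I.pair a b = 0 ↔ a = 0 ∧ b = 0 := by
  have := I.B_pos
  simp [pair, this.ne']

lemma pair_ne {v v' : Fin I.n} {c c' : ℕ} (hc : c < 2 * 2 ^ I.h) (hc' : c' < 2 * 2 ^ I.h)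
    (h : ¬ (v = v' ∧ c = c')) : I.pair v c ≠ I.pair v' c' := by
  intro h'
  obtain ⟨h₁, h₂⟩ := I.pair_inj (I.node_lt_B hc) (I.node_lt_B hc') h'
  exact h ⟨Fin.ext h₁, h₂⟩

namespace Build

variable {D g : ℕ → ℕ} {m : ℕ} {S : Fin I.n → ℕ → Prop} {v₀ : Fin I.n} {c₀ : ℕ}

lemma empty (v₀ : Fin I.n) : I.Build (fun _ => 0) (fun _ => 0) 1 (fun _ _ => False) v₀ 0 := by
  constructor <;> simp [pair_eq_zero]

/-- The excepted position 0 is not a node, so the excepted vertex is irrelevant and may be changed.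
-/
lemma congr (hB : I.Build D g m S v₀ 0) {S' : Fin I.n → ℕ → Prop} (h : ∀ v u, S v u ↔ S' v u)
    (v₁ : Fin I.n) : I.Build D g m S' v₁ 0 := by
  refine ⟨hB.zero, hB.le, hB.inj, hB.pos, hB.name_le, fun v u hu => ?_, fun v c h₀ hc _ => ?_⟩
  · rw [hB.leaf v u hu]; classical exact if_congr (h v u) rfl rfl
  · exact hB.node v c h₀ hc (by omega)

/-- Setting a leaf makes only the name of its parent out of date; the exception marks this parent.
-/
lemma set_leaf (hB : I.Build D g m S v₀ 0) (v : Fin I.n) {u : ℕ} (hu : u < 2 ^ I.h) :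
    I.Build D (Function.update g (I.pair v (2 ^ I.h + u)) 1) m
      (fun v' u' => S v' u' ∨ v' = v ∧ u' = u) v ((2 ^ I.h + u) / 2) := by
  refine ⟨hB.zero, hB.le, hB.inj, hB.pos, fun a => ?_, fun v' u' hu' => ?_,
    fun v' c h₀ hc hne => ?_⟩
  · rw [Function.update_apply]
    split_ifs
    · exact hB.pos
    · exact hB.name_le a
  · by_cases h : v' = v ∧ u' = u
    · obtain ⟨rfl, rfl⟩ := h; simp
    · rw [Function.update_of_ne (pair_ne (by omega) (by omega) (by
        rintro ⟨h₁, h₂⟩; exact h ⟨h₁, by omega⟩)), hB.leaf v' u' hu']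
      by_cases hS : S v' u' <;> simp [hS, h]
  · have h₁ : ∀ c', c' < 2 * 2 ^ I.h → c' / 2 = c ∨ c' = c →
        Function.update g (I.pair v (2 ^ I.h + u)) 1 (I.pair v' c') = g (I.pair v' c') := by
      intro c' hc' h
      refine Function.update_of_ne (pair_ne hc' (by omega) ?_) _ _
      rintro ⟨rfl, rfl⟩
      rcases h with h | h
      · exact hne ⟨rfl, h.symm⟩
      · omega
    rw [h₁ c (by omega) (by omega), h₁ (2 * c) (by omega) (by omega),
      h₁ (2 * c + 1) (by omega) (by omega)]
    exact hB.node v' c h₀ hc (by omega)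

/-- A fresh name exceeds all names in use, so injectivity on nonzero names survives. -/
lemma intern (hB : I.Build D g m S v₀ c₀) {a : ℕ} (ha : a ≠ 0) (hD : D a = 0) :
    I.Build (Function.update D a (m + 1)) g (m + 1) S v₀ c₀ := by
  refine ⟨?_, fun b => ?_, fun b c h₁ h₂ => ?_, by omega, fun b => (hB.name_le b).trans (by omega),
    hB.leaf, fun v c h₀ hc hne => ?_⟩
  · rw [Function.update_of_ne ha.symm, hB.zero]
  · rw [Function.update_apply]
    have := hB.le b
    split_ifs <;> omega
  · have := hB.le b
    have := hB.le c
    by_cases hb : b = a <;> by_cases hc : c = a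
    · rw [hb, hc]
    · rw [hb, Function.update_self, Function.update_of_ne hc] at h₁; omega
    · rw [hc, Function.update_self, Function.update_of_ne hb] at h₁; omega
    · rw [Function.update_of_ne hb] at h₁ h₂
      rw [Function.update_of_ne hc] at h₁
      exact hB.inj b c h₁ h₂
  · obtain ⟨h₁, h₂⟩ := hB.node v c h₀ hc hne
    refine ⟨?_, h₂⟩
    -- No existing node has `a` as its pair of children: its name would be `D a = 0`, and name 0
    -- forces the pair to be 0.
    rw [Function.update_of_ne, h₁]
    intro h
    rw [h, hD] at h₁
    exact ha (h ▸ h₂ h₁)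

/-- Repairing the excepted node changes its name, so the exception moves to its parent. Its new name
is nonzero, which keeps 0 reserved for empty subtries. -/
lemma set_parent (hB : I.Build D g m S v₀ c₀) (h₀ : 0 < c₀) (h₁ : c₀ < 2 ^ I.h)
    (hD : D (I.pair (g (I.pair v₀ (2 * c₀))) (g (I.pair v₀ (2 * c₀ + 1)))) ≠ 0) :
    I.Build D (Function.update g (I.pair v₀ c₀)
      (D (I.pair (g (I.pair v₀ (2 * c₀))) (g (I.pair v₀ (2 * c₀ + 1)))))) m S v₀ (c₀ / 2) := by
  set a := D (I.pair (g (I.pair v₀ (2 * c₀))) (g (I.pair v₀ (2 * c₀ + 1)))) with ha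
  have hg : ∀ (v : Fin I.n) c', c' < 2 * 2 ^ I.h → ¬ (v = v₀ ∧ c' = c₀) →
      Function.update g (I.pair v₀ c₀) a (I.pair v c') = g (I.pair v c') := fun v c' hc' h =>
    Function.update_of_ne (pair_ne hc' (by omega) h) _ _
  refine ⟨hB.zero, hB.le, hB.inj, hB.pos, fun b => ?_, fun v' u' hu' => ?_,
    fun v' c h₂ hc hne => ?_⟩
  · rw [Function.update_apply]
    split_ifs
    · exact hB.le _
    · exact hB.name_le b
  · rw [hg v' (2 ^ I.h + u') (by omega) (by omega), hB.leaf v' u' hu']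
  · by_cases h : v' = v₀ ∧ c = c₀
    · obtain ⟨rfl, rfl⟩ := h
      rw [Function.update_self, hg _ _ (by omega) (by omega), hg _ _ (by omega) (by omega)]
      exact ⟨ha, fun h => absurd h hD⟩
    · rw [hg _ c (by omega) h, hg _ _ (by omega) (by rintro ⟨h₁, h₂⟩; exact hne ⟨h₁, by omega⟩),
        hg _ _ (by omega) (by rintro ⟨h₁, h₂⟩; exact hne ⟨h₁, by omega⟩)]
      exact hB.node v' c h₂ hc h

/-- Two nodes with the same nonzero name have the same pair of children because `D` is injective
there; two nodes named 0 both have the pair 0. As names are below B, the pair determines the names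
of the children. -/
lemma trieOk (hB : I.Build D g m S v₀ 0) (hm : m < I.B)
    (hS : ∀ v u, S v u ↔ ∃ h : u < I.n, I.G.Adj v ⟨u, h⟩) :
    I.TrieOk fun v c => g (I.pair v c) := by
  refine ⟨fun v x c h₀ hc => ?_, fun v u hu => ?_⟩
  · obtain ⟨h₁, h₂⟩ := hB.node v c h₀ hc (by omega)
    obtain ⟨h₃, h₄⟩ := hB.node x c h₀ hc (by omega)
    have hlt : ∀ a, g a < I.B := fun a => (hB.name_le a).trans_lt hm
    refine ⟨fun h => ?_, fun ⟨h, h'⟩ => ?_⟩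
    · refine I.pair_inj (hlt _) (hlt _) ?_
      by_cases hz : g (I.pair v c) = 0
      · rw [h₂ hz, h₄ (h ▸ hz)]
      · exact hB.inj _ _ (by rw [← h₁, ← h₃, h]) (h₁ ▸ hz)
    · rw [h₁, h₃, h, h']
  · rw [hB.leaf v u hu]; classical exact if_congr (hS v u) rfl rfl

end Build

variable (I) in
/-- The leaf `u` of the trie of `v` belongs to one of the first `j` entries of the adjacency list of
the vertex `i` or to the list of a vertex before `i`. -/
def Slot (i j : ℕ) (v : Fin I.n) (u : ℕ) : Prop :=
  ∃ r, ∃ h : r < (I.A v).length, ((I.A v)[r] : ℕ) = u ∧ ((v : ℕ) < i ∨ (v : ℕ) = i ∧ r < j)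

lemma slot_zero (v : Fin I.n) (u : ℕ) : ¬ I.Slot 0 0 v u := by
  rintro ⟨r, h, -, h'⟩; omega

lemma slot_succ {i : Fin I.n} {j : ℕ} (hj : j < (I.A i).length) (v : Fin I.n) (u : ℕ) :
    I.Slot i (j + 1) v u ↔ I.Slot i j v u ∨ v = i ∧ u = (I.A i)[j] := by
  constructor
  · rintro ⟨r, h, hu, h'⟩
    by_cases hr : v = i ∧ r = j
    · obtain ⟨rfl, rfl⟩ := hr; exact Or.inr ⟨rfl, hu.symm⟩
    · refine Or.inl ⟨r, h, hu, ?_⟩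
      rw [Fin.ext_iff] at hr; omega
  · rintro (⟨r, h, hu, h'⟩ | ⟨rfl, rfl⟩)
    · exact ⟨r, h, hu, by omega⟩
    · exact ⟨j, hj, rfl, by omega⟩

lemma slot_next (i v : Fin I.n) (u : ℕ) : I.Slot i (I.A i).length v u ↔ I.Slot (i + 1) 0 v u := by
  constructor
  · rintro ⟨r, h, hu, h'⟩; exact ⟨r, h, hu, by omega⟩
  · rintro ⟨r, h, hu, h'⟩
    refine ⟨r, h, hu, ?_⟩
    by_cases hv : v = i
    · subst hv; omega
    · rw [Fin.ext_iff] at hv; omega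

lemma slot_last (v : Fin I.n) (u : ℕ) : I.Slot I.n 0 v u ↔ ∃ h : u < I.n, I.G.Adj v ⟨u, h⟩ := by
  constructor
  · rintro ⟨r, h, rfl, -⟩
    exact ⟨Fin.is_lt _, mem_A.1 (List.getElem_mem h)⟩
  · rintro ⟨h, h'⟩
    obtain ⟨r, hr, e⟩ := List.getElem_of_mem (mem_A.2 h')
    exact ⟨r, hr, by rw [e], Or.inl v.2⟩

end Inst

end VertexConn

/-! ### The preprocessing on the machine -/

namespace VertexConn

open WordRam

namespace Inst

variable {I : Inst} {ω : ℕ → Fin I.W}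

variable (I) in
/-- The state holds the input and the constants. -/
structure Consts (s : State) : Prop extends Base I s where
  v4 : s.var 4 = I.B
  v5 : s.var 5 = 2 ^ I.h
  v6 : s.var 6 = I.h
  v7 : s.var 7 = I.NC
  v8 : s.var 8 = 84 * I.ℓ * I.h
  v9 : s.var 9 = 42 * I.ℓ * I.h
  v10 : s.var 10 = open Classical in (List.finRange I.n).countP fun v => decide (v ∈ I.T)
  v11 : s.var 11 = I.k + 2 * I.ℓ
  v12 : s.var 12 = 8 * I.k

lemma Consts.congr {s s' : State} (h : I.Consts s) (hv : ∀ x < 13, s'.var x = s.var x)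
    (ha : ∀ a < 4, s'.arr a = s.arr a) : I.Consts s' := by
  refine ⟨h.toBase.congr (fun x hx => hv x (by omega)) (fun a h => ha a (by omega)),
    ?_, ?_, ?_, ?_, ?_, ?_, ?_, ?_, ?_⟩
  · rw [hv 4 (by omega), h.v4]
  · rw [hv 5 (by omega), h.v5]
  · rw [hv 6 (by omega), h.v6]
  · rw [hv 7 (by omega), h.v7]
  · rw [hv 8 (by omega), h.v8]
  · rw [hv 9 (by omega), h.v9]
  · rw [hv 10 (by omega), h.v10]
  · rw [hv 11 (by omega), h.v11]
  · rw [hv 12 (by omega), h.v12]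

lemma Consts.env {s : State} (h : I.Consts s) (ht : I.TrieOk fun v c => s.arr 4 (I.pair v c)) :
    I.Env s :=
  ⟨h.toBase, h.v4, h.v5, h.v7, h.v8, h.v9, h.v10, h.v11, h.v12, ht⟩

lemma wp_setup {s : State} (hs : I.Base s) :
    wp ω Alg.setup s fun s' t => I.Consts s' ∧ t ≤ 100 * I.n := by
  have hW := I.one_lt_W
  have h₁ := I.two_B_le
  have h₂ := I.B_ge
  have h₃ := I.n_cube_ge
  have h₄ := I.n_sq_ge
  have h₅ := I.hn
  have h₆ := I.h_le_n
  have h₇ := I.hk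
  have h₈ := I.hkn
  have h₉ := I.NC_le
  have h₁₀ := I.ℓh_le
  have h₁₁ := I.two_pow_le
  refine wp_seq (wp_set (a := I.B) (eval_mul (eval_mul (eval_mul (eval_var hs.v0) (eval_var hs.v0)
    (by omega)) (eval_var hs.v0) (by omega)) (eval_var hs.v0) (by unfold B at h₁; omega)) ?_)
  refine wp_seq (wp_set (eval_lit hW) (wp_seq (wp_set (eval_lit (by omega)) ?_)))
  -- Doubling stops once the power exceeds n, which happens at exponent h; h ≤ n, so n rounds
  -- suffice.
  refine wp_seq (wp_forVar (N := I.n) (fun j s' t => s'.var 6 = min j I.h ∧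
    s'.var 5 = 2 ^ min j I.h ∧ t ≤ 2 + 20 * j) (by decide) (by decide) (by decide)
    (by simpa using hs.v0) (by omega) hW (by simp) ?_ ?_)
  · rintro j s' t hj h13 hs' ⟨hv6, hv5, ht⟩
    have hv0 : s'.var 0 = I.n := by rw [hs'.var 0 (by decide)]; simpa using hs.v0
    refine wp_ite (eval_lt (eval_var hv0) (eval_var hv5) hW) (fun h => wp_skip ?_) (fun h => ?_)
    · have h := of_ite_ne_zero h
      rw [← Nat.size_le] at h
      have h : I.h ≤ min j I.h := h
      refine ⟨?_, ?_, ?_⟩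
      · simp only [State.setv_var]; rw [if_neg (by decide), hv6]; omega
      · simp only [State.setv_var]
        rw [if_neg (by decide), hv5, show min j I.h = min (j + 1) I.h by omega]
      · simp only [Expr.cost]; omega
    · have h := not_of_ite_eq_zero h
      rw [← Nat.size_le] at h
      have h : ¬ I.h ≤ min j I.h := h
      have h' : 2 ^ min j I.h ≤ 2 ^ I.h := Nat.pow_le_pow_right (by omega) (by omega)
      refine wp_seq (wp_set (eval_add (eval_var hv5) (eval_var hv5) (by omega)) ?_)
      refine wp_set (eval_add (eval_var (a := min j I.h) (by simpa using hv6)) (eval_lit hW)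
        (by omega)) ⟨?_, ?_, ?_⟩
      · simp; omega
      · simp only [State.setv_var]
        rw [if_neg (by decide), if_neg (by decide), if_pos trivial,
          show min (j + 1) I.h = min j I.h + 1 by omega, pow_succ]
        omega
      · simp only [Expr.cost]; omega
  rintro s₁ t₁ - hs₁ ⟨hv6, hv5, ht₁⟩
  rw [min_eq_right h₆] at hv6 hv5
  have hB₁ : I.Base s₁ := hs.congr
    (fun x hx => by
      rw [hs₁.var x (by simp [Prog.wv]; omega)]
      simp only [State.setv_var]
      iterate 3 rw [if_neg (by omega)])
    (fun a ha => by rw [hs₁.arr a (by simp [Prog.wa])]; simp)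
  have hv4 : s₁.var 4 = I.B := by rw [hs₁.var 4 (by decide)]; simp
  clear hs₁
  refine wp_seq (wp_set (a := I.NC) (eval_mul (eval_mul (eval_mul (eval_lit (by omega))
    (eval_var hB₁.v2) (by omega)) (eval_var hv6) (by omega)) (eval_var hv6)
    (by unfold NC at h₉; omega)) ?_)
  have e84 : 84 * I.ℓ * I.h ≤ 400 * I.ℓ * I.h :=
    Nat.mul_le_mul_right _ (Nat.mul_le_mul_right _ (by norm_num))
  have e42 : 42 * I.ℓ * I.h ≤ 400 * I.ℓ * I.h :=
    Nat.mul_le_mul_right _ (Nat.mul_le_mul_right _ (by norm_num))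
  refine wp_seq (wp_set (a := 84 * I.ℓ * I.h) (eval_mul (eval_mul (eval_lit (by omega))
    (eval_var (by simpa using hB₁.v2)) (by omega)) (eval_var (by simpa using hv6)) (by omega)) ?_)
  refine wp_seq (wp_set (a := 42 * I.ℓ * I.h) (eval_mul (eval_mul (eval_lit (by omega))
    (eval_var (by simpa using hB₁.v2)) (by omega)) (eval_var (by simpa using hv6)) (by omega)) ?_)
  refine wp_seq (wp_set (a := I.k + 2 * I.ℓ) (eval_add (eval_var (by simpa using hB₁.v1))
    (eval_mul (eval_lit (by omega)) (eval_var (by simpa using hB₁.v2)) (by omega)) (by omega)) ?_)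
  refine wp_seq (wp_set (a := 8 * I.k) (eval_mul (eval_lit (by omega))
    (eval_var (by simpa using hB₁.v1)) (by omega)) ?_)
  refine wp_seq (wp_set (eval_lit (by omega)) ?_)
  classical
  refine wp_forVar (N := I.n) (fun j s' t => s'.var 10 =
    ((List.finRange I.n).take j).countP (fun v => decide (v ∈ I.T)) ∧ t ≤ 2 + 13 * j)
    (by decide) (by decide) (by decide) (by simpa using hB₁.v0) (by omega) hW (by simp) ?_ ?_
  · rintro j s' t hj h13 hs' ⟨hv10, ht⟩
    have hle : ((List.finRange I.n).take j).countP (fun v => decide (v ∈ I.T)) ≤ I.n :=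
      List.countP_le_length.trans (by simp)
    have hter : s'.arr 2 j = if (⟨j, hj⟩ : Fin I.n) ∈ I.T then 1 else 0 := by
      rw [hs'.arr 2 (by decide)]
      simpa using hB₁.ter ⟨j, hj⟩
    refine wp_set (eval_add (eval_var hv10) (eval_get (eval_var h13) hter)
      (by split_ifs <;> omega)) ⟨?_, by simp only [Expr.cost]; omega⟩
    have htake : (List.finRange I.n).take (j + 1) = (List.finRange I.n).take j ++ [⟨j, hj⟩] := by
      rw [List.take_add_one, List.getElem?_eq_getElem (by simpa using hj)]; simp
    rw [htake, List.countP_append]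
    simp [List.countP_cons]
  · rintro s' t - hs' ⟨hv10, ht⟩
    refine ⟨⟨hB₁.congr ?_ ?_, ?_, ?_, ?_, ?_, ?_, ?_, ?_, ?_, ?_⟩, ?_⟩
    · intro x hx
      rw [hs'.var x (by simp [Prog.wv]; omega)]
      simp only [State.setv_var]
      iterate 6 rw [if_neg (by omega)]
    · intro a ha
      rw [hs'.arr a (by simp [Prog.wa])]; rfl
    · rw [hs'.var 4 (by decide)]; simpa using hv4
    · rw [hs'.var 5 (by decide)]; simpa using hv5
    · rw [hs'.var 6 (by decide)]; simpa using hv6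
    · rw [hs'.var 7 (by decide)]; simp
    · rw [hs'.var 8 (by decide)]; simp
    · rw [hs'.var 9 (by decide)]; simp
    · rw [hv10, List.take_of_length_le (by simp)]
    · rw [hs'.var 11 (by decide)]; simp
    · rw [hs'.var 12 (by decide)]; simp
    · simp only [Expr.cost]; omega

lemma wp_parentStep {s : State} (hE : I.Consts s) {v : Fin I.n} {c m : ℕ} {S : Fin I.n → ℕ → Prop}
    (h14 : s.var 14 = v) (h17 : s.var 17 = c) (h19 : s.var 19 = m) (hc : 2 ≤ c)
    (hc' : c < 2 * 2 ^ I.h) (hm : m + 1 < I.B) (hB : I.Build (s.arr 5) (s.arr 4) m S v (c / 2))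
    (hne : s.arr 4 (I.pair v c) ≠ 0) :
    wp ω Alg.parentStep s fun s' t => t ≤ 60 ∧ s'.var 17 = c / 2 ∧ (∃ m', m' ≤ m + 1 ∧
      s'.var 19 = m' ∧ I.Build (s'.arr 5) (s'.arr 4) m' S v (c / 2 / 2)) ∧
      s'.arr 4 (I.pair v (c / 2)) ≠ 0 := by
  have hW := I.one_lt_W
  have h₁ := I.two_B_le
  have h₂ := I.node_lt_B hc'
  have h₃ := I.fin_lt_B v
  have hlt : ∀ a, s.arr 4 a < I.B := fun a => (hB.name_le a).trans_lt (by omega)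
  set d := c / 2 with hd
  refine wp_seq (wp_set (eval_div (eval_var h17) (eval_lit (by omega)) (by omega)) ?_)
  set l := s.arr 4 (I.pair v (2 * d)) with hl
  set r := s.arr 4 (I.pair v (2 * d + 1)) with hr
  have h4 : s.var 4 = I.B := hE.v4
  -- The child from which the update ascends has a nonzero name, so the pair is nonzero and may be
  -- interned.
  have hkey : I.pair l r ≠ 0 := by
    intro h
    obtain ⟨hl0, hr0⟩ := pair_eq_zero.1 h
    rcases Nat.even_or_odd' c with ⟨e, he | he⟩
    · exact hne (by rw [he, show e = d by omega]; exact hl0)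
    · exact hne (by rw [he, show e = d by omega]; exact hr0)
  refine wp_seq (wp_set (a := I.pair l r) (eval_pr (by simpa using h4)
    (eval_id (v := v) (c := 2 * d) (by simpa using h4) (by simpa using h14)
      (by rw [eval_add (a := d) (b := d) (by simp [Expr.eval, hd]) (by simp [Expr.eval, hd])
        (by omega)]; omega) (by omega))
    (eval_id (v := v) (c := 2 * d + 1) (by simpa using h4) (by simpa using h14)
      (by rw [eval_add (a := d + d) (b := 1) (eval_add (by simp [Expr.eval, hd])
        (by simp [Expr.eval, hd]) (by omega)) (eval_lit hW) (by omega)]; omega) (by omega))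
    (hlt _) (hlt _)) ?_)
  set s₁ := (s.setv 17 (c / 2)).setv 20 (I.pair l r) with hs₁
  have hpair : ∀ s' : State, s'.var 4 = I.B → s'.var 14 = v → s'.var 17 = d →
      (Alg.pr (.var 14) (.var 17)).eval I.W s' = I.pair v d := fun s' h h' h'' =>
    eval_pr h (eval_var h') (eval_var h'') h₃ (by omega)
  refine wp_seq (wp_ite (a := s.arr 5 (I.pair l r)) (eval_get (j := I.pair l r)
    (eval_var (by simp [hs₁])) (by simp [hs₁])) (fun hD => wp_skip ?_) (fun hD => ?_))
  · refine wp_put (hpair s₁ (by simpa [hs₁] using h4) (by simpa [hs₁] using h14)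
      (by simp [hs₁, hd])) (c := s.arr 5 (I.pair l r)) (eval_get (j := I.pair l r)
      (eval_var (by simp [hs₁])) (by simp [hs₁])) ⟨by simp only [Expr.cost]; omega, by simp [hs₁, hd],
        ⟨m, by omega, by simpa [hs₁] using h19, ?_⟩, ?_⟩
    · have := hB.set_parent (by omega) (by omega) hD
      simpa [hs₁] using this
    · simpa [hs₁] using hD
  · refine wp_seq (wp_set (eval_add (eval_var (a := m) (by simpa [hs₁] using h19)) (eval_lit hW)
      (by omega)) (wp_put (j := I.pair l r) (c := m + 1) (eval_var (by simp [hs₁]))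
      (eval_var (by simp)) ?_))
    refine wp_put (c := m + 1) (hpair _ (by simpa [hs₁] using h4) (by simpa [hs₁] using h14)
      (by simp [hs₁, hd])) (eval_get (j := I.pair l r) (eval_var (by simp [hs₁])) (by simp))
      ⟨by simp only [Expr.cost]; omega, by simp [hs₁, hd],
        ⟨m + 1, by omega, by simp, ?_⟩, ?_⟩
    · have := (hB.intern hkey hD).set_parent (by omega) (by omega) (by simp [← hl, ← hr])
      simpa [hs₁, ← hl, ← hr] using this
    · simp

end Inst

end VertexConn

namespace VertexConn

open WordRam

namespace Inst

variable {I : Inst} {ω : ℕ → Fin I.W}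

lemma wp_insertStep {s : State} (hE : I.Consts s) {v : Fin I.n} {j m : ℕ}
    {S : Fin I.n → ℕ → Prop} (hj : j < (I.A v).length) (h14 : s.var 14 = v) (h15 : s.var 15 = j)
    (h19 : s.var 19 = m) (hm : m + I.h + 1 < I.B) (hB : I.Build (s.arr 5) (s.arr 4) m S v 0) :
    wp ω Alg.insertStep s fun s' t => t ≤ 40 + 70 * I.h ∧ ∃ m', m' ≤ m + I.h ∧
      s'.var 19 = m' ∧ I.Build (s'.arr 5) (s'.arr 4) m'
        (fun v' u' => S v' u' ∨ v' = v ∧ u' = (I.A v)[j]) v 0 := by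
  have hW := I.one_lt_W
  have h₁ := I.two_B_le
  have h₂ := I.n_lt_two_pow
  set u : ℕ := (I.A v)[j] with hu
  have hun : u < 2 ^ I.h := ((I.A v)[j]).2.trans h₂
  refine wp_seq (wp_set (a := u) (hE.toBase.eval_nbr h14 h15 hj) ?_)
  refine wp_seq (wp_set (a := 2 ^ I.h + u) (eval_leaf (u := (I.A v)[j]) (by simpa using hE.v5)
    (by simp [hu])) ?_)
  refine wp_seq (wp_put (j := I.pair v (2 ^ I.h + u)) (eval_pr (by simpa using hE.v4)
    (eval_var (by simpa using h14)) (eval_var (by simp)) (I.fin_lt_B v)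
    (I.node_lt_B (by omega))) (eval_lit hW) ?_)
  have hdiv : ∀ i, (2 ^ I.h + u) / 2 ^ i / 2 = (2 ^ I.h + u) / 2 ^ (i + 1) := fun i => by
    rw [pow_succ, Nat.div_div_eq_div_mul]
  refine wp_forVar (N := I.h) (fun i s' t => t ≤ 2 + 68 * i ∧
    s'.var 17 = (2 ^ I.h + u) / 2 ^ i ∧ (∃ m', m' ≤ m + i ∧ s'.var 19 = m' ∧
      I.Build (s'.arr 5) (s'.arr 4) m' (fun v' u' => S v' u' ∨ v' = v ∧ u' = u) v
        ((2 ^ I.h + u) / 2 ^ i / 2)) ∧ s'.arr 4 (I.pair v ((2 ^ I.h + u) / 2 ^ i)) ≠ 0)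
    (by decide) (by decide) (by decide) (by simpa using hE.v6) (by omega) hW
    ⟨by omega, by simp, ⟨m, le_rfl, by simpa using h19, ?_⟩, by simp⟩ ?_ ?_
  · simpa using hB.set_leaf v hun
  · rintro i s' t hi - hs' ⟨ht, h17, ⟨m', hm', h19', hB'⟩, hne⟩
    have hE' : I.Consts s' := hE.congr
      (fun x hx => by
        rw [hs'.var x (by simp [Alg.parentStep, Prog.wv]; omega)]
        simp only [State.seta_var, State.setv_var]
        iterate 2 rw [if_neg (by omega)])
      (fun a ha => by
        rw [hs'.arr a (by simp [Alg.parentStep, Prog.wa]; omega), State.seta_arr,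
          if_neg (by omega)]
        rfl)
    have hc : 2 ≤ (2 ^ I.h + u) / 2 ^ i := by
      rw [Nat.le_div_iff_mul_le (by positivity), ← pow_succ']
      exact (Nat.pow_le_pow_right (by omega) hi).trans (by omega)
    refine wp_mono (wp_parentStep hE' (v := v)
      (by rw [hs'.var 14 (by decide)]; simpa using h14) h17 h19' hc
      ((Nat.div_le_self _ _).trans_lt (by omega)) (by omega) hB' hne) ?_
    rintro s'' t' ⟨ht', h17', ⟨m'', hm'', h19'', hB''⟩, hne'⟩ -
    rw [hdiv] at h17' hB'' hne'
    exact ⟨by omega, by simpa using h17',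
      ⟨m'', by omega, by simpa using h19'', by simpa using hB''⟩, by simpa using hne'⟩
  · rintro s' t - hs' ⟨ht, h17, ⟨m', hm', h19', hB'⟩, -⟩
    refine ⟨by simp only [Expr.cost]; omega, m', hm', h19', ?_⟩
    -- After h steps the root has been repaired and the exception has moved to position 0, which is
    -- not a node.
    rwa [hdiv, pow_succ, Nat.div_eq_of_lt (by omega)] at hB'

/-- Each list entry introduces at most h new names. All names therefore stay below B, so that they
can be paired without overflow. -/
lemma name_bound {x : ℕ} (hx : x ≤ I.n * I.n) : 1 + x * I.h + I.h + 1 < I.B := by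
  have h₁ : x * I.h ≤ I.n * I.n * I.n := Nat.mul_le_mul hx I.h_le_n
  have := I.B_ge; have := I.n_cube_ge; have := I.n_sq_ge; have := I.hn; have := I.h_le_n
  omega

lemma wp_vertex {s : State} (hE : I.Consts s) {v : Fin I.n} {m : ℕ} (h14 : s.var 14 = v)
    (h19 : s.var 19 = m) (hm : m ≤ 1 + I.off v * I.h)
    (hB : I.Build (s.arr 5) (s.arr 4) m (I.Slot v 0) v 0) :
    wp ω (.set 18 (Alg.degE 14) ;; forVar 15 18 Alg.insertStep) s fun s' t =>
      t ≤ 20 + (48 + 70 * I.h) * (I.A v).length ∧ ∃ m', m' ≤ 1 + I.off (v + 1) * I.h ∧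
      s'.var 19 = m' ∧ I.Build (s'.arr 5) (s'.arr 4) m' (I.Slot (v + 1) 0) v 0 := by
  have hW := I.one_lt_W
  have h₁ := I.two_B_le
  have h₂ := I.length_A_le v
  have hoff := I.off_succ v
  have hoff' := I.off_le (v + 1)
  have h₃ := I.name_bound hoff'
  have h₄ := I.B_ge
  have h₅ := I.n_cube_ge
  have h₆ := I.n_sq_ge
  refine wp_seq (wp_set (hE.toBase.eval_deg h14) ?_)
  refine wp_forVar (N := (I.A v).length) (fun j s' t => t ≤ 2 + (48 + 70 * I.h) * j ∧
    ∃ m', m' ≤ 1 + (I.off v + j) * I.h ∧ s'.var 19 = m' ∧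
      I.Build (s'.arr 5) (s'.arr 4) m' (I.Slot v j) v 0)
    (by decide) (by decide) (by decide) (by simp) (by omega) hW
    ⟨by omega, m, hm, by simpa using h19, by simpa using hB⟩ ?_ ?_
  · rintro j s' t hj h15 hs' ⟨ht, m', hm', h19', hB'⟩
    have hE' : I.Consts s' := hE.congr
      (fun x hx => by
        rw [hs'.var x (by simp [Alg.insertStep, Alg.parentStep, forVar, Prog.wv]; omega),
          State.setv_var, if_neg (by omega)])
      (fun a ha => by
        rw [hs'.arr a (by simp [Alg.insertStep, Alg.parentStep, forVar, Prog.wa]; omega)]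
        rfl)
    have h₇ := I.name_bound (x := I.off v + j) (by omega)
    refine wp_mono (wp_insertStep hE' hj (by rw [hs'.var 14 (by decide)]; simpa using h14) h15 h19'
      (by omega) hB') ?_
    rintro s'' t' ⟨ht', m'', hm'', h19'', hB''⟩ -
    refine ⟨by rw [Nat.mul_succ]; omega, m'', by rw [← add_assoc, Nat.succ_mul]; omega,
      by simpa using h19'', ?_⟩
    exact hB''.congr (fun v' u' => (slot_succ hj v' u').symm) v
  · rintro s' t - - ⟨ht, m', hm', h19', hB'⟩
    exact ⟨by simp only [Expr.cost]; omega, m', by rw [hoff]; exact hm', h19',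
      hB'.congr (slot_next v) v⟩

lemma wp_tries {s : State} (hE : I.Consts s) (h4 : s.arr 4 = fun _ => 0)
    (h5 : s.arr 5 = fun _ => 0) :
    wp ω Alg.tries s fun s' t => I.Env s' ∧ t ≤ 10 + 28 * I.n + (48 + 70 * I.h) * I.off I.n := by
  have hW := I.one_lt_W
  have h₁ := I.two_B_le
  have h₂ := I.hn
  have h₄ := I.B_ge
  have h₅ := I.n_cube_ge
  have h₆ := I.n_sq_ge
  let v₀ : Fin I.n := ⟨0, by omega⟩
  refine wp_seq (wp_set (eval_lit hW) ?_)
  refine wp_forVar (N := I.n) (fun i s' t => t ≤ 2 + 28 * i + (48 + 70 * I.h) * I.off i ∧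
    ∃ m', m' ≤ 1 + I.off i * I.h ∧ s'.var 19 = m' ∧
      I.Build (s'.arr 5) (s'.arr 4) m' (I.Slot i 0) v₀ 0)
    (by decide) (by decide) (by decide) (by simpa using hE.v0) (by omega) hW
    ⟨by omega, 1, by omega, by simp, ?_⟩ ?_ ?_
  · have := (Build.empty v₀).congr (S' := I.Slot 0 0) (fun v u => by simp [slot_zero]) v₀
    simpa [h4, h5] using this
  · rintro i s' t hi h14 hs' ⟨ht, m', hm', h19', hB'⟩
    have hE' : I.Consts s' := hE.congr
      (fun x hx => by
        rw [hs'.var x (by simp [Alg.insertStep, Alg.parentStep, forVar, Prog.wv]; omega),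
          State.setv_var, if_neg (by omega)])
      (fun a ha => by
        rw [hs'.arr a (by simp [Alg.insertStep, Alg.parentStep, forVar, Prog.wa]; omega)]
        rfl)
    refine wp_mono (wp_vertex hE' (v := ⟨i, hi⟩) h14 h19' hm' (hB'.congr (fun _ _ => Iff.rfl) _)) ?_
    rintro s'' t' ⟨ht', m'', hm'', h19'', hB''⟩ -
    have hoff := I.off_succ ⟨i, hi⟩
    simp only at hoff
    have hmul := Nat.mul_add (48 + 70 * I.h) (I.off i) (I.A ⟨i, hi⟩).length
    refine ⟨by rw [hoff]; omega, m'', hm'', by simpa using h19'', ?_⟩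
    exact hB''.congr (fun _ _ => Iff.rfl) v₀
  · rintro s' t - hs' ⟨ht, m', hm', h19', hB'⟩
    have hE' : I.Consts s' := hE.congr
      (fun x hx => by
        rw [hs'.var x (by simp [Alg.insertStep, Alg.parentStep, forVar, Prog.wv]; omega),
          State.setv_var, if_neg (by omega)])
      (fun a ha => by
        rw [hs'.arr a (by simp [Alg.insertStep, Alg.parentStep, forVar, Prog.wa]; omega)]
        rfl)
    have h₇ := I.name_bound (I.off_le I.n)
    exact ⟨hE'.env (hB'.trieOk (by omega) slot_last), by simp only [Expr.cost]; omega⟩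

end Inst

end VertexConn

/-! ### The whole algorithm on an input -/

namespace VertexConn

open WordRam

namespace Alg

/-- The kernelization algorithm. -/
def kernelize : Prog := setup ;; tries ;; forVar 21 3 round

end Alg

namespace Inst

variable {I : Inst} {ω : ℕ → Fin I.W}

lemma length_X_le : I.X.length ≤ I.n := by simpa using I.hX.length_le_card

lemma wp_main {s : State} {C : ℝ} (hC5 : 5000 ≤ C) (hs : I.Base s)
    (ha : ∀ a, 4 ≤ a → s.arr a = fun _ => 0) (ho : s.out = []) :
    wp ω Alg.kernelize s fun s' t => t ≤ 130 * I.n + (48 + 70 * I.h) * I.off I.n +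
        I.X.length * (I.roundCost + 8) ∧
      (I.Good → IsCorrectOutput C I.G I.k I.ℓ I.X I.T s'.out) := by
  have hW := I.one_lt_W
  have h₁ := I.two_B_le
  have h₂ := I.hn
  have h₃ := I.length_X_le
  have h₄ := I.B_ge
  have h₅ := I.n_cube_ge
  have h₆ := I.n_sq_ge
  refine wp_seq (wp_mono (wp_setup hs) ?_)
  rintro s₁ t₁ ⟨hE₁, ht₁⟩ hs₁
  have ha₁ : ∀ a, 4 ≤ a → s₁.arr a = fun _ => 0 := fun a h => by
    rw [hs₁.arr a (by simp [Alg.setup, forVar, Prog.wa]), ha a h]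
  refine wp_seq (wp_mono (wp_tries hE₁ (ha₁ 4 le_rfl) (ha₁ 5 (by omega))) ?_)
  rintro s₂ t₂ ⟨hE₂, ht₂⟩ hs₂
  have ha₂ : ∀ a, 6 ≤ a → s₂.arr a = fun _ => 0 := fun a h => by
    rw [hs₂.arr a (by simp [Alg.tries, Alg.insertStep, Alg.parentStep, forVar, Prog.wa]; omega),
      ha₁ a (by omega)]
  have ho₂ : s₂.out = [] := by rw [hs₂.out rfl, hs₁.out rfl, ho]
  refine wp_forVar (N := I.X.length) (fun i s' t => t ≤ 2 + i * (I.roundCost + 8) ∧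
    (∃ f, s'.out = (I.X.take i).flatMap f ∧
      (I.Good → ∀ x ∈ I.X.take i, IsCorrectAnswer C I.G I.k I.ℓ I.T x (f x))) ∧
    (∀ i', i ≤ i' → ∀ w : Fin I.n, s'.arr 6 (I.pair i' w) = 0) ∧
    (∀ i', i ≤ i' → ∀ w : Fin I.n, s'.arr 7 (I.pair i' w) = 0) ∧
    (∀ i', i ≤ i' → ∀ w : Fin I.n, s'.arr 8 (I.pair i' w) = 0))
    (by decide) (by decide) (by decide) hE₂.v3 (by omega) hW
    ⟨by omega, ⟨fun _ => [], by simpa using ho₂, by simp⟩, by simp [ha₂], by simp [ha₂],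
      by simp [ha₂]⟩ ?_ ?_
  · rintro i s' t hi h21 hs' ⟨ht, ⟨f, hf, hcor⟩, h6, h7, h8⟩
    have hE' : I.Env s' := hE₂.same hs' (by decide) (by decide)
    refine wp_mono (wp_round hC5 hE' hi h21 h6 h7 h8) ?_
    rintro s'' t' ⟨ht', ⟨ws, hws, hans⟩, h6', h7', h8'⟩ -
    have htake : I.X.take (i + 1) = I.X.take i ++ [I.X[i]] := by
      rw [List.take_add_one, List.getElem?_eq_getElem hi]; rfl
    -- Since X has no repetitions, recording the new answer does not overwrite an earlier one.
    have hnot : ∀ x ∈ I.X.take i, x ≠ I.X[i] := by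
      rintro x hx rfl
      have h := I.hX.sublist (I.X.take_sublist (i + 1))
      rw [htake, List.nodup_append] at h
      exact h.2.2 _ hx _ (by simp) rfl
    refine ⟨by rw [Nat.succ_mul]; omega, ⟨Function.update f I.X[i] ws, ?_, ?_⟩,
      fun i' hi' => h6' i' hi', fun i' hi' => h7' i' hi', fun i' hi' => h8' i' hi'⟩
    · rw [State.setv_out, hws, hf, htake, List.flatMap_append]
      congr 1
      · simp only [List.flatMap_def]
        congr 1
        exact List.map_congr_left fun x hx => (Function.update_of_ne (hnot x hx) _ _).symm
      · simp
    · intro hG x hx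
      rw [htake, List.mem_append, List.mem_singleton] at hx
      rcases hx with hx | rfl
      · rw [Function.update_of_ne (hnot x hx)]; exact hcor hG x hx
      · rw [Function.update_self]; exact hans hG
  · rintro s' t - - ⟨ht, ⟨f, hf, hcor⟩, -⟩
    rw [List.take_length] at hf hcor
    exact ⟨by omega, fun hG => ⟨f, hf, hcor hG⟩⟩

lemma getElem?_flatMap_A (v : Fin I.n) {r : ℕ} (hr : r < (I.A v).length) :
    ((List.finRange I.n).flatMap I.A)[I.off v + r]? = some (I.A v)[r] := by
  have hsplit : List.finRange I.n =
      (List.finRange I.n).take v ++ v :: (List.finRange I.n).drop (v + 1) := by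
    conv_lhs => rw [← List.take_append_drop v (List.finRange I.n)]
    rw [List.drop_eq_getElem_cons (by simp)]
    simp
  have hlen : (((List.finRange I.n).take v).flatMap I.A).length = I.off v := by
    rw [List.length_flatMap]; rfl
  rw [hsplit, List.flatMap_append, List.flatMap_cons, List.getElem?_append_right (by omega), hlen,
    Nat.add_sub_cancel_left, List.getElem?_append_left hr, List.getElem?_eq_getElem hr]

lemma base_input : I.Base (input I.A I.k I.ℓ I.X I.T) := by
  have hmap : ∀ l : List (Fin I.n), (l >>= fun a => pure (a : ℕ)) = l.map Fin.val := fun l => by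
    rw [List.map_eq_flatMap]; rfl
  refine ⟨rfl, rfl, rfl, rfl, fun i hi => ?_, fun v r h => ?_, fun v => ?_, fun i h => ?_⟩
  · simp only [input]
    rw [if_pos hi]; rfl
  · have := I.getElem?_flatMap_A v h
    simp only [input, List.getD_eq_getElem?_getD, List.getElem?_map, hmap, this]
    rfl
  · simp only [input]
    rw [dif_pos v.2]
  · simp only [input, List.getD_eq_getElem?_getD, List.getElem?_map, hmap,
      List.getElem?_eq_getElem h]
    rfl

lemma off_eq : I.off I.n = 2 * I.G.edgeSet.ncard := by
  classical
  rw [← I.G.coe_edgeFinset, Set.ncard_coe_finset, ← I.G.sum_degrees_eq_twice_card_edges, off,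
    List.take_of_length_le (by simp), ← List.ofFn_eq_map, List.sum_ofFn]
  refine Finset.sum_congr rfl fun v _ => ?_
  rw [← card_N, ← I.G.card_neighborFinset_eq_degree]
  congr 1
  ext u
  simp

end Inst

end VertexConn

/-! ### The final bounds on time and failure probability -/

namespace VertexConn

open WordRam

namespace Inst

variable {I : Inst}

/-- All degrees are at least k ≥ 2. This absorbs the O(n) cost of the preprocessing into the number
of edges. -/
lemma n_le_edges : I.n ≤ I.G.edgeSet.ncard := by
  have h₁ : (List.map (fun v => (I.A v).length) (List.finRange I.n)).length • I.k ≤ I.off I.n := by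
    rw [off, List.take_of_length_le (by simp)]
    refine List.card_nsmul_le_sum _ _ fun a ha => ?_
    obtain ⟨v, -, rfl⟩ := List.mem_map.1 ha
    exact I.hdeg v
  have h₂ := I.hk
  have h₃ := I.hℓ
  have h₄ : I.n * 2 ≤ I.n * I.k := Nat.mul_le_mul_left _ (by omega)
  rw [List.length_map, List.length_finRange, smul_eq_mul, off_eq] at h₁
  omega

lemma time_le {t : ℕ} (ht : t ≤ 130 * I.n + (48 + 70 * I.h) * I.off I.n +
    I.X.length * (I.roundCost + 8)) :
    (t : ℝ) ≤ 30000000 * (I.G.edgeSet.ncard + I.X.length * I.k * I.ℓ) * Real.log I.n ^ 2 := by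
  have hL := I.one_le_log
  have hh := I.h_le_log
  have hn : (I.n : ℝ) ≤ I.G.edgeSet.ncard := by exact_mod_cast I.n_le_edges
  have hℓ : (1 : ℝ) ≤ I.ℓ := by exact_mod_cast I.hℓ
  have hk : (1 : ℝ) ≤ I.k := by exact_mod_cast (by have := I.hk; have := I.hℓ; omega : 1 ≤ I.k)
  have ht' : (t : ℝ) ≤ 130 * I.n + (48 + 70 * I.h) * (2 * I.G.edgeSet.ncard) +
      I.X.length * (4000000 * (I.k * I.ℓ * I.h * I.h) + 8) := by
    rw [off_eq, roundCost] at ht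
    exact_mod_cast ht
  set L := Real.log I.n
  set m : ℝ := (I.G.edgeSet.ncard : ℝ)
  have h₁ : (I.h : ℝ) ≤ 5 / 2 * L := by linarith
  have h₂ : (I.h : ℝ) * I.h ≤ 25 / 4 * L ^ 2 := by
    calc (I.h : ℝ) * I.h ≤ (5 / 2 * L) * (5 / 2 * L) := by gcongr
      _ = 25 / 4 * L ^ 2 := by ring
  have h₃ : L ≤ L ^ 2 := by nlinarith
  have hm : 0 ≤ m := by positivity
  have h₄ : (1 : ℝ) ≤ I.k * I.ℓ := one_le_mul_of_one_le_of_one_le hk hℓ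
  have h₅ : 130 * (I.n : ℝ) + (48 + 70 * I.h) * (2 * m) ≤ 30000000 * (m * L ^ 2) := by
    have : (48 + 70 * (I.h : ℝ)) ≤ 223 * L ^ 2 := by linarith
    have e₁ := mul_le_mul_of_nonneg_right this hm
    have e₂ : m * 1 ≤ m * L ^ 2 := mul_le_mul_of_nonneg_left (by linarith) hm
    nlinarith
  -- h² ≤ (25/4) ln² n turns 4000000 into 25000000; the rest of the constant covers the overhead of
  -- 8 per round.
  have h₆ : 4000000 * ((I.k : ℝ) * I.ℓ * I.h * I.h) + 8 ≤ 30000000 * (I.k * I.ℓ * L ^ 2) := by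
    have e₁ := mul_le_mul_of_nonneg_left h₂ (zero_le_one.trans h₄)
    have e₂ : 1 * 1 ≤ (I.k : ℝ) * I.ℓ * L ^ 2 := mul_le_mul h₄ (by linarith) (by norm_num)
      (zero_le_one.trans h₄)
    nlinarith
  calc (t : ℝ) ≤ _ := ht'
    _ ≤ 30000000 * (m * L ^ 2) + I.X.length * (30000000 * (I.k * I.ℓ * L ^ 2)) :=
      add_le_add h₅ (mul_le_mul_of_nonneg_left h₆ (by positivity))
    _ = _ := by ring

/-- From n < 2^h ≤ e^h follows e^(-5h) ≤ n^(-5); the union over n² pairs leaves n^(-3). -/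
lemma sq_mul_exp_le : (I.n : ℝ) * I.n * Real.exp (-(5 * I.h)) ≤ 1 / (I.n : ℝ) ^ 3 := by
  have hn : (0 : ℝ) < I.n := by exact_mod_cast (by have := I.hn; omega : 0 < I.n)
  have h₁ : (I.n : ℝ) ≤ Real.exp I.h := by
    have h₂ : (I.n : ℝ) ≤ 2 ^ I.h := by exact_mod_cast I.n_lt_two_pow.le
    refine h₂.trans ?_
    rw [← Real.exp_one_pow]
    gcongr
    linarith [Real.exp_one_gt_d9]
  rw [Real.exp_neg, ← div_eq_mul_inv, div_le_div_iff₀ (Real.exp_pos _) (by positivity), one_mul]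
  calc (I.n : ℝ) * I.n * I.n ^ 3 = I.n ^ 5 := by ring
    _ ≤ Real.exp I.h ^ 5 := by gcongr
    _ = Real.exp (5 * I.h) := by rw [← Real.exp_nat_mul]; norm_num

end Inst

/-- A lower bound on the degrees of a graph is smaller than the number of its vertices. -/
lemma lt_of_le_degree {n k : ℕ} {G : SimpleGraph (Fin n)} (v : Fin n)
    (h : k ≤ (G.neighborSet v).ncard) : k < n := by
  classical
  have h₁ := G.degree_lt_card_verts v
  rw [Set.ncard_eq_toFinset_card'] at h
  rw [Fintype.card_fin] at h₁
  exact h.trans_lt h₁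

/-- The bound on ℓ bootstraps itself: with ln n ≥ ln 2 it gives n > k > 69, hence ln n ≥ 4, and then
k ≥ 100 ℓ ln n ≥ 400ℓ. -/
lemma size_bounds {n k ℓ : ℕ} (hℓ : 1 ≤ ℓ) (hk : 0 < n → k < n)
    (h : (ℓ : ℝ) ≤ k / (100 * Real.log n)) : 400 ≤ n ∧ 400 * ℓ ≤ k ∧ k < n := by
  have hℓ' : (1 : ℝ) ≤ ℓ := by exact_mod_cast hℓ
  have hn : 2 ≤ n := by
    by_contra! hn
    -- For n ≤ 1 the denominator is 0, so the quotient is 0 by convention and contradicts ℓ ≥ 1.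
    have : Real.log n = 0 := by
      interval_cases n <;> simp
    rw [this, mul_zero, div_zero] at h
    linarith
  have hkn := hk (by omega)
  have hkn' : (k : ℝ) < n := by exact_mod_cast hkn
  have hn' : (2 : ℝ) ≤ n := by exact_mod_cast hn
  have h₁ : Real.log 2 ≤ Real.log n := Real.log_le_log (by norm_num) hn'
  have h₂ := Real.log_two_gt_d9
  rw [le_div_iff₀ (by linarith)] at h
  have h₃ : (69 : ℝ) < n := by nlinarith
  have h₄ : 4 ≤ Real.log n := by
    rw [Real.le_log_iff_exp_le (by linarith), show (4 : ℝ) = (4 : ℕ) by norm_num,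
      ← Real.exp_one_pow]
    calc Real.exp 1 ^ 4 ≤ (2.8 : ℝ) ^ 4 := by
          gcongr
          linarith [Real.exp_one_lt_d9]
      _ ≤ (n : ℝ) := by norm_num; linarith
  have h₅ : (400 : ℝ) * ℓ ≤ k := by nlinarith
  have h₆ : 400 * ℓ ≤ k := by exact_mod_cast h₅
  exact ⟨by omega, h₆, hkn⟩

instance (b n : ℕ) : IsProbabilityMeasure (randomWords b n) := by
  unfold randomWords; infer_instance

end VertexConn

open WordRam VertexConn in
theorem lemma3p5 :
    ∃ (P : Prog) (b d : ℕ) (C : ℝ), 2 ≤ b ∧ 0 < C ∧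
      ∀ (n : ℕ) (G : SimpleGraph (Fin n)) (k ℓ : ℕ) (hℓ : 1 ≤ ℓ)
        (X : List (Fin n)) (A : Fin n → List (Fin n)),
        (∀ v, k ≤ (G.neighborSet v).ncard) →
        (ℓ : ℝ) ≤ k / (100 * Real.log n) →
        X.Nodup →
        IsAdjList G A →
        (∀ (T : Set (Fin n)) (ω : ℕ → Fin (numWords b n)),
          ∃ (s : State) (t : ℕ), Exec ω P (input A k ℓ X T) s t ∧
            (t : ℝ) ≤ C * (G.edgeSet.ncard + X.length * k * ℓ) * Real.log n ^ d) ∧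
        ((setBernoulli Set.univ (sampleRate ℓ hℓ)).prod (randomWords b n))
          {p : Set (Fin n) × (ℕ → Fin (numWords b n)) |
            ¬ ∃ (s : State) (t : ℕ), Exec p.2 P (input A k ℓ X p.1) s t ∧
              IsCorrectOutput C G k ℓ X p.1 s.out}
          ≤ ENNReal.ofReal (1 / (n : ℝ) ^ 3) := by
  -- One constant serves both for the running time and for the number of edges of a kernel; for the
  -- latter 5000 would do.
  refine ⟨Alg.kernelize, 9, 2, 30000000, by norm_num, by norm_num, ?_⟩
  intro n G k ℓ hℓ X A hdeg hbound hX hA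
  obtain ⟨hn, hk, hkn⟩ := size_bounds hℓ (fun h => lt_of_le_degree ⟨0, h⟩ (hdeg _)) hbound
  have hdeg' : ∀ v, k ≤ (A v).length := fun v => by
    classical
    refine (hdeg v).trans_eq ?_
    rw [← List.toFinset_card_of_nodup (hA v).1, ← Set.ncard_coe_finset]
    congr 1
    ext u
    simp [(hA v).2]
  -- The sets F(x,v) do not depend on T, so `I ∅` may stand for any instance in the probability
  -- estimate.
  let I : Set (Fin n) → Inst := fun T => ⟨n, k, ℓ, G, A, X, T, hn, hℓ, hk, hkn, hdeg', hX, hA⟩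
  have hrun : ∀ (T : Set (Fin n)) (ω : ℕ → Fin (numWords 9 n)),
      wp ω Alg.kernelize (input A k ℓ X T) _ := fun T ω =>
    Inst.wp_main (I := I T) (C := 30000000) (by norm_num) Inst.base_input
      (fun a ha => by
        obtain ⟨a, rfl⟩ := Nat.exists_eq_add_of_le ha
        rw [add_comm]
        rfl) rfl
  refine ⟨fun T ω => ?_, ?_⟩
  · obtain ⟨s, t, he, ht, -⟩ := hrun T ω
    exact ⟨s, t, he, Inst.time_le (I := I T) ht⟩
  -- Failure is contained in an event that concerns T alone, so the factor of the random words
  -- contributes 1.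
  · have hbad : {p : Set (Fin n) × (ℕ → Fin (numWords 9 n)) |
        ¬ ∃ (s : State) (t : ℕ), Exec p.2 Alg.kernelize (input A k ℓ X p.1) s t ∧
          IsCorrectOutput 30000000 G k ℓ X p.1 s.out} ⊆
        {T | ∃ q : Fin n × Fin n, 40 * ℓ * n.size ≤ ((I ∅).F q.1 q.2).card ∧
          Disjoint ((I ∅).F q.1 q.2 : Set (Fin n)) T} ×ˢ Set.univ := by
      rintro ⟨T, ω⟩ hp
      refine ⟨?_, trivial⟩
      by_contra hT
      refine hp ?_
      obtain ⟨s, t, he, -, ho⟩ := hrun T ω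
      refine ⟨s, t, he, ho fun x v hc => ?_⟩
      by_contra! hno
      exact hT ⟨(x, v), hc, Set.disjoint_left.2 hno⟩
    refine (measure_mono hbad).trans ?_
    rw [Measure.prod_prod, measure_univ, mul_one]
    refine (setBernoulli_miss_le hℓ _ _).trans (ENNReal.ofReal_le_ofReal ?_)
    refine le_of_eq_of_le ?_ (Inst.sq_mul_exp_le (I := I ∅))
    simp [I, Inst.h]
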